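/- Identify $\mathbb R^4$ with $\mathbb C^2$, with Euclidean inner product $\langle\cdot,\cdot\rangle$ and complex structure $J=i$. For an immersed surface $Y$ let $H$ be its mean curvature vector (the trace of the second fundamental form) and $Y^\perp$ the normal component of its position vector; for a regular planar curve $\Gamma$ let $N=i\Gamma'/|\Gamma'|$ and let $k$ be the curvature with respect to $N$. A smooth immersion $Y:I\times\mathbb R/2\pi\mathbb Z\to\mathbb C^2$, $I$ a nonempty open interval, is called cyclic if $Y(s,t)=r(s)(\cos t\,e_1(s)+\sin t\,e_2(s))+V(s)$ with $r>0$, $(e_1,e_2)$ orthonormal, and $r,e_1,e_2,V$ smooth. Congruence means congruence under $U(2)$. Let $\lambda\neq0$ be a real number. (A) Let $Y$ be a cyclic Lagrangian immersion with $H+\lambda Y^\perp=0$. Then near every point $p$ of its domain, up to a smooth change of parameters and a congruence, $Y$ coincides with an open piece of one of the following: (i) a centered type I (equivariant) surface $(s,t)\mapsto\gamma(s)(\cos t,\sin t)$, where $\gamma=re^{i\phi}$ ($r>0$) is a smooth regular planar curve with $k=\langle\gamma,N\rangle\left(\frac1{|\gamma|^2}-\lambda\right)$; (ii) a product $\mathbb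 S^1(r)\times\Gamma$, where $\lambda r^2=1$ (so $\lambda>0$) and $\Gamma$ is a smooth regular planar self-shrinking curve: $k+\lambda\langle\Gamma,N\rangle=0$; (iii) only at points with $Y(p)=0$: the Lagrangian plane $\mathbb R^2\subset\mathbb C^2$. (B) Type I. Let $Y(s,t)=r(s)e^{i\phi(s)}(\cos t,\sin t)+V(s)$ be an immersion, with $r,\phi,V$ smooth, $r>0$, $V'=e^{i\phi}(W_1,W_2)$ and $W_1,W_2$ real valued. If $H+\lambda Y^\perp=0$, then either $V\equiv0$ (the surface is centered) and $\gamma=re^{i\phi}$ is as in (i), or $\phi\equiv\phi_0$ is constant and $V$ takes values in $e^{i\phi_0}\mathbb R^2$, so that the surface is a piece of a Lagrangian plane through the origin. (C) Type II. Let $Y(s,t)=c\,e^{it}\gamma(s)+V(s)$ be an immersion, with $c$ a real constant, $\gamma=(\gamma_1,\gamma_2)$ a smooth (not necessarily regular) Legendrian curve in $\mathbb S^3$ (that is, $\langle\gamma',i\gamma\rangle=0$), $V$ smooth, $V'=W(\bar\gamma_2,-\bar\gamma_1)$ and $W$ complex valued. If $H+\lambda Y^\perp=0$, then either $\gamma$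 is constant, $\lambda c^2=1$ and, up to congruence, $Y(s,t)=(ce^{it},\Gamma(s))$ with $\Gamma$ as in (ii); or $V\equiv0$, $\lambda c^2=2$ and, up to congruence, $Y(s,t)=\frac c{\sqrt2}(e^{i(t+x(s))},e^{i(t-x(s))})$ with $x$ smooth and $x'\ne0$ (the Clifford torus). (D) Type III. Let $Y(s,t)=c\,(\alpha_1(s)e^{it},\alpha_2(s)e^{-it})+V(s)$ be an immersion, with $c$ a real constant, $\alpha=(\alpha_1,\alpha_2)$ smooth (not necessarily regular), $|\alpha_1|^2-|\alpha_2|^2=-1$, $\langle\alpha_1',i\alpha_1\rangle-\langle\alpha_2',i\alpha_2\rangle=0$, $V$ smooth, $V'=(W|\alpha_2|^2,\overline W\alpha_1\alpha_2)$ and $W$ complex valued. If $H+\lambda Y^\perp=0$, then $\alpha_1\equiv0$ (the degenerate case in which the surface is a product of curves), $\lambda c^2=1$ and, up to congruence, $Y(s,t)=(ce^{-it},\Gamma(s))$ with $\Gamma$ as in (ii). In particular no surface of type III with $\alpha_1\not\equiv0$ is self-similar. -/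

import Mathlib

open scoped ContDiff ComplexConjugate

noncomputable section

namespace CyclicLagrangian

/-- The complex Euclidean plane. The complex structure `J` is multiplication by `Complex.I`. -/
abbrev C2 : Type := EuclideanSpace ℂ (Fin 2)

/-- The Euclidean (real) inner product on `ℂ² = ℝ⁴`. -/
def rdot (v w : C2) : ℝ := (inner ℂ v w).re

/-- The Euclidean (real) inner product on `ℂ = ℝ²`. -/
def cdot (z w : ℂ) : ℝ := (z * conj w).re

/-- Nonempty open intervals of the real line (possibly unbounded). -/
def IsOpenInterval (I : Set ℝ) : Prop := I.Nonempty ∧ IsOpen I ∧ I.OrdConnected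

/-- The parameter domain `I × ℝ`; the surfaces below are `2π`-periodic in the second variable. -/
def strip (I : Set ℝ) : Set (ℝ × ℝ) := I ×ˢ Set.univ

/-! ### Extrinsic geometry of a parametrized surface `Y (s, t)` in `ℂ²` -/

/-- The partial derivative `Y_s`. -/
def dS (Y : ℝ × ℝ → C2) (p : ℝ × ℝ) : C2 := deriv (fun s => Y (s, p.2)) p.1

/-- The partial derivative `Y_t`. -/
def dT (Y : ℝ × ℝ → C2) (p : ℝ × ℝ) : C2 := deriv (fun t => Y (p.1, t)) p.2

/-- `Y` is an immersion on `Ω`. -/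
def IsImmersionOn (Y : ℝ × ℝ → C2) (Ω : Set (ℝ × ℝ)) : Prop :=
  ContDiffOn ℝ ∞ Y Ω ∧ ∀ p ∈ Ω, LinearIndependent ℝ ![dS Y p, dT Y p]

/-- `Y` is Lagrangian on `Ω`: the symplectic form `⟨·, J ·⟩` vanishes on the tangent planes. -/
def IsLagrangianOn (Y : ℝ × ℝ → C2) (Ω : Set (ℝ × ℝ)) : Prop :=
  ∀ p ∈ Ω, rdot (dS Y p) (Complex.I • dT Y p) = 0

/-- The coefficient `E = |Y_s|²` of the induced metric. -/
def metE (Y : ℝ × ℝ → C2) (p : ℝ × ℝ) : ℝ := rdot (dS Y p) (dS Y p)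

/-- The coefficient `F = ⟨Y_s, Y_t⟩` of the induced metric. -/
def metF (Y : ℝ × ℝ → C2) (p : ℝ × ℝ) : ℝ := rdot (dS Y p) (dT Y p)

/-- The coefficient `G = |Y_t|²` of the induced metric. -/
def metG (Y : ℝ × ℝ → C2) (p : ℝ × ℝ) : ℝ := rdot (dT Y p) (dT Y p)

/-- `E G - F²`, which is positive exactly where `Y` is an immersion. -/
def metDet (Y : ℝ × ℝ → C2) (p : ℝ × ℝ) : ℝ := metE Y p * metG Y p - metF Y p ^ 2

/-- The orthogonal projection of `v` onto the tangent plane `Span (Y_s, Y_t)` at `p`. -/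
def tangentPart (Y : ℝ × ℝ → C2) (p : ℝ × ℝ) (v : C2) : C2 :=
  ((metG Y p * rdot v (dS Y p) - metF Y p * rdot v (dT Y p)) / metDet Y p) • dS Y p +
  ((metE Y p * rdot v (dT Y p) - metF Y p * rdot v (dS Y p)) / metDet Y p) • dT Y p

/-- The normal component `v^⊥` of `v` at `p`. -/
def normalPart (Y : ℝ × ℝ → C2) (p : ℝ × ℝ) (v : C2) : C2 := v - tangentPart Y p v

/-- The mean curvature vector: the trace, with respect to the induced metric, of the second
fundamental form `(Y_ij)^⊥`. -/
def meanCurvature (Y : ℝ × ℝ → C2) (p : ℝ × ℝ) : C2 :=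
  (metDet Y p)⁻¹ •
    (metG Y p • normalPart Y p (dS (dS Y) p)
      - (2 * metF Y p) • normalPart Y p (dS (dT Y) p)
      + metE Y p • normalPart Y p (dT (dT Y) p))

/-- The self-similar equation `H + lam Y^⊥ = 0` on `Ω`. -/
def IsSelfSimilarOn (lam : ℝ) (Y : ℝ × ℝ → C2) (Ω : Set (ℝ × ℝ)) : Prop :=
  ∀ p ∈ Ω, meanCurvature Y p + lam • normalPart Y p (Y p) = 0

/-- `Y` is, over the interval `I`, a one-parameter family of full round circles with radius
`r s > 0`, center `V s`, in the affine plane directed by the orthonormal pair `e₁ s, e₂ s`. -/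
def IsCyclicOn (Y : ℝ × ℝ → C2) (I : Set ℝ) : Prop :=
  ∃ (r : ℝ → ℝ) (e₁ e₂ V : ℝ → C2),
    ContDiffOn ℝ ∞ r I ∧ ContDiffOn ℝ ∞ e₁ I ∧ ContDiffOn ℝ ∞ e₂ I ∧ ContDiffOn ℝ ∞ V I ∧
    (∀ s ∈ I, 0 < r s ∧ rdot (e₁ s) (e₁ s) = 1 ∧ rdot (e₂ s) (e₂ s) = 1 ∧
      rdot (e₁ s) (e₂ s) = 0) ∧
    ∀ s ∈ I, ∀ t : ℝ,
      Y (s, t) = r s • (Real.cos t • e₁ s + Real.sin t • e₂ s) + V s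

/-- Near `p`, the surface `Y : Ω → ℂ²` coincides with (an open piece of) the surface
`Z : Ω' → ℂ²`, up to a change of parameters `ψ` and an element `U` of `U(2)`. -/
def LocallyCongruentAt (Y : ℝ × ℝ → C2) (Ω : Set (ℝ × ℝ)) (p : ℝ × ℝ)
    (Z : ℝ × ℝ → C2) (Ω' : Set (ℝ × ℝ)) : Prop :=
  ∃ (U : C2 ≃ₗᵢ[ℂ] C2) (ψ : OpenPartialHomeomorph (ℝ × ℝ) (ℝ × ℝ)),
    p ∈ ψ.source ∧ ψ.source ⊆ Ω ∧ ψ.target ⊆ Ω' ∧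
    ContDiffOn ℝ ∞ ψ ψ.source ∧ ContDiffOn ℝ ∞ ψ.symm ψ.target ∧
    ∀ q ∈ ψ.source, U (Y q) = Z (ψ q)

/-! ### Planar curves -/

/-- `Γ` is a smooth regular curve on `I`. -/
def IsRegularCurveOn {E : Type*} [NormedAddCommGroup E] [NormedSpace ℝ E]
    (Γ : ℝ → E) (I : Set ℝ) : Prop :=
  ContDiffOn ℝ ∞ Γ I ∧ ∀ s ∈ I, deriv Γ s ≠ 0

/-- The unit normal `N = i Γ' / |Γ'|` of a planar curve. -/
def unitNormal (Γ : ℝ → ℂ) (s : ℝ) : ℂ := Complex.I * deriv Γ s / (‖deriv Γ s‖ : ℂ)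

/-- The signed curvature `⟨Γ'', N⟩ / |Γ'|²` of a planar curve, with respect to `unitNormal`. -/
def curvature (Γ : ℝ → ℂ) (s : ℝ) : ℝ :=
  cdot (deriv (deriv Γ) s) (unitNormal Γ s) / ‖deriv Γ s‖ ^ 2

/-- The self-similar equation `k + lam ⟨Γ, N⟩ = 0` for a regular planar curve. -/
def IsSelfSimilarCurveOn (lam : ℝ) (Γ : ℝ → ℂ) (I : Set ℝ) : Prop :=
  IsRegularCurveOn Γ I ∧ ∀ s ∈ I, curvature Γ s + lam * cdot (Γ s) (unitNormal Γ s) = 0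

/-- The equation `k = ⟨γ, N⟩ (1 / |γ|² - lam)` of the profile curves of the equivariant
self-similar Lagrangian surfaces, for a regular planar curve that avoids the origin. -/
def IsEquivariantProfileOn (lam : ℝ) (γ : ℝ → ℂ) (I : Set ℝ) : Prop :=
  IsRegularCurveOn γ I ∧ ∀ s ∈ I, γ s ≠ 0 ∧
    curvature γ s = cdot (γ s) (unitNormal γ s) * (1 / ‖γ s‖ ^ 2 - lam)

/-! ### The model surfaces -/

/-- The planar curve `r e^{iφ}`. -/
def polarCurve (r φ : ℝ → ℝ) (s : ℝ) : ℂ := (r s : ℂ) * Complex.exp (φ s * Complex.I)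

/-- The parametrization `r e^{iφ} (cos t, sin t) + V`. -/
def typeI (r φ : ℝ → ℝ) (V : ℝ → C2) (p : ℝ × ℝ) : C2 :=
  polarCurve r φ p.1 • !₂[(Real.cos p.2 : ℂ), (Real.sin p.2 : ℂ)] + V p.1

/-- Type I data: `r > 0` and `V' = e^{iφ} (W₁, W₂)` with `W₁, W₂` real. -/
def IsTypeIData (r φ : ℝ → ℝ) (V : ℝ → C2) (I : Set ℝ) : Prop :=
  ContDiffOn ℝ ∞ r I ∧ ContDiffOn ℝ ∞ φ I ∧ ContDiffOn ℝ ∞ V I ∧ (∀ s ∈ I, 0 < r s) ∧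
  ∃ W₁ W₂ : ℝ → ℝ, ∀ s ∈ I,
    HasDerivAt V (Complex.exp (φ s * Complex.I) • !₂[(W₁ s : ℂ), (W₂ s : ℂ)]) s

/-- The parametrization `c e^{it} γ + V`. -/
def typeII (c : ℝ) (γ V : ℝ → C2) (p : ℝ × ℝ) : C2 :=
  ((c : ℂ) * Complex.exp (p.2 * Complex.I)) • γ p.1 + V p.1

/-- Type II data: `γ` is a Legendrian curve of the unit sphere `𝕊³` (not necessarily regular) and
`V' = W (conj γ₂, - conj γ₁)`, with `W` complex valued. -/
def IsTypeIIData (γ V : ℝ → C2) (I : Set ℝ) : Prop :=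
  ContDiffOn ℝ ∞ γ I ∧ ContDiffOn ℝ ∞ V I ∧
  (∀ s ∈ I, rdot (γ s) (γ s) = 1 ∧ rdot (deriv γ s) (Complex.I • γ s) = 0) ∧
  ∃ W : ℝ → ℂ, ∀ s ∈ I, HasDerivAt V (W s • !₂[conj (γ s 1), -conj (γ s 0)]) s

/-- The parametrization `c (α₁ e^{it}, α₂ e^{-it}) + V`. -/
def typeIII (c : ℝ) (α V : ℝ → C2) (p : ℝ × ℝ) : C2 :=
  (c : ℂ) • !₂[α p.1 0 * Complex.exp (p.2 * Complex.I),
               α p.1 1 * Complex.exp (-(p.2 * Complex.I))] + V p.1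

/-- Type III data: `α` is a Legendrian curve (not necessarily regular) of the unit anti-de Sitter
space `|α₁|² - |α₂|² = -1`, and `V' = (W |α₂|², conj W α₁ α₂)`, with `W` complex valued. -/
def IsTypeIIIData (α V : ℝ → C2) (I : Set ℝ) : Prop :=
  ContDiffOn ℝ ∞ α I ∧ ContDiffOn ℝ ∞ V I ∧
  (∀ s ∈ I, ‖α s 0‖ ^ 2 - ‖α s 1‖ ^ 2 = -1 ∧
    cdot (deriv α s 0) (Complex.I * α s 0) - cdot (deriv α s 1) (Complex.I * α s 1) = 0) ∧
  ∃ W : ℝ → ℂ, ∀ s ∈ I,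
    HasDerivAt V !₂[W s * (‖α s 1‖ : ℂ) ^ 2, conj (W s) * α s 0 * α s 1] s

/-- The Cartesian product `𝕊¹(c) × Γ`, parametrized by `(c e^{it}, Γ(s))`. -/
def circleProduct (c : ℝ) (Γ : ℝ → ℂ) (p : ℝ × ℝ) : C2 :=
  !₂[(c : ℂ) * Complex.exp (p.2 * Complex.I), Γ p.1]

/-- The Lagrangian plane `ℝ² ⊆ ℂ²`. -/
def realPlane (p : ℝ × ℝ) : C2 := !₂[(p.1 : ℂ), (p.2 : ℂ)]

/-- The Clifford torus `𝕊¹(c/√2) × 𝕊¹(c/√2)`, parametrized by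
`(c/√2) (e^{i(t+x)}, e^{i(t-x)})`. -/
def cliffordTorus (c : ℝ) (p : ℝ × ℝ) : C2 :=
  ((c / Real.sqrt 2 : ℝ) : ℂ) • !₂[Complex.exp (((p.2 + p.1 : ℝ) : ℂ) * Complex.I),
    Complex.exp (((p.2 - p.1 : ℝ) : ℂ) * Complex.I)]

end CyclicLagrangian

end

noncomputable section

namespace CyclicLagrangian

/-! ### Algebra of the complex plane `ℂ²` -/

/-! With `z = e^{it}`, a family of circles is `z A + conj z B + V`, where `A, B = r (e₁ ∓ i e₂) /
2`; orthonormality of the pair says exactly that `A` and `B` are Hermitian orthogonal of equal real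
scale, and only the orthogonality is kept. On a Lagrangian surface `J` carries tangent vectors to
normal vectors, so the vector equation is tested against `J Y_s` and `J Y_t`
(`jetSol_of_isSelfSimilarOn`). The Lagrangian condition and the `J Y_t` equation are then real
trigonometric polynomials in `z` of degree at most three, and every coefficient vanishes
(`trig_coeffs_eq_zero`).

The Lagrangian coefficients, with the derivative of `⟨A, B⟩ = 0`, make `A'` orthogonal to `B` and
`B'` orthogonal to `A`, and keep `|A|² - |B|²` constant. The `J Y_t` equation forces `|A| = |B|`
wherever both are nonzero (`IsSol.norm_eq`). Hence either one coefficient vanishes identically and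
the circles lie in complex lines, or `|A| = |B| > 0` throughout. In the second case `A` and `B` stay
in fixed complex lines, and after a unitary map and a shift of `t` the surface is `r e^{iφ} (cos t,
sin t) + V`.

Complex lines: the circle is `c e^{it} γ` with `γ' = μ quat γ` and `V' = W quat γ`. The `J Y_t`
equation leaves two possibilities (`circle_dichotomy`): `μ = 0` with `λc² = 1`, a product with a
self-similar curve, or `W = 0` with `λc² = 2`. In the latter the `J Y_s` equation fixes the argument
of `μ`, so `γ` runs along a great circle: the Clifford torus, itself a product of two circles.

Lagrangian planes: the cubic coefficient shows that `e^{-iφ} V` is real and that `rφ'` annihilates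
`e^{-iφ} V'` (`lagrangian_circle_dichotomy`). The `J Y_s` equation at `t = 0` is a linear equation
for `b = rφ'`, so `b` vanishes identically or nowhere. If identically, the surface lies in a
Lagrangian plane through the origin; if nowhere, `V = 0` and the same equation is the profile
equation. Away from the origin a plane is also the equivariant surface over a ray, so it needs a
case of its own only at the origin.

In type III the two coefficients have different norms, so one of them vanishes and the surface
reduces to type II. -/

lemma inner_eq_coords (x y : C2) : inner ℂ x y = conj (x 0) * y 0 + conj (x 1) * y 1 := by
  simp [PiLp.inner_apply, Fin.sum_univ_two, mul_comm]

lemma rdot_eq_coords (x y : C2) : rdot x y =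
    (x 0).re * (y 0).re + (x 0).im * (y 0).im + (x 1).re * (y 1).re + (x 1).im * (y 1).im := by
  simp [rdot, inner_eq_coords]; ring

/-- The Euclidean product of `x` with `J y`. -/
def om (x y : C2) : ℝ := rdot x (Complex.I • y)

lemma om_eq_coords (x y : C2) : om x y =
    (x 0).im * (y 0).re - (x 0).re * (y 0).im + (x 1).im * (y 1).re - (x 1).re * (y 1).im := by
  simp [om, rdot_eq_coords]; ring

lemma om_eq_inner (x y : C2) : om x y = -(inner ℂ x y).im := by
  simp [om, rdot]

lemma om_self (x : C2) : om x x = 0 := by rw [om_eq_coords]; ring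

lemma om_swap (x y : C2) : om x y = -om y x := by simp only [om_eq_coords]; ring

lemma rdot_comm (x y : C2) : rdot x y = rdot y x := by simp only [rdot_eq_coords]; ring

lemma rdot_add_left (x y z : C2) : rdot (x + y) z = rdot x z + rdot y z := by
  simp only [rdot_eq_coords, PiLp.add_apply, Complex.add_re, Complex.add_im]; ring

lemma rdot_sub_left (x y z : C2) : rdot (x - y) z = rdot x z - rdot y z := by
  simp only [rdot_eq_coords, PiLp.sub_apply, Complex.sub_re, Complex.sub_im]; ring

lemma rdot_smul_left (a : ℝ) (x y : C2) : rdot (a • x) y = a * rdot x y := by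
  simp only [rdot_eq_coords, PiLp.smul_apply, Complex.real_smul, Complex.re_ofReal_mul,
    Complex.im_ofReal_mul]; ring

lemma om_add_left (x y z : C2) : om (x + y) z = om x z + om y z := rdot_add_left _ _ _

lemma om_sub_left (x y z : C2) : om (x - y) z = om x z - om y z := rdot_sub_left _ _ _

lemma om_smul_left (a : ℝ) (x y : C2) : om (a • x) y = a * om x y := rdot_smul_left _ _ _

lemma om_add_right (x y z : C2) : om x (y + z) = om x y + om x z := by
  rw [om_swap, om_add_left, om_swap y, om_swap z]; ring

lemma om_smul_right (a : ℝ) (x y : C2) : om x (a • y) = a * om x y := by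
  rw [om_swap, om_smul_left, om_swap y]; ring

lemma rdot_add_right (x y z : C2) : rdot x (y + z) = rdot x y + rdot x z := by
  rw [rdot_comm, rdot_add_left, rdot_comm y, rdot_comm z]

lemma rdot_smul_right (a : ℝ) (x y : C2) : rdot x (a • y) = a * rdot x y := by
  rw [rdot_comm, rdot_smul_left, rdot_comm y]

lemma rdot_self (x : C2) : rdot x x = ‖x‖ ^ 2 := by
  simp only [rdot, inner_self_eq_norm_sq_to_K]; norm_cast

lemma rdot_self_pos {x : C2} (h : x ≠ 0) : 0 < rdot x x := by
  rw [rdot_self]; positivity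

/-- The Gram determinant of two linearly independent vectors is positive. -/
lemma gram_pos {S T : C2} (h : LinearIndependent ℝ ![S, T]) :
    0 < rdot S S * rdot T T - rdot S T ^ 2 := by
  have hT : T ≠ 0 := by simpa using h.ne_zero 1
  have hT' := rdot_self_pos hT
  -- This is `|T|²` times the component of `S` orthogonal to `T`; its squared length is `|T|²` times
  -- the Gram determinant.
  have hne : rdot T T • S - rdot S T • T ≠ 0 := by
    intro h0
    have := LinearIndependent.pair_iff.1 h (rdot T T) (-rdot S T) (by rw [← h0]; module)
    exact hT'.ne' this.1
  have h2 := rdot_self_pos hne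
  have h3 : rdot (rdot T T • S - rdot S T • T) (rdot T T • S - rdot S T • T)
      = rdot T T * (rdot S S * rdot T T - rdot S T ^ 2) := by
    rw [sub_eq_add_neg, ← neg_smul]
    simp only [rdot_add_left, rdot_add_right, rdot_smul_left, rdot_smul_right, rdot_comm T S]
    ring
  rw [h3] at h2
  exact (pos_iff_pos_of_mul_pos h2).1 hT'

lemma indep_of_gram_pos {S T : C2} (h : 0 < rdot S S * rdot T T - rdot S T ^ 2) :
    LinearIndependent ℝ ![S, T] := by
  rw [LinearIndependent.pair_iff]
  intro a b hab
  have h1 : rdot (a • S + b • T) S = 0 := by rw [hab]; simp [rdot]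
  have h2 : rdot (a • S + b • T) T = 0 := by rw [hab]; simp [rdot]
  simp only [rdot_add_left, rdot_smul_left, rdot_comm T S] at h1 h2
  constructor
  · have : a * (rdot S S * rdot T T - rdot S T ^ 2) = 0 := by
      linear_combination rdot T T * h1 - rdot S T * h2
    exact (mul_eq_zero.1 this).resolve_right h.ne'
  · have : b * (rdot S S * rdot T T - rdot S T ^ 2) = 0 := by
      linear_combination rdot S S * h2 - rdot S T * h1
    exact (mul_eq_zero.1 this).resolve_right h.ne'

lemma orthonormal_pair {f₁ f₂ : C2} (h₁ : inner ℂ f₁ f₁ = (1 : ℂ)) (h₂ : inner ℂ f₂ f₂ = (1 : ℂ))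
    (h : inner ℂ f₁ f₂ = (0 : ℂ)) : Orthonormal ℂ ![f₁, f₂] := by
  rw [orthonormal_iff_ite]
  have h' : inner ℂ f₂ f₁ = (0 : ℂ) := by rw [← inner_conj_symm, h, map_zero]
  intro i j
  fin_cases i <;> fin_cases j <;> simp [-inner_self_eq_norm_sq_to_K, h₁, h₂, h, h']

/-- The unitary group acts transitively on unitary frames. -/
lemma exists_unitary {f₁ f₂ g₁ g₂ : C2}
    (hf₁ : inner ℂ f₁ f₁ = (1 : ℂ)) (hf₂ : inner ℂ f₂ f₂ = (1 : ℂ)) (hf : inner ℂ f₁ f₂ = (0 : ℂ))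
    (hg₁ : inner ℂ g₁ g₁ = (1 : ℂ)) (hg₂ : inner ℂ g₂ g₂ = (1 : ℂ))
    (hg : inner ℂ g₁ g₂ = (0 : ℂ)) :
    ∃ U : C2 ≃ₗᵢ[ℂ] C2, U f₁ = g₁ ∧ U f₂ = g₂ := by
  have key : ∀ {f₁ f₂ : C2}, inner ℂ f₁ f₁ = (1 : ℂ) → inner ℂ f₂ f₂ = (1 : ℂ) →
      inner ℂ f₁ f₂ = (0 : ℂ) →
      ∃ b : OrthonormalBasis (Fin 2) ℂ C2, b 0 = f₁ ∧ b 1 = f₂ := by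
    intro f₁ f₂ h₁ h₂ h
    obtain ⟨b, hb⟩ := Orthonormal.exists_orthonormalBasis_extension_of_card_eq
      (𝕜 := ℂ) (E := C2) (ι := Fin 2) (by simp) (v := ![f₁, f₂]) (s := Set.univ)
      ((orthonormal_pair h₁ h₂ h).comp _ Subtype.val_injective)
    exact ⟨b, by simpa using hb 0 trivial, by simpa using hb 1 trivial⟩
  obtain ⟨b, hb0, hb1⟩ := key hf₁ hf₂ hf
  obtain ⟨d, hd0, hd1⟩ := key hg₁ hg₂ hg
  refine ⟨b.equiv d (Equiv.refl _), ?_, ?_⟩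
  · rw [← hb0, ← hd0]; simp
  · rw [← hb1, ← hd1]; simp

lemma rdot_unitary (U : C2 ≃ₗᵢ[ℂ] C2) (x y : C2) : rdot (U x) (U y) = rdot x y := by
  simp [rdot, U.inner_map_map]

lemma om_unitary (U : C2 ≃ₗᵢ[ℂ] C2) (x y : C2) : om (U x) (U y) = om x y := by
  simp [om_eq_inner, U.inner_map_map]

/-! ### Trigonometric polynomials of degree three -/

/-- Replacing `z` by `-z` separates even from odd degrees, and a few well-chosen points of the
circle then determine each half. -/
lemma trig_coeffs_eq_zero {c₀ : ℝ} {c₁ c₂ c₃ : ℂ}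
    (h : ∀ z : ℂ, ‖z‖ = 1 → c₀ + (c₁ * z + c₂ * z ^ 2 + c₃ * z ^ 3).re = 0) :
    c₀ = 0 ∧ c₁ = 0 ∧ c₂ = 0 ∧ c₃ = 0 := by
  have ev : ∀ z : ℂ, ‖z‖ = 1 → c₀ + (c₂ * z ^ 2).re = 0 := by
    intro z hz
    have h1 := h z hz
    have h2 := h (-z) (by simpa using hz)
    rw [show c₁ * -z + c₂ * (-z) ^ 2 + c₃ * (-z) ^ 3 = -(c₁ * z) + c₂ * z ^ 2 - c₃ * z ^ 3 by ring]
      at h2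
    simp only [Complex.add_re, Complex.sub_re, Complex.neg_re] at h1 h2
    linarith
  have od : ∀ z : ℂ, ‖z‖ = 1 → (c₁ * z + c₃ * z ^ 3).re = 0 := by
    intro z hz
    have h1 := h z hz
    have h2 := ev z hz
    simp only [Complex.add_re] at h1 h2 ⊢
    linarith
  -- The even part is read off where `z²` equals `1`, `-1` and `i`.
  obtain ⟨w, hw⟩ : ∃ w : ℂ, w ^ 2 = Complex.I := ⟨_, Complex.cpow_nat_inv_pow _ two_ne_zero⟩
  have hw1 : ‖w‖ = 1 := by
    have : ‖w‖ ^ 2 = 1 := by rw [← norm_pow, hw]; simp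
    nlinarith [norm_nonneg w]
  have e1 := ev 1 (by simp)
  have e2 := ev Complex.I (by simp)
  have e3 := ev w hw1
  rw [hw] at e3
  rw [Complex.I_sq] at e2
  simp at e1 e2 e3
  have hc0 : c₀ = 0 := by linarith
  have hc2 : c₂ = 0 := by
    apply Complex.ext <;> simp <;> linarith
  have s3 : Real.sqrt 3 ^ 2 = 3 := Real.sq_sqrt (by norm_num)
  have s3' : 0 < Real.sqrt 3 := by positivity
  -- The points `e^{±iπ/3}`, with `σ` the sign: there `z³ = -1`, so the cubic term is known and `c₁`
  -- can be isolated.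
  have hn : ∀ σ : ℝ, σ ^ 2 = 1 → ‖(⟨1 / 2, σ * (Real.sqrt 3 / 2)⟩ : ℂ)‖ = 1 := by
    intro σ hσ
    have : ‖(⟨1 / 2, σ * (Real.sqrt 3 / 2)⟩ : ℂ)‖ ^ 2 = 1 := by
      rw [Complex.sq_norm, Complex.normSq_mk]
      linear_combination (1 / 4 : ℝ) * s3 + (Real.sqrt 3) ^ 2 / 4 * hσ
    nlinarith [norm_nonneg (⟨1 / 2, σ * (Real.sqrt 3 / 2)⟩ : ℂ)]
  have hcube : ∀ σ : ℝ, σ ^ 2 = 1 → (⟨1 / 2, σ * (Real.sqrt 3 / 2)⟩ : ℂ) ^ 3 = -1 := by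
    intro σ hσ
    apply Complex.ext
    · simp [pow_succ]; linear_combination -(3 / 8 * σ ^ 2 : ℝ) * s3 - (9 / 8 : ℝ) * hσ
    · simp [pow_succ]
      linear_combination -(1/8 * σ ^ 3 * Real.sqrt 3 : ℝ) * s3 - (3 / 8 * σ * Real.sqrt 3 : ℝ) * hσ
  have o1 := od 1 (by simp)
  have o2 := od Complex.I (by simp)
  have o3 := od _ (hn 1 (by norm_num))
  have o4 := od _ (hn (-1) (by norm_num))
  rw [hcube 1 (by norm_num)] at o3
  rw [hcube (-1) (by norm_num)] at o4
  rw [show Complex.I ^ 3 = -Complex.I by rw [pow_succ, Complex.I_sq]; ring] at o2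
  simp at o1 o2 o3 o4
  have hi : c₁.im = 0 := by
    have : c₁.im * Real.sqrt 3 = 0 := by linarith
    exact (mul_eq_zero.1 this).resolve_right s3'.ne'
  rw [hi] at o3
  refine ⟨hc0, ?_, hc2, ?_⟩ <;> apply Complex.ext <;> simp <;> linarith

/-! ### Calculus on open intervals -/

lemma IsOpenInterval.isPreconnected {I : Set ℝ} (h : IsOpenInterval I) : IsPreconnected I :=
  h.2.2.isPreconnected

section Calculus

variable {E : Type*} [NormedAddCommGroup E] [NormedSpace ℝ E] {I : Set ℝ} {f : ℝ → E}

lemma hasDerivAt_of_smooth (hI : IsOpen I) (hf : ContDiffOn ℝ ∞ f I) {s : ℝ} (hs : s ∈ I) :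
    HasDerivAt f (deriv f s) s :=
  ((hf.differentiableOn (by simp)).differentiableAt (hI.mem_nhds hs)).hasDerivAt

lemma smooth_deriv (hI : IsOpen I) (hf : ContDiffOn ℝ ∞ f I) : ContDiffOn ℝ ∞ (deriv f) I :=
  ((contDiffOn_infty_iff_deriv_of_isOpen hI).1 hf).2

lemma smooth_of_hasDerivAt (hI : IsOpen I) {g : ℝ → E} (hg : ContDiffOn ℝ ∞ g I)
    (hf : ∀ s ∈ I, HasDerivAt f (g s) s) : ContDiffOn ℝ ∞ f I := by
  refine (contDiffOn_infty_iff_deriv_of_isOpen hI).2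
    ⟨fun s hs => (hf s hs).differentiableAt.differentiableWithinAt, hg.congr fun s hs => ?_⟩
  exact (hf s hs).deriv

lemma exists_primitive [CompleteSpace E] (hI : IsOpenInterval I) (hf : ContDiffOn ℝ ∞ f I) :
    ∃ F : ℝ → E, ContDiffOn ℝ ∞ F I ∧ ∀ s ∈ I, HasDerivAt F (f s) s := by
  obtain ⟨⟨s₀, hs₀⟩, hO, hc⟩ := hI
  have key : ∀ s ∈ I, HasDerivAt (fun u => ∫ x in s₀..u, f x) (f s) s := by
    intro s hs
    apply intervalIntegral.integral_hasDerivAt_right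
    · exact (hf.continuousOn.mono (hc.uIcc_subset hs₀ hs)).intervalIntegrable
    · exact hf.continuousOn.stronglyMeasurableAtFilter hO s hs
    · exact hf.continuousOn.continuousAt (hO.mem_nhds hs)
  exact ⟨_, smooth_of_hasDerivAt hO hf key, key⟩

lemma eq_const_of_hasDerivAt_zero (hI : IsOpenInterval I) (hf : ∀ s ∈ I, HasDerivAt f 0 s) :
    ∃ a, ∀ s ∈ I, f s = a :=
  hI.2.1.exists_is_const_of_deriv_eq_zero (𝕜 := ℝ) hI.isPreconnected
    (fun s hs => (hf s hs).differentiableAt.differentiableWithinAt) (fun s hs => (hf s hs).deriv)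

/-- Two functions that agree on an open set have the same derivative there. -/
lemma HasDerivAt.of_eqOn (hI : IsOpen I) {g : ℝ → E} {f' : E} {s : ℝ} (hs : s ∈ I)
    (h : ∀ s ∈ I, g s = f s) (hf : HasDerivAt f f' s) : HasDerivAt g f' s :=
  hf.congr_of_eventuallyEq (Filter.eventually_of_mem (hI.mem_nhds hs) h)

lemma HasDerivAt.eq_of_eqOn (hI : IsOpen I) {g : ℝ → E} {f' g' : E} {s : ℝ} (hs : s ∈ I)
    (h : ∀ s ∈ I, g s = f s) (hf : HasDerivAt f f' s) (hg : HasDerivAt g g' s) : g' = f' :=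
  hg.unique (HasDerivAt.of_eqOn hI hs h hf)

end Calculus

/-- The solutions of a linear homogeneous scalar equation. -/
lemma exists_eq_exp_smul {𝕜 : Type*} [NormedField 𝕜] [NormedAlgebra ℝ 𝕜]
    {I : Set ℝ} (hI : IsOpenInterval I) {b : ℝ → 𝕜} {h : ℝ → ℝ}
    (hh : ContDiffOn ℝ ∞ h I) (hb : ∀ s ∈ I, HasDerivAt b (h s • b s) s) :
    ∃ κ : 𝕜, ∃ H : ℝ → ℝ, ContDiffOn ℝ ∞ H I ∧ ∀ s ∈ I, b s = Real.exp (H s) • κ := by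
  obtain ⟨H, hH, hH'⟩ := exists_primitive hI hh
  obtain ⟨κ, hκ⟩ := eq_const_of_hasDerivAt_zero (f := fun s => Real.exp (-H s) • b s) hI (by
    intro s hs
    have := (hH' s hs).neg.exp.smul (hb s hs)
    refine this.congr_deriv ?_
    rw [smul_smul, ← add_smul]; simp)
  refine ⟨κ, H, hH, fun s hs => ?_⟩
  rw [← hκ s hs, smul_smul, ← Real.exp_add]; simp

/-! ### The self-similar equation as two scalar equations -/

/-- The self-similar equation of a Lagrangian surface, multiplied with `J X` for a tangent
vector `X`, in terms of the position vector and its derivatives up to the second order. -/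
def ScalarEq (lam : ℝ) (Y S T SS ST TT X : C2) : Prop :=
  rdot T T * om SS X - 2 * rdot S T * om ST X + rdot S S * om TT X
    + lam * (rdot S S * rdot T T - rdot S T ^ 2) * om Y X = 0

/-- The conditions on the derivatives up to the second order, at one point, of a self-similar
Lagrangian immersion. -/
structure JetSol (lam : ℝ) (Y S T SS ST TT : C2) : Prop where
  indep : LinearIndependent ℝ ![S, T]
  lag : om S T = 0
  eqS : ScalarEq lam Y S T SS ST TT S
  eqT : ScalarEq lam Y S T SS ST TT T

/-- The discarded tangential part is a combination of `Y_s` and `Y_t`, both of which pair to zero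
with `J X`; normal projections are therefore invisible to this pairing. -/
lemma om_normalPart {Y : ℝ × ℝ → C2} {p : ℝ × ℝ} {X : C2} (hS : om (dS Y p) X = 0)
    (hT : om (dT Y p) X = 0) (v : C2) : om (normalPart Y p v) X = om v X := by
  simp [normalPart, tangentPart, om_sub_left, om_add_left, om_smul_left, hS, hT]

/-- Since the surface is Lagrangian, `J Y_s` and `J Y_t` are normal. Pairing with them removes the
projections, and multiplying by `EG - F²` removes the denominators. -/
lemma jetSol_of_isSelfSimilarOn {lam : ℝ} {Y : ℝ × ℝ → C2} {Ω : Set (ℝ × ℝ)} {p : ℝ × ℝ}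
    (hp : p ∈ Ω) (himm : LinearIndependent ℝ ![dS Y p, dT Y p]) (hlag : om (dS Y p) (dT Y p) = 0)
    (h : IsSelfSimilarOn lam Y Ω) :
    JetSol lam (Y p) (dS Y p) (dT Y p) (dS (dS Y) p) (dS (dT Y) p) (dT (dT Y) p) := by
  have hdet : 0 < metDet Y p := gram_pos himm
  have key : ∀ X, om (dS Y p) X = 0 → om (dT Y p) X = 0 →
      ScalarEq lam (Y p) (dS Y p) (dT Y p) (dS (dS Y) p) (dS (dT Y) p) (dT (dT Y) p) X := by
    intro X hS hT
    have h1 : om (meanCurvature Y p + lam • normalPart Y p (Y p)) X = 0 := by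
      rw [h p hp]; simp [om, rdot]
    simp only [meanCurvature, om_add_left, om_sub_left, om_smul_left, om_normalPart hS hT] at h1
    have h2 := congrArg (fun x => metDet Y p * x) h1
    simp only [mul_add, mul_zero, mul_inv_cancel_left₀ hdet.ne'] at h2
    have h3 : metDet Y p = rdot (dS Y p) (dS Y p) * rdot (dT Y p) (dT Y p)
      - rdot (dS Y p) (dT Y p) ^ 2 := rfl
    rw [h3] at h2
    unfold ScalarEq
    simp only [metG, metE, metF] at h2
    linear_combination h2
  exact ⟨himm, hlag, key _ (om_self _) (by rw [om_swap, hlag, neg_zero]),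
    key _ hlag (om_self _)⟩

lemma JetSol.unitary {lam : ℝ} {Y S T SS ST TT : C2} (h : JetSol lam Y S T SS ST TT)
    (U : C2 ≃ₗᵢ[ℂ] C2) : JetSol lam (U Y) (U S) (U T) (U SS) (U ST) (U TT) := by
  refine ⟨indep_of_gram_pos ?_, ?_, ?_, ?_⟩
  · simpa only [rdot_unitary] using gram_pos h.indep
  · simpa only [om_unitary] using h.lag
  · simpa only [ScalarEq, rdot_unitary, om_unitary] using h.eqS
  · simpa only [ScalarEq, rdot_unitary, om_unitary] using h.eqT

/-- Effect of the change of parameter `t ↦ t + τ(s)`. -/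
lemma JetSol.shear {lam : ℝ} {Y S T SS ST TT : C2} (h : JetSol lam Y S T SS ST TT) (τ τ' : ℝ) :
    JetSol lam Y (S + τ • T) T (SS + (2 * τ) • ST + (τ ^ 2) • TT + τ' • T) (ST + τ • TT) TT := by
  have hl := h.lag
  have h1 := h.eqS
  have h2 := h.eqT
  have hl' : om T S = 0 := by rw [om_swap, hl, neg_zero]
  simp only [ScalarEq] at h1 h2
  refine ⟨indep_of_gram_pos ?_, ?_, ?_, ?_⟩
  · have := gram_pos h.indep
    simp only [rdot_add_left, rdot_add_right, rdot_smul_left, rdot_smul_right, rdot_comm T S]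
    nlinarith
  · simp only [om_add_left, om_smul_left, hl, om_self]; ring
  all_goals
    simp only [ScalarEq, rdot_add_left, rdot_add_right, rdot_smul_left, rdot_smul_right,
      rdot_comm T S, om_add_left, om_add_right, om_smul_left, om_smul_right, om_self, hl']
  -- The equation for `S + τT` is the combination of the two old ones; `τ'` only multiplies the
  -- tangent vector `T` and drops out.
  · linear_combination h1 + τ * h2
  · linear_combination h2

/-- Effect of the change of parameter `t ↦ -t`. -/
lemma JetSol.reflect {lam : ℝ} {Y S T SS ST TT : C2} (h : JetSol lam Y S T SS ST TT) :
    JetSol lam Y S (-T) SS (-ST) TT := by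
  have e : ∀ x : C2, -x = (-1 : ℝ) • x := fun x => by simp
  have hl := h.lag
  have h1 := h.eqS
  have h2 := h.eqT
  simp only [ScalarEq] at h1 h2
  refine ⟨indep_of_gram_pos ?_, ?_, ?_, ?_⟩
  · have := gram_pos h.indep
    simp only [e, rdot_smul_left, rdot_smul_right]
    nlinarith
  · simp only [e, om_smul_right, hl]; ring
  all_goals
    simp only [ScalarEq, e, rdot_smul_left, rdot_smul_right, om_smul_left, om_smul_right]
  · linear_combination h1
  · linear_combination -h2

/-! ### Families of circles -/

/-- The point with parameter `z ∈ 𝕊¹` of a circle in `ℂ²`. -/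
def cyc (z : ℂ) (A B V : C2) : C2 := z • A + conj z • B + V

lemma cyc_apply (z : ℂ) (A B V : C2) (i : Fin 2) :
    cyc z A B V i = z * A i + conj z * B i + V i := by
  simp [cyc]

lemma cyc_unitary (U : C2 ≃ₗᵢ[ℂ] C2) (z : ℂ) (A B V : C2) :
    U (cyc z A B V) = cyc z (U A) (U B) (U V) := by
  simp [cyc]

/-- The surface `z A + conj z B + V`, `z = e^{it}`, is a self-similar Lagrangian immersion. -/
structure IsSol (lam : ℝ) (A B V : ℝ → C2) (I : Set ℝ) : Prop where
  smoothA : ContDiffOn ℝ ∞ A I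
  smoothB : ContDiffOn ℝ ∞ B I
  smoothV : ContDiffOn ℝ ∞ V I
  orth : ∀ s ∈ I, inner ℂ (A s) (B s) = (0 : ℂ)
  jet : ∀ s ∈ I, ∀ z : ℂ, ‖z‖ = 1 →
    JetSol lam (cyc z (A s) (B s) (V s)) (cyc z (deriv A s) (deriv B s) (deriv V s))
      (cyc z (Complex.I • A s) (-(Complex.I • B s)) 0)
      (cyc z (deriv (deriv A) s) (deriv (deriv B) s) (deriv (deriv V) s))
      (cyc z (Complex.I • deriv A s) (-(Complex.I • deriv B s)) 0)
      (cyc z (-A s) (-B s) 0)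

lemma deriv_two_of_hasDerivAt {I : Set ℝ} (hI : IsOpen I) {A A₁ A₂ : ℝ → C2}
    (h₁ : ∀ s ∈ I, HasDerivAt A (A₁ s) s) (h₂ : ∀ s ∈ I, HasDerivAt A₁ (A₂ s) s) :
    ∀ s ∈ I, deriv A s = A₁ s ∧ deriv (deriv A) s = A₂ s := fun s hs =>
  ⟨(h₁ s hs).deriv, (HasDerivAt.of_eqOn hI hs (fun u hu => (h₁ u hu).deriv) (h₂ s hs)).deriv⟩

/-! ### Symmetries: unitary maps, exchange of the coefficients, shifts of the parameter -/

section Transformations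

variable {lam : ℝ} {I : Set ℝ} {A B V A₁ A₂ B₁ B₂ V₁ V₂ : ℝ → C2}

/-- Lets closed formulas replace iterated `deriv`; the next lemma is its converse. -/
lemma IsSol.jet_of_hasDerivAt (hI : IsOpen I) (h : IsSol lam A B V I)
    (hA₁ : ∀ s ∈ I, HasDerivAt A (A₁ s) s) (hA₂ : ∀ s ∈ I, HasDerivAt A₁ (A₂ s) s)
    (hB₁ : ∀ s ∈ I, HasDerivAt B (B₁ s) s) (hB₂ : ∀ s ∈ I, HasDerivAt B₁ (B₂ s) s)
    (hV₁ : ∀ s ∈ I, HasDerivAt V (V₁ s) s) (hV₂ : ∀ s ∈ I, HasDerivAt V₁ (V₂ s) s)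
    {s : ℝ} (hs : s ∈ I) {z : ℂ} (hz : ‖z‖ = 1) :
    JetSol lam (cyc z (A s) (B s) (V s)) (cyc z (A₁ s) (B₁ s) (V₁ s))
      (cyc z (Complex.I • A s) (-(Complex.I • B s)) 0) (cyc z (A₂ s) (B₂ s) (V₂ s))
      (cyc z (Complex.I • A₁ s) (-(Complex.I • B₁ s)) 0) (cyc z (-A s) (-B s) 0) := by
  have := h.jet s hs z hz
  obtain ⟨a1, a2⟩ := deriv_two_of_hasDerivAt hI hA₁ hA₂ s hs
  obtain ⟨b1, b2⟩ := deriv_two_of_hasDerivAt hI hB₁ hB₂ s hs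
  obtain ⟨v1, v2⟩ := deriv_two_of_hasDerivAt hI hV₁ hV₂ s hs
  rwa [a1, a2, b1, b2, v1, v2] at this

lemma IsSol.of_hasDerivAt (hI : IsOpen I)
    (hA : ContDiffOn ℝ ∞ A I) (hB : ContDiffOn ℝ ∞ B I) (hV : ContDiffOn ℝ ∞ V I)
    (hA₁ : ∀ s ∈ I, HasDerivAt A (A₁ s) s) (hA₂ : ∀ s ∈ I, HasDerivAt A₁ (A₂ s) s)
    (hB₁ : ∀ s ∈ I, HasDerivAt B (B₁ s) s) (hB₂ : ∀ s ∈ I, HasDerivAt B₁ (B₂ s) s)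
    (hV₁ : ∀ s ∈ I, HasDerivAt V (V₁ s) s) (hV₂ : ∀ s ∈ I, HasDerivAt V₁ (V₂ s) s)
    (orth : ∀ s ∈ I, inner ℂ (A s) (B s) = (0 : ℂ))
    (jet : ∀ s ∈ I, ∀ z : ℂ, ‖z‖ = 1 →
      JetSol lam (cyc z (A s) (B s) (V s)) (cyc z (A₁ s) (B₁ s) (V₁ s))
      (cyc z (Complex.I • A s) (-(Complex.I • B s)) 0) (cyc z (A₂ s) (B₂ s) (V₂ s))
      (cyc z (Complex.I • A₁ s) (-(Complex.I • B₁ s)) 0) (cyc z (-A s) (-B s) 0)) :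
    IsSol lam A B V I := by
  refine ⟨hA, hB, hV, orth, fun s hs z hz => ?_⟩
  obtain ⟨a1, a2⟩ := deriv_two_of_hasDerivAt hI hA₁ hA₂ s hs
  obtain ⟨b1, b2⟩ := deriv_two_of_hasDerivAt hI hB₁ hB₂ s hs
  obtain ⟨v1, v2⟩ := deriv_two_of_hasDerivAt hI hV₁ hV₂ s hs
  rw [a1, a2, b1, b2, v1, v2]
  exact jet s hs z hz

lemma hasDerivAt_unitary (U : C2 ≃ₗᵢ[ℂ] C2) {f : ℝ → C2} {f' : C2} {s : ℝ}
    (h : HasDerivAt f f' s) : HasDerivAt (fun s => U (f s)) (U f') s :=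
  ((U.toContinuousLinearEquiv : C2 →L[ℂ] C2).restrictScalars ℝ).hasFDerivAt.comp_hasDerivAt s h

lemma smooth_unitary (U : C2 ≃ₗᵢ[ℂ] C2) {E : Type*} [NormedAddCommGroup E] [NormedSpace ℝ E]
    {f : E → C2} {s : Set E} (h : ContDiffOn ℝ ∞ f s) : ContDiffOn ℝ ∞ (fun s => U (f s)) s :=
  ((U.toContinuousLinearEquiv : C2 →L[ℂ] C2).restrictScalars ℝ).contDiff.comp_contDiffOn h

lemma IsSol.unitary (hI : IsOpen I) (h : IsSol lam A B V I) (U : C2 ≃ₗᵢ[ℂ] C2) :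
    IsSol lam (fun s => U (A s)) (fun s => U (B s)) (fun s => U (V s)) I := by
  have d : ∀ {f : ℝ → C2}, ContDiffOn ℝ ∞ f I →
      ∀ s ∈ I, HasDerivAt (fun s => U (f s)) (U (deriv f s)) s := fun hf s hs =>
    hasDerivAt_unitary U (hasDerivAt_of_smooth hI hf hs)
  refine .of_hasDerivAt hI (smooth_unitary U h.smoothA) (smooth_unitary U h.smoothB)
    (smooth_unitary U h.smoothV) (d h.smoothA) (d (smooth_deriv hI h.smoothA))
    (d h.smoothB) (d (smooth_deriv hI h.smoothB)) (d h.smoothV) (d (smooth_deriv hI h.smoothV))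
    (fun s hs => by rw [U.inner_map_map, h.orth s hs]) (fun s hs z hz => ?_)
  have := (h.jet s hs z hz).unitary U
  simpa only [cyc_unitary, map_neg, map_smul, map_zero] using this

/-- Reversing `t` conjugates `z`, which exchanges the two coefficients. -/
lemma IsSol.swap (h : IsSol lam A B V I) : IsSol lam B A V I := by
  refine ⟨h.smoothB, h.smoothA, h.smoothV,
    fun s hs => by rw [← inner_conj_symm, h.orth s hs, map_zero], fun s hs z hz => ?_⟩
  have := (h.jet s hs (conj z) (by simpa using hz)).reflect
  convert this using 1 <;> simp only [cyc, Complex.conj_conj] <;> module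

/-- The change of parameter `t ↦ t - τ(s)`. -/
lemma IsSol.phase (hI : IsOpen I) (h : IsSol lam A B V I) {τ : ℝ → ℝ}
    (hτ : ContDiffOn ℝ ∞ τ I) :
    IsSol lam (fun s => Complex.exp (τ s * Complex.I) • A s)
      (fun s => Complex.exp (-(τ s * Complex.I)) • B s) V I := by
  have hτ₁ := fun s (hs : s ∈ I) => hasDerivAt_of_smooth hI hτ hs
  have hτ₂ := fun s (hs : s ∈ I) => hasDerivAt_of_smooth hI (smooth_deriv hI hτ) hs
  have smτ : ContDiffOn ℝ ∞ (fun s => (τ s : ℂ) * Complex.I) I :=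
    (Complex.ofRealCLM.contDiff.comp_contDiffOn hτ).mul contDiffOn_const
  -- One computation serves both coefficients: `σ = 1` for `A` and `σ = -1` for `B`.
  have dE : ∀ σ : ℂ, ∀ s ∈ I, HasDerivAt (fun s => Complex.exp (σ * (τ s * Complex.I)))
      (Complex.exp (σ * (τ s * Complex.I)) * (σ * (deriv τ s * Complex.I))) s := fun σ s hs =>
    (((hτ₁ s hs).ofReal_comp.mul_const _).const_mul σ).cexp
  have d1 : ∀ σ : ℂ, ∀ f : ℝ → C2, ContDiffOn ℝ ∞ f I → ∀ s ∈ I,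
      HasDerivAt (fun s => Complex.exp (σ * (τ s * Complex.I)) • f s)
        (Complex.exp (σ * (τ s * Complex.I)) •
          (deriv f s + (σ * (deriv τ s * Complex.I)) • f s)) s := by
    intro σ f hf s hs
    refine ((dE σ s hs).smul (hasDerivAt_of_smooth hI hf hs)).congr_deriv ?_
    module
  have d2 : ∀ σ : ℂ, ∀ f : ℝ → C2, ContDiffOn ℝ ∞ f I → ∀ s ∈ I,
      HasDerivAt (fun s => Complex.exp (σ * (τ s * Complex.I)) •
          (deriv f s + (σ * (deriv τ s * Complex.I)) • f s))
        (Complex.exp (σ * (τ s * Complex.I)) •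
          (deriv (deriv f) s + (2 * (σ * (deriv τ s * Complex.I))) • deriv f s
            + ((σ * (deriv τ s * Complex.I)) ^ 2 + σ * (deriv (deriv τ) s * Complex.I)) • f s))
        s := by
    intro σ f hf s hs
    refine ((dE σ s hs).smul ((hasDerivAt_of_smooth hI (smooth_deriv hI hf) hs).add
      ((((hτ₂ s hs).ofReal_comp.mul_const Complex.I).const_mul σ).smul
        (hasDerivAt_of_smooth hI hf hs)))).congr_deriv ?_
    simp only [Pi.add_apply, Pi.smul_apply']
    module
  have e1 : (fun s => Complex.exp (τ s * Complex.I) • A s)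
      = fun s => Complex.exp (1 * (τ s * Complex.I)) • A s := by simp
  have e2 : (fun s => Complex.exp (-(τ s * Complex.I)) • B s)
      = fun s => Complex.exp ((-1) * (τ s * Complex.I)) • B s := by simp
  rw [e1, e2]
  refine .of_hasDerivAt hI ((contDiffOn_const.mul smτ).cexp.smul h.smoothA)
    ((contDiffOn_const.mul smτ).cexp.smul h.smoothB) h.smoothV
    (d1 _ _ h.smoothA) (d2 _ _ h.smoothA) (d1 _ _ h.smoothB) (d2 _ _ h.smoothB)
    (fun s hs => hasDerivAt_of_smooth hI h.smoothV hs)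
    (fun s hs => hasDerivAt_of_smooth hI (smooth_deriv hI h.smoothV) hs) ?_ ?_
  · intro s hs
    rw [inner_smul_left, inner_smul_right, h.orth s hs]; simp
  · intro s hs z hz
    set e := Complex.exp (1 * (τ s * Complex.I)) with he
    have he' : Complex.exp ((-1) * (τ s * Complex.I)) = conj e := by
      rw [he, ← Complex.exp_conj]; simp
    have hn : ‖z * e‖ = 1 := by
      rw [norm_mul, hz, he, one_mul, one_mul, Complex.norm_exp_ofReal_mul_I]
    -- The new circle at `z` is the old one at `z e`, and differentiating the moving parameter in
    -- `s` is the shear by `τ'`.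
    have := (h.jet s hs (z * e) hn).shear (deriv τ s) (deriv (deriv τ) s)
    rw [he']
    have hre : ∀ (x : ℝ) (v : C2), x • v = (x : ℂ) • v := fun x v => (Complex.coe_smul x v).symm
    convert this using 1 <;> simp only [cyc, map_mul, hre] <;> push_cast <;>
      match_scalars <;> ring_nf <;> (try simp only [Complex.I_sq]) <;> ring_nf

end Transformations

lemma hasDerivAt_expI (t : ℝ) : HasDerivAt (fun t : ℝ => Complex.exp (t * Complex.I))
    (Complex.exp (t * Complex.I) * Complex.I) t := by
  simpa using ((hasDerivAt_id t).ofReal_comp.mul_const Complex.I).cexp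

lemma conj_expI (t : ℝ) : conj (Complex.exp (t * Complex.I)) = Complex.exp (-(t * Complex.I)) := by
  rw [← Complex.exp_conj]; simp

lemma hasDerivAt_conj_expI (t : ℝ) : HasDerivAt (fun t : ℝ => conj (Complex.exp (t * Complex.I)))
    (-(conj (Complex.exp (t * Complex.I)) * Complex.I)) t := by
  simp only [conj_expI]
  simpa using ((hasDerivAt_id t).ofReal_comp.mul_const Complex.I).neg.cexp

/-! ### From a parametrized surface to its coefficients -/

section Strip

variable {lam : ℝ} {I : Set ℝ} {A B V : ℝ → C2} {Y : ℝ × ℝ → C2}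

lemma dS_cyc (hI : IsOpen I) {A' B' V' : C2} {z : ℝ → ℂ}
    (hY : ∀ s ∈ I, ∀ t : ℝ, Y (s, t) = cyc (z t) (A s) (B s) (V s)) {s : ℝ} (hs : s ∈ I)
    (hA : HasDerivAt A A' s) (hB : HasDerivAt B B' s) (hV : HasDerivAt V V' s) (t : ℝ) :
    dS Y (s, t) = cyc (z t) A' B' V' :=
  (HasDerivAt.of_eqOn hI hs (fun s hs => hY s hs t)
    (((hA.const_smul (z t)).add (hB.const_smul (conj (z t)))).add hV)).deriv

lemma dT_cyc (hY : ∀ s ∈ I, ∀ t : ℝ, Y (s, t) = cyc (Complex.exp (t * Complex.I)) (A s) (B s) (V s))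
    {s : ℝ} (hs : s ∈ I) (t : ℝ) :
    dT Y (s, t) = cyc (Complex.exp (t * Complex.I)) (Complex.I • A s) (-(Complex.I • B s)) 0 := by
  have h := (((hasDerivAt_expI t).smul_const (A s)).add
      ((hasDerivAt_conj_expI t).smul_const (B s))).add_const (V s)
  have hf : (fun t => Y (s, t)) = fun t : ℝ => cyc (Complex.exp (t * Complex.I)) (A s) (B s) (V s) :=
    funext fun t => hY s hs t
  unfold dT
  refine (congrArg (fun f => deriv f t) hf).trans (h.deriv.trans ?_)
  simp only [cyc]; module

/-- A family of circles with orthogonal coefficients solves the scalar equations. -/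
lemma isSol_of_isSelfSimilarOn (hI : IsOpen I)
    (hA : ContDiffOn ℝ ∞ A I) (hB : ContDiffOn ℝ ∞ B I) (hV : ContDiffOn ℝ ∞ V I)
    (orth : ∀ s ∈ I, inner ℂ (A s) (B s) = (0 : ℂ))
    (hY : ∀ s ∈ I, ∀ t : ℝ, Y (s, t) = cyc (Complex.exp (t * Complex.I)) (A s) (B s) (V s))
    (himm : IsImmersionOn Y (strip I))
    (hlag : ∀ s ∈ I, ∀ z : ℂ, ‖z‖ = 1 → om (cyc z (deriv A s) (deriv B s) (deriv V s))
      (cyc z (Complex.I • A s) (-(Complex.I • B s)) 0) = 0)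
    (hss : IsSelfSimilarOn lam Y (strip I)) : IsSol lam A B V I := by
  refine ⟨hA, hB, hV, orth, fun s hs z hz => ?_⟩
  obtain ⟨t, rfl⟩ : ∃ t : ℝ, Complex.exp (t * Complex.I) = z :=
    ⟨z.arg, by simpa [hz] using Complex.norm_mul_exp_arg_mul_I z⟩
  have hd := fun {f : ℝ → C2} (hf : ContDiffOn ℝ ∞ f I) {s : ℝ} (hs : s ∈ I) =>
    hasDerivAt_of_smooth hI hf hs
  have e1 : ∀ s ∈ I, ∀ t, dS Y (s, t) = _ := fun s hs t =>
    dS_cyc hI hY hs (hd hA hs) (hd hB hs) (hd hV hs) t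
  have e2 : ∀ s ∈ I, ∀ t, dT Y (s, t) = _ := fun s hs t => dT_cyc hY hs t
  have e3 := dS_cyc hI e1 hs (hd (smooth_deriv hI hA) hs) (hd (smooth_deriv hI hB) hs)
    (hd (smooth_deriv hI hV) hs) t
  have e4 := dS_cyc hI e2 hs ((hd hA hs).const_smul Complex.I) ((hd hB hs).const_smul Complex.I).neg
    (hasDerivAt_const s (0 : C2)) t
  have e5 := dT_cyc e2 hs t
  have hp : (s, t) ∈ strip I := ⟨hs, trivial⟩
  have hl := hlag s hs _ hz
  rw [← e1 s hs, ← e2 s hs] at hl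
  have := jetSol_of_isSelfSimilarOn hp (himm.2 _ hp) hl hss
  rw [e3, e4, e5, e1 s hs, e2 s hs, hY s hs] at this
  convert this using 1
  · simp only [cyc, smul_neg, smul_smul, Complex.I_mul_I]
    module

end Strip

/-! ### The Lagrangian condition -/

/-- The Lagrangian condition has degree two in `z`; the null cubic term only matches the shape
required by `trig_coeffs_eq_zero`. -/
lemma om_cyc {z : ℂ} (hz : ‖z‖ = 1) (A B A' B' V' : C2) :
    om (cyc z A' B' V') (cyc z (Complex.I • A) (-(Complex.I • B)) 0)
      = ((inner ℂ B' B).re - (inner ℂ A' A).re) +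
        ((inner ℂ B V' - inner ℂ V' A) * z + (inner ℂ B A' - inner ℂ B' A) * z ^ 2 + 0 * z ^ 3).re
      := by
  have hz' : z.re ^ 2 + z.im ^ 2 = 1 := by
    have : ‖z‖ ^ 2 = 1 := by rw [hz]; norm_num
    rw [Complex.sq_norm, Complex.normSq_apply] at this
    linarith
  rw [om_eq_inner, ← inner_conj_symm B V', ← inner_conj_symm B A']
  simp only [cyc, inner_add_left, inner_add_right, inner_smul_left, inner_smul_right,
    inner_neg_right, inner_zero_right, Complex.conj_conj]
  generalize inner ℂ A' A = a, inner ℂ B' B = b, inner ℂ A' B = c, inner ℂ B' A = d,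
    inner ℂ V' A = e, inner ℂ V' B = f
  simp only [Complex.add_re, Complex.add_im, Complex.mul_re, Complex.mul_im, Complex.sub_re,
    Complex.sub_im, Complex.conj_re, Complex.conj_im, Complex.I_re, Complex.I_im, Complex.neg_re,
    Complex.neg_im, Complex.zero_re, Complex.zero_im, pow_two]
  linear_combination (b.re - a.re) * hz'

variable {lam : ℝ} {I : Set ℝ} {A B V : ℝ → C2}

lemma IsSol.lagrangian (h : IsSol lam A B V I) {s : ℝ} (hs : s ∈ I) :
    (inner ℂ (deriv A s) (A s)).re = (inner ℂ (deriv B s) (B s)).re ∧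
    inner ℂ (deriv V s) (A s) = inner ℂ (B s) (deriv V s) ∧
    inner ℂ (deriv B s) (A s) = inner ℂ (B s) (deriv A s) := by
  have := trig_coeffs_eq_zero (c₀ := (inner ℂ (deriv B s) (B s)).re - (inner ℂ (deriv A s) (A s)).re)
    (c₁ := inner ℂ (B s) (deriv V s) - inner ℂ (deriv V s) (A s))
    (c₂ := inner ℂ (B s) (deriv A s) - inner ℂ (deriv B s) (A s)) (c₃ := 0)
    (fun z hz => by rw [← (h.jet s hs z hz).lag, om_cyc hz])
  exact ⟨by linarith [this.1], (sub_eq_zero.1 this.2.1).symm, (sub_eq_zero.1 this.2.2.1).symm⟩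

/-- The two coefficients move in orthogonal directions. -/
lemma IsSol.deriv_orth (hI : IsOpen I) (h : IsSol lam A B V I) {s : ℝ} (hs : s ∈ I) :
    inner ℂ (B s) (deriv A s) = (0 : ℂ) ∧ inner ℂ (A s) (deriv B s) = (0 : ℂ) := by
  have h1 := (h.lagrangian hs).2.2
  have hA := hasDerivAt_of_smooth hI h.smoothA hs
  have hB := hasDerivAt_of_smooth hI h.smoothB hs
  have h2 : HasDerivAt (fun s => inner ℂ (A s) (B s))
      (inner ℂ (A s) (deriv B s) + inner ℂ (deriv A s) (B s)) s := hA.inner ℂ hB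
  have h3 := HasDerivAt.eq_of_eqOn hI hs (f := fun _ => (0 : ℂ)) (fun s hs => h.orth s hs)
    (hasDerivAt_const s _) h2
  rw [← inner_conj_symm, ← inner_conj_symm (deriv A s)] at h3
  -- Orthogonality makes the two products opposite and the Lagrangian condition makes them equal, so
  -- both vanish.
  have h4 : inner ℂ (deriv B s) (A s) + inner ℂ (B s) (deriv A s) = (0 : ℂ) := by
    have := congrArg conj h3
    simpa using this
  rw [h1] at h4
  have h5 : inner ℂ (B s) (deriv A s) = (0 : ℂ) := by
    linear_combination h4 / 2
  refine ⟨h5, ?_⟩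
  rw [← inner_conj_symm, h1, h5, map_zero]

lemma re_sq_add_im_sq {z : ℂ} (hz : ‖z‖ = 1) : z.re ^ 2 + z.im ^ 2 = 1 := by
  have : ‖z‖ ^ 2 = 1 := by rw [hz]; norm_num
  rw [Complex.sq_norm, Complex.normSq_apply] at this
  linarith

/-- This is the source of degree three: the Gram determinant has degree two in `z`, the position
term degree one, and `z conj z = 1` reduces the mixed products. -/
lemma trig_mul_trig {z : ℂ} (hz : ‖z‖ = 1) (f₀ K : ℝ) (f₁ f₂ x : ℂ) :
    (f₀ + (2 * f₁ * z + 2 * f₂ * z ^ 2).re) * (K + (x * z).re) =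
      (K * f₀ + (f₁ * conj x).re) + ((f₀ * x + 2 * K * f₁ + f₂ * conj x) * z +
        (2 * K * f₂ + f₁ * x) * z ^ 2 + (f₂ * x) * z ^ 3).re := by
  have hz' := re_sq_add_im_sq hz
  rw [show z ^ 3 = z * z * z by ring]
  simp only [Complex.add_re, Complex.add_im, Complex.mul_re, Complex.mul_im, Complex.conj_re,
    Complex.conj_im, Complex.ofReal_re, Complex.ofReal_im, Complex.re_ofNat, Complex.im_ofNat,
    pow_two]
  linear_combination (f₁.re * x.re + f₁.im * x.im + (f₂.re * x.re + f₂.im * x.im) * z.re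
    - (f₂.im * x.re - f₂.re * x.im) * z.im) * hz'

lemma hasDerivAt_cyc {A B V : ℝ → C2} {A' B' V' : C2} {s : ℝ} (z : ℂ) (hA : HasDerivAt A A' s)
    (hB : HasDerivAt B B' s) (hV : HasDerivAt V V' s) :
    HasDerivAt (fun s => cyc z (A s) (B s) (V s)) (cyc z A' B' V') s :=
  ((hA.const_smul z).add (hB.const_smul (conj z))).add hV

lemma hasDerivAt_om {f g : ℝ → C2} {f' g' : C2} {s : ℝ} (hf : HasDerivAt f f' s)
    (hg : HasDerivAt g g' s) :
    HasDerivAt (fun s => om (f s) (g s)) (om (f s) g' + om f' (g s)) s := by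
  have h := (Complex.imCLM.hasFDerivAt.comp_hasDerivAt s (hf.inner ℂ hg)).neg
  have e : (fun s => om (f s) (g s)) = -⇑Complex.imCLM ∘ fun t => inner ℂ (f t) (g t) := by
    funext s; simp [om_eq_inner]
  rw [e]
  refine h.congr_deriv ?_
  simp only [om_eq_inner, Complex.imCLM_apply, Complex.add_im]; ring

/-- The tangential equation along the circles, after using the symmetry of the second fundamental
form. -/
lemma IsSol.eqT {lam : ℝ} {I : Set ℝ} {A B V : ℝ → C2} (hI : IsOpen I) (h : IsSol lam A B V I)
    {s : ℝ} (hs : s ∈ I) {z : ℂ} (hz : ‖z‖ = 1) {Y S T ST TT : C2}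
    (hY : Y = cyc z (A s) (B s) (V s)) (hS : S = cyc z (deriv A s) (deriv B s) (deriv V s))
    (hT : T = cyc z (Complex.I • A s) (-(Complex.I • B s)) 0)
    (hST : ST = cyc z (Complex.I • deriv A s) (-(Complex.I • deriv B s)) 0)
    (hTT : TT = cyc z (-A s) (-B s) 0) :
    rdot T T * om ST S - 2 * rdot S T * om ST T + rdot S S * om TT T
      + lam * ((rdot S S * rdot T T - rdot S T ^ 2) * om Y T) = 0 := by
  have hd := fun {f : ℝ → C2} (hf : ContDiffOn ℝ ∞ f I) => hasDerivAt_of_smooth hI hf hs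
  have dS := hasDerivAt_cyc z (hd (smooth_deriv hI h.smoothA)) (hd (smooth_deriv hI h.smoothB))
    (hd (smooth_deriv hI h.smoothV))
  have dT := hasDerivAt_cyc z ((hd h.smoothA).const_smul Complex.I)
    ((hd h.smoothB).const_smul Complex.I).neg (hasDerivAt_const s (0 : C2))
  -- Differentiating `⟨Y_s, J Y_t⟩ = 0` in `s` gives `om SS T = om ST S`, which removes the second
  -- derivatives of the coefficients.
  have hsym := HasDerivAt.eq_of_eqOn hI hs (f := fun _ => (0 : ℝ))
    (fun s hs => (h.jet s hs z hz).lag) (hasDerivAt_const s _) (hasDerivAt_om dS dT)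
  have := (h.jet s hs z hz).eqT
  simp only [ScalarEq] at this
  rw [om_swap _ (cyc z (Complex.I • deriv A s) (-(Complex.I • deriv B s)) 0), ← hST, ← hT, ← hS]
    at hsym
  rw [← hY, ← hS, ← hT, ← hST, ← hTT] at this
  linear_combination this - rdot T T * hsym

/-- In a unitary frame with `A = (a, 0)`, `B = (0, b)`, `A' = (a₁, 0)`, `B' = (0, b₁)`, the
tangential equation forces `|A| = |B|`. -/
lemma radii_eq_of_frame {lam a b : ℝ} (hlam : lam ≠ 0) (ha : 0 < a) (hb : 0 < b)
    {a₁ b₁ v₁ v₂ p q : ℂ} (hlag : a₁.re * a = b₁.re * b) (hv : conj v₁ * a = v₂ * b)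
    {Y S T ST TT : ℂ → C2}
    (hY : ∀ z, Y z = cyc z !₂[(a : ℂ), 0] !₂[0, (b : ℂ)] !₂[p, q])
    (hS : ∀ z, S z = cyc z !₂[a₁, 0] !₂[0, b₁] !₂[v₁, v₂])
    (hT : ∀ z, T z = cyc z (Complex.I • !₂[(a : ℂ), 0]) (-(Complex.I • !₂[0, (b : ℂ)])) 0)
    (hST : ∀ z, ST z = cyc z (Complex.I • !₂[a₁, 0]) (-(Complex.I • !₂[0, b₁])) 0)
    (hTT : ∀ z, TT z = cyc z (-!₂[(a : ℂ), 0]) (-!₂[0, (b : ℂ)]) 0)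
    (hpos : ∀ z, ‖z‖ = 1 → 0 < rdot (S z) (S z) * rdot (T z) (T z) - rdot (S z) (T z) ^ 2)
    (heq : ∀ z, ‖z‖ = 1 → rdot (T z) (T z) * om (ST z) (S z)
      - 2 * rdot (S z) (T z) * om (ST z) (T z) + rdot (S z) (S z) * om (TT z) (T z)
      + lam * ((rdot (S z) (S z) * rdot (T z) (T z) - rdot (S z) (T z) ^ 2) * om (Y z) (T z)) = 0) :
    a = b := by
  -- The Lagrangian relation `hv` leaves a single complex unknown `w` for the velocity of the
  -- center.
  obtain ⟨w, hw1, hw2⟩ : ∃ w : ℂ, v₁ = b * w ∧ v₂ = a * conj w := by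
    have hb' : (b : ℂ) ≠ 0 := by exact_mod_cast hb.ne'
    refine ⟨v₁ / b, by field_simp, ?_⟩
    rw [map_div₀, Complex.conj_ofReal]
    field_simp
    linear_combination -hv
  subst hw1 hw2
  -- The Gram determinant will be `f₀ + Re(2 f₁ z + 2 f₂ z²)` and the position term `-(K + Re(x
  -- z))`, with `K = |A|² - |B|²`.
  set D : ℂ := a₁ * b + b₁ * a with hD
  set f₀ : ℝ := Complex.normSq D + (a ^ 4 + b ^ 4) * Complex.normSq w with hf₀
  set f₁ : ℂ := conj D * a ^ 2 * conj w + D * b ^ 2 * conj w with hf₁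
  set f₂ : ℂ := (a * b * conj w) ^ 2 with hf₂
  set x : ℂ := conj p * a - q * b with hx
  set K : ℝ := a ^ 2 - b ^ 2 with hK
  set G : ℝ := a ^ 2 + b ^ 2 with hG
  set m : ℝ := a₁.im * a + b₁.im * b with hm
  set n : ℝ := a₁.im * a - b₁.im * b with hn
  have eE : ∀ z, ‖z‖ = 1 → rdot (S z) (S z) = Complex.normSq a₁ + Complex.normSq b₁
      + G * Complex.normSq w + (2 * (a₁ * b * conj w + conj b₁ * a * conj w) * z).re := by
    intro z hz
    rw [hS, rdot_eq_coords]
    simp [cyc_apply, Complex.normSq_apply, hG]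
    linear_combination (a₁.re ^ 2 + a₁.im ^ 2 + b₁.re ^ 2 + b₁.im ^ 2) * re_sq_add_im_sq hz
  have eG : ∀ z, ‖z‖ = 1 → rdot (T z) (T z) = G := by
    intro z hz
    rw [hT, rdot_eq_coords]
    simp [cyc_apply, hG]
    linear_combination (a ^ 2 + b ^ 2) * re_sq_add_im_sq hz
  have eF : ∀ z, ‖z‖ = 1 → rdot (S z) (T z) = n + (2 * Complex.I * (a * b * conj w) * z).re := by
    intro z hz
    rw [hS, hT, rdot_eq_coords]
    simp [cyc_apply, hn]
    linear_combination (a₁.im * a - b₁.im * b) * re_sq_add_im_sq hz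
  have eTTT : ∀ z, ‖z‖ = 1 → om (TT z) (T z) = K := by
    intro z hz
    rw [hTT, hT, om_eq_coords]
    simp [cyc_apply, hK]
    linear_combination (a ^ 2 - b ^ 2) * re_sq_add_im_sq hz
  have eSTT : ∀ z, ‖z‖ = 1 → om (ST z) (T z) = m := by
    intro z hz
    rw [hST, hT, om_eq_coords]
    simp [cyc_apply, hm]
    linear_combination (a₁.im * a + b₁.im * b) * re_sq_add_im_sq hz
  have eSTS : ∀ z, ‖z‖ = 1 → om (ST z) (S z) = Complex.normSq a₁ - Complex.normSq b₁
      + ((a₁ * b * conj w - conj b₁ * a * conj w) * z).re := by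
    intro z hz
    rw [hST, hS, om_eq_coords]
    simp [cyc_apply, Complex.normSq_apply]
    linear_combination (a₁.re ^ 2 + a₁.im ^ 2 - b₁.re ^ 2 - b₁.im ^ 2) * re_sq_add_im_sq hz
  have eY : ∀ z, ‖z‖ = 1 → om (Y z) (T z) = -(K + (x * z).re) := by
    intro z hz
    rw [hY, hT, om_eq_coords]
    simp [cyc_apply, hK, hx]
    linear_combination -(a ^ 2 - b ^ 2) * re_sq_add_im_sq hz
  have eDet : ∀ z, ‖z‖ = 1 → rdot (S z) (S z) * rdot (T z) (T z) - rdot (S z) (T z) ^ 2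
      = f₀ + (2 * f₁ * z + 2 * f₂ * z ^ 2).re := by
    intro z hz
    rw [eE z hz, eG z hz, eF z hz]
    have h1 := re_sq_add_im_sq hz
    simp [hf₀, hf₁, hf₂, hD, Complex.normSq_apply, hn, hG, pow_two]
    linear_combination (a * a₁.re - b * b₁.re) * hlag
      - 2 * a ^ 2 * b ^ 2 * (w.re ^ 2 + w.im ^ 2) * h1
  have main := trig_coeffs_eq_zero
    (c₀ := G * (Complex.normSq a₁ - Complex.normSq b₁) - 2 * n * m
      + (Complex.normSq a₁ + Complex.normSq b₁ + G * Complex.normSq w) * K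
      - lam * (K * f₀ + (f₁ * conj x).re))
    (c₁ := G * (a₁ * b * conj w - conj b₁ * a * conj w)
      - 2 * (2 * Complex.I * (a * b * conj w)) * m
      + K * (2 * (a₁ * b * conj w + conj b₁ * a * conj w))
      - lam * (f₀ * x + 2 * K * f₁ + f₂ * conj x))
    (c₂ := -lam * (2 * K * f₂ + f₁ * x)) (c₃ := - lam * (f₂ * x)) (by
      intro z hz
      have h1 := heq z hz
      rw [eDet z hz, eY z hz, mul_neg, trig_mul_trig hz, eE z hz, eG z hz, eF z hz, eTTT z hz,
        eSTT z hz, eSTS z hz] at h1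
      rw [← h1]
      generalize z ^ 2 = z₂, z ^ 3 = z₃
      simp only [Complex.add_re, Complex.add_im, Complex.sub_re, Complex.sub_im, Complex.neg_re,
        Complex.neg_im, Complex.mul_re, Complex.mul_im, Complex.ofReal_re, Complex.ofReal_im,
        Complex.re_ofNat, Complex.im_ofNat]
      ring)
  obtain ⟨h0, -, h2, h3⟩ := main
  have hl : (lam : ℂ) ≠ 0 := by exact_mod_cast hlam
  have h2' : 2 * K * f₂ + f₁ * x = 0 := (mul_eq_zero.1 h2).resolve_left (neg_ne_zero.2 hl)
  have h3' : f₂ * x = 0 := (mul_eq_zero.1 h3).resolve_left (neg_ne_zero.2 hl)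
  -- For `K ≠ 0` the coefficients of `z³` and `z²` force `f₂ = 0`, hence `w = 0` and `f₁ = 0`. The
  -- constant coefficient will then kill `f₀`, and the Gram determinant with it.
  by_contra hne
  have hK0 : K ≠ 0 := by
    have : K = (a - b) * (a + b) := by rw [hK]; ring
    rw [this]
    exact mul_ne_zero (sub_ne_zero.2 hne) (by positivity)
  have hf20 : f₂ = 0 := by
    rcases mul_eq_zero.1 h3' with h | h
    · exact h
    · rw [h, mul_zero, add_zero] at h2'
      exact (mul_eq_zero.1 h2').resolve_left (mul_ne_zero two_ne_zero (by exact_mod_cast hK0))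
  have hw : w = 0 := by
    have ha' : (a : ℂ) ≠ 0 := by exact_mod_cast ha.ne'
    have hb' : (b : ℂ) ≠ 0 := by exact_mod_cast hb.ne'
    have := eq_zero_of_pow_eq_zero hf20
    simpa [ha', hb'] using this
  have hf10 : f₁ = 0 := by rw [hf₁, hw]; simp
  rw [hf10, hw] at h0
  -- With `w = 0` the curvature terms cancel by `hlag`, and only the position term survives.
  have hf : lam * K * f₀ = 0 := by
    simp only [hG, hn, hm, hK, Complex.normSq_apply, zero_mul, Complex.zero_re,
      Complex.zero_im, mul_zero, add_zero]
      at h0 ⊢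
    linear_combination -h0 + 2 * (a₁.re * a + b₁.re * b) * hlag
  have hf00 : f₀ = 0 := (mul_eq_zero.1 hf).resolve_left (mul_ne_zero hlam hK0)
  have := hpos 1 (by simp)
  rw [eDet 1 (by simp), hf00, hf10, hf20] at this
  simp at this

lemma eq_frame_smul {f₁ f₂ : C2} (h₁ : inner ℂ f₁ f₁ = (1 : ℂ)) (h₂ : inner ℂ f₂ f₂ = (1 : ℂ))
    (h : inner ℂ f₁ f₂ = (0 : ℂ)) (x : C2) :
    x = (inner ℂ f₁ x : ℂ) • f₁ + (inner ℂ f₂ x : ℂ) • f₂ := by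
  obtain ⟨b, hb⟩ := Orthonormal.exists_orthonormalBasis_extension_of_card_eq
    (𝕜 := ℂ) (E := C2) (ι := Fin 2) (by simp) (v := ![f₁, f₂]) (s := Set.univ)
    ((orthonormal_pair h₁ h₂ h).comp _ Subtype.val_injective)
  have h0 : b 0 = f₁ := by simpa using hb 0 trivial
  have h1 : b 1 = f₂ := by simpa using hb 1 trivial
  simpa [Fin.sum_univ_two, h0, h1] using (b.sum_repr' x).symm

/-- A unitary map that sends two orthogonal vectors to the coordinate axes. -/
lemma exists_unitary_axes {A B : C2} (hA : A ≠ 0) (hB : B ≠ 0) (h : inner ℂ A B = (0 : ℂ)) :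
    ∃ U : C2 ≃ₗᵢ[ℂ] C2, U A = !₂[(‖A‖ : ℂ), 0] ∧ U B = !₂[0, (‖B‖ : ℂ)] := by
  have hA' : (‖A‖ : ℂ) ≠ 0 := by simpa using hA
  have hB' : (‖B‖ : ℂ) ≠ 0 := by simpa using hB
  have unit : ∀ {A : C2}, (‖A‖ : ℂ) ≠ 0 →
      inner ℂ ((‖A‖ : ℂ)⁻¹ • A) ((‖A‖ : ℂ)⁻¹ • A) = (1 : ℂ) := by
    intro A hA
    rw [inner_smul_left, inner_smul_right, inner_self_eq_norm_sq_to_K, map_inv₀,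
      Complex.conj_ofReal]
    simp only [Complex.coe_algebraMap]
    field_simp
  obtain ⟨U, h1, h2⟩ := exists_unitary (unit hA') (unit hB')
    (by rw [inner_smul_left, inner_smul_right, h]; simp)
    (g₁ := !₂[1, 0]) (g₂ := !₂[0, 1]) (by rw [inner_eq_coords]; simp)
    (by rw [inner_eq_coords]; simp) (by rw [inner_eq_coords]; simp)
  rw [map_smul, inv_smul_eq_iff₀ hA'] at h1
  rw [map_smul, inv_smul_eq_iff₀ hB'] at h2
  refine ⟨U, ?_, ?_⟩
  · rw [h1]; ext i; fin_cases i <;> simp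
  · rw [h2]; ext i; fin_cases i <;> simp

lemma vec_eta (x : C2) : x = !₂[x 0, x 1] := by
  ext i; fin_cases i <;> simp

/-- Two nonzero coefficients have the same norm. -/
lemma IsSol.norm_eq {lam : ℝ} (hlam : lam ≠ 0) {I : Set ℝ} {A B V : ℝ → C2} (hI : IsOpen I)
    (h : IsSol lam A B V I) {s : ℝ} (hs : s ∈ I) (hA : A s ≠ 0) (hB : B s ≠ 0) :
    ‖A s‖ = ‖B s‖ := by
  obtain ⟨U, hUA, hUB⟩ := exists_unitary_axes hA hB (h.orth s hs)
  have hnA : 0 < ‖A s‖ := norm_pos_iff.2 hA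
  have hnB : 0 < ‖B s‖ := norm_pos_iff.2 hB
  have hU := h.unitary hI U
  obtain ⟨l1, l2, -⟩ := hU.lagrangian hs
  obtain ⟨o1, o2⟩ := hU.deriv_orth hI hs
  have eT := fun z hz => hU.eqT hI hs (z := z) hz rfl rfl rfl rfl rfl
  have hp := fun z hz => gram_pos (hU.jet s hs z hz).indep
  simp only [hUA, hUB] at l1 l2 o1 o2 eT hp
  generalize deriv (fun s => U (A s)) s = A' at *
  generalize deriv (fun s => U (B s)) s = B' at *
  generalize deriv (fun s => U (V s)) s = V' at *
  generalize U (V s) = W at *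
  -- In these axes, orthogonality of each velocity to the other coefficient leaves one coordinate in
  -- each of `A'` and `B'`.
  have hA1 : A' 1 = 0 := by simpa [inner_eq_coords, hB] using o1
  have hB0 : B' 0 = 0 := by simpa [inner_eq_coords, hA] using o2
  rw [vec_eta A', vec_eta B', vec_eta V', vec_eta W, hA1, hB0] at eT
  rw [vec_eta A', vec_eta B', vec_eta V', hA1, hB0] at hp
  refine radii_eq_of_frame hlam hnA hnB (a₁ := A' 0) (b₁ := B' 1) (v₁ := V' 0) (v₂ := V' 1)
    ?_ ?_ (fun z => rfl) (fun z => rfl) (fun z => rfl) (fun z => rfl) (fun z => rfl) hp eT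
  · simpa [inner_eq_coords] using l1
  · have := l2
    simp only [inner_eq_coords] at this
    simpa [mul_comm] using this

/-! ### Circles in complex lines -/

/-- The quaternionic structure `(x, y) ↦ (conj y, -conj x)` of `ℂ²`. -/
def quat : C2 →L[ℝ] C2 := LinearMap.toContinuousLinearMap
  { toFun := fun x => !₂[conj (x 1), -conj (x 0)]
    map_add' := fun x y => by ext i; fin_cases i <;> simp [add_comm]
    map_smul' := fun a x => by ext i; fin_cases i <;> simp }

lemma quat_apply (x : C2) : quat x = !₂[conj (x 1), -conj (x 0)] := rfl

lemma quat_smul (a : ℂ) (x : C2) : quat (a • x) = conj a • quat x := by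
  ext i; fin_cases i <;> simp [quat_apply]

lemma quat_quat (x : C2) : quat (quat x) = -x := by
  ext i; fin_cases i <;> simp [quat_apply]

lemma inner_quat_self (x : C2) : inner ℂ x (quat x) = (0 : ℂ) := by
  simp [inner_eq_coords, quat_apply]; ring

lemma inner_quat_quat (x y : C2) : inner ℂ (quat x) (quat y) = (inner ℂ y x : ℂ) := by
  simp [inner_eq_coords, quat_apply]; ring

lemma inner_frame {g : C2} (hg : inner ℂ g g = (1 : ℂ)) (a b a' b' : ℂ) :
    inner ℂ (a • g + b • quat g) (a' • g + b' • quat g)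
    = conj a * a' + conj b * b' := by
  have h1 := inner_quat_self g
  have h2 : inner ℂ (quat g) g = (0 : ℂ) := by rw [← inner_conj_symm, h1, map_zero]
  have h3 : inner ℂ (quat g) (quat g) = (1 : ℂ) := by rw [inner_quat_quat, hg]
  simp only [inner_add_left, inner_add_right, inner_smul_left, inner_smul_right, h1, h2, h3, hg]
  ring

lemma rdot_frame {g : C2} (hg : inner ℂ g g = (1 : ℂ)) (a b a' b' : ℂ) :
    rdot (a • g + b • quat g) (a' • g + b' • quat g)
    = (conj a * a' + conj b * b').re := by rw [rdot, inner_frame hg]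

lemma om_frame {g : C2} (hg : inner ℂ g g = (1 : ℂ)) (a b a' b' : ℂ) :
    om (a • g + b • quat g) (a' • g + b' • quat g)
    = -(conj a * a' + conj b * b').im := by rw [om_eq_inner, inner_frame hg]

lemma eq_quat_frame {g : C2} (hg : inner ℂ g g = (1 : ℂ)) (x : C2) :
    x = (inner ℂ g x : ℂ) • g + (inner ℂ (quat g) x : ℂ) • quat g :=
  eq_frame_smul hg (by rw [inner_quat_quat, hg]) (inner_quat_self g) x

/-- The scalar equations for circles in complex lines, in a unitary frame `g, quat g`. -/
lemma circle_scalar_eqs {lam c : ℝ} (hc : c ≠ 0) {g Y S T SS ST TT : C2}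
    (hg : inner ℂ g g = (1 : ℂ)) {z μ μ' W W' v h : ℂ} (hz : ‖z‖ = 1)
    (hj : JetSol lam Y S T SS ST TT)
    (hY : Y = (c * z + v) • g + h • quat g) (hS : S = (0 : ℂ) • g + (c * z * μ + W) • quat g)
    (hT : T = (Complex.I * c * z) • g + (0 : ℂ) • quat g)
    (hSS : SS = (-(conj μ * (c * z * μ + W))) • g + (c * z * μ' + W') • quat g)
    (hTT : TT = (-(c * z)) • g + (0 : ℂ) • quat g) :
    c * z * μ + W ≠ 0 ∧
    c * (c * Complex.normSq μ + (μ * conj W * z).re) + Complex.normSq (c * z * μ + W) *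
      (1 - lam * c ^ 2 - lam * c * (conj v * z).re) = 0 ∧
    ((c * z * μ' + W') * conj (c * z * μ + W)).im +
      lam * Complex.normSq (c * z * μ + W) * (h * conj (c * z * μ + W)).im = 0 := by
  have hz' := re_sq_add_im_sq hz
  have hp := gram_pos hj.indep
  have e1 := hj.eqT
  have e2 := hj.eqS
  simp only [ScalarEq] at e1 e2
  have rSS : rdot S S = Complex.normSq (c * z * μ + W) := by
    rw [hS, rdot_frame hg]; simp [Complex.normSq_apply]; ring
  have rTT : rdot T T = c ^ 2 := by
    rw [hT, rdot_frame hg]; simp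
    linear_combination c ^ 2 * hz'
  have rST : rdot S T = 0 := by
    rw [hS, hT, rdot_frame hg]; simp
  rw [rSS, rTT, rST] at hp e1 e2
  have hc2 : c ^ 2 ≠ 0 := pow_ne_zero 2 hc
  -- Here `S` and `T` are orthogonal, so the mixed term disappears, and `|T|² = c²` is a common
  -- factor of both equations.
  refine ⟨fun h0 => ?_, mul_left_cancel₀ hc2 ?_, mul_left_cancel₀ hc2 ?_⟩
  · rw [h0] at hp; simp at hp
  · rw [mul_zero, ← e1]
    have o1 : om SS T = c * (c * Complex.normSq μ + (μ * conj W * z).re) := by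
      rw [hSS, hT, om_frame hg]; simp [Complex.normSq_apply]
      linear_combination (c ^ 2 * (μ.re ^ 2 + μ.im ^ 2)) * hz'
    have o2 : om TT T = c ^ 2 := by
      rw [hTT, hT, om_frame hg]; simp
      linear_combination c ^ 2 * hz'
    have o3 : om Y T = -c ^ 2 - c * (conj v * z).re := by
      rw [hY, hT, om_frame hg]; simp
      linear_combination -c ^ 2 * hz'
    rw [o1, o2, o3]; ring
  · rw [mul_zero, ← e2]
    have o1 : om SS S = ((c * z * μ' + W') * conj (c * z * μ + W)).im := by
      rw [hSS, hS, om_frame hg]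
      generalize c * z * μ' + W' = x, c * z * μ + W = y
      simp; ring
    have o2 : om TT S = 0 := by
      rw [hTT, hS, om_frame hg]; simp
    have o3 : om Y S = (h * conj (c * z * μ + W)).im := by
      rw [hY, hS, om_frame hg]
      generalize c * z * μ + W = y
      simp; ring
    rw [o1, o2, o3]; ring

/-- With `p = μ conj W`, the coefficient of `z²` gives `p x = 0`. If `x ≠ 0`, then `p = 0` and the
coefficient of `z` becomes `e x`, where `e > 0` by immersivity; so `x = 0`, that is `v = 0`. What
remains is `p (1 + 2k) = 0` and `c²|μ|² + k e = 0` with `k = 1 - λc²`, giving `k = 0` if `μ = 0` and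
`k = -1` if `W = 0`. -/
lemma circle_dichotomy {lam c : ℝ} (hlam : lam ≠ 0) (hc : c ≠ 0) {μ W v : ℂ}
    (hne : ∀ z : ℂ, ‖z‖ = 1 → c * z * μ + W ≠ 0)
    (heq : ∀ z : ℂ, ‖z‖ = 1 → c * (c * Complex.normSq μ + (μ * conj W * z).re) +
      Complex.normSq (c * z * μ + W) * (1 - lam * c ^ 2 - lam * c * (conj v * z).re) = 0) :
    v = 0 ∧ ((lam * c ^ 2 = 1 ∧ μ = 0) ∨ (lam * c ^ 2 = 2 ∧ W = 0)) := by
  set p := μ * conj W with hp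
  set e : ℝ := c ^ 2 * Complex.normSq μ + Complex.normSq W with he
  set k : ℝ := 1 - lam * c ^ 2 with hk
  set x : ℂ := -(lam * c * conj v) with hx
  have hc' : (c : ℂ) ≠ 0 := by exact_mod_cast hc
  have hl' : (lam : ℂ) ≠ 0 := by exact_mod_cast hlam
  have hmod : ∀ z : ℂ, ‖z‖ = 1 → Complex.normSq (c * z * μ + W)
      = e + (2 * (c * p) * z + 2 * 0 * z ^ 2).re := by
    intro z hz
    simp [hp, he, Complex.normSq_apply]
    linear_combination (c ^ 2 * (μ.re ^ 2 + μ.im ^ 2)) * re_sq_add_im_sq hz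
  obtain ⟨h0, h1, h2, -⟩ := trig_coeffs_eq_zero
    (c₀ := c ^ 2 * Complex.normSq μ + (k * e + (c * p * conj x).re))
    (c₁ := c * p + (e * x + 2 * k * (c * p))) (c₂ := c * p * x) (c₃ := 0) (by
      intro z hz
      have h := heq z hz
      have hk' : k - lam * c * (conj v * z).re = k + (x * z).re := by
        rw [hx, show -(lam * c * conj v) * z = ((-(lam * c) : ℝ) : ℂ) * (conj v * z) by
          push_cast; ring, Complex.re_ofReal_mul]
        ring
      rw [hk', hmod z hz, trig_mul_trig hz] at h
      rw [← h]
      generalize z ^ 2 = z₂, z ^ 3 = z₃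
      simp only [Complex.add_re, Complex.add_im, Complex.mul_re, Complex.mul_im,
        Complex.ofReal_re, Complex.ofReal_im, Complex.re_ofNat, Complex.im_ofNat,
        Complex.zero_re, Complex.zero_im]
      ring)
  have hepos : e ≠ 0 := by
    intro h
    have h3 : Complex.normSq μ = 0 := by
      have := Complex.normSq_nonneg W
      have h4 := mul_nonneg (sq_nonneg c) (Complex.normSq_nonneg μ)
      have h5 : c ^ 2 * Complex.normSq μ = 0 := by linarith
      exact (mul_eq_zero.1 h5).resolve_left (pow_ne_zero 2 hc)
    have h4 : Complex.normSq W = 0 := by rw [h3] at he; linarith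
    rw [Complex.normSq_eq_zero] at h3 h4
    exact hne 1 (by simp) (by rw [h3, h4]; simp)
  have hpx : p * x = 0 := by
    have : (c : ℂ) * (p * x) = 0 := by linear_combination h2
    exact (mul_eq_zero.1 this).resolve_left hc'
  have hx0 : x = 0 := by
    by_contra hx0
    have hp0 : p = 0 := (mul_eq_zero.1 hpx).resolve_right hx0
    rw [hp0] at h1
    have : (e : ℂ) * x = 0 := by linear_combination h1
    exact (mul_ne_zero (by exact_mod_cast hepos) hx0) this
  have hv : v = 0 := by
    rw [hx] at hx0
    simpa [hlam, hc] using hx0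
  refine ⟨hv, ?_⟩
  rw [hx0] at h0 h1
  have h1' : p * (1 + 2 * k) = 0 := by
    have : (c : ℂ) * (p * (1 + 2 * k)) = 0 := by linear_combination h1
    exact (mul_eq_zero.1 this).resolve_left hc'
  have h0' : c ^ 2 * Complex.normSq μ + k * e = 0 := by simpa using h0
  by_cases hμ : μ = 0
  · left
    refine ⟨?_, hμ⟩
    have : k * e = 0 := by rw [hμ] at h0'; simpa using h0'
    have := (mul_eq_zero.1 this).resolve_right hepos
    linarith
  by_cases hW : W = 0
  · right
    refine ⟨?_, hW⟩
    have h3 : (c ^ 2 * Complex.normSq μ) * (1 + k) = 0 := by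
      rw [he, hW] at h0'; simp at h0'; linarith
    have h4 := (mul_eq_zero.1 h3).resolve_left
      (mul_ne_zero (pow_ne_zero 2 hc) (by simpa using hμ))
    linarith
  -- If `μ` and `W` are both nonzero, then `k = -1/2` and `|W| = |cμ|`, so `c z μ + W` vanishes at
  -- some unit `z`, against immersivity.
  exfalso
  have hp0 : p ≠ 0 := mul_ne_zero hμ (by simpa using hW)
  have h2k : 1 + 2 * k = 0 := by
    have := (mul_eq_zero.1 h1').resolve_left hp0
    exact_mod_cast this
  have hnorm : Complex.normSq W = c ^ 2 * Complex.normSq μ := by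
    rw [he] at h0'
    linear_combination -2 * h0' + (c ^ 2 * Complex.normSq μ + Complex.normSq W) * h2k
  have hcμ : (c : ℂ) * μ ≠ 0 := mul_ne_zero hc' hμ
  refine hne (-W / (c * μ)) ?_ (by field_simp; ring)
  have h5 : ‖W‖ ^ 2 = ‖(c : ℂ) * μ‖ ^ 2 := by
    rw [Complex.sq_norm, Complex.sq_norm, hnorm, map_mul, Complex.normSq_ofReal]; ring
  have h6 : ‖W‖ = ‖(c : ℂ) * μ‖ := by
    rwa [sq_eq_sq₀ (norm_nonneg _) (norm_nonneg _)] at h5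
  rw [norm_div, norm_neg, h6, div_self (norm_ne_zero_iff.2 hcμ)]

lemma cdot_unitNormal (Γ : ℝ → ℂ) (s : ℝ) (x : ℂ) :
    cdot x (unitNormal Γ s) = (x * conj (deriv Γ s)).im / ‖deriv Γ s‖ := by
  simp only [cdot, unitNormal, map_div₀, Complex.conj_ofReal, ← mul_div_assoc, Complex.div_ofReal_re]
  congr 1
  simp; ring

lemma curvature_eq (Γ : ℝ → ℂ) (s : ℝ) :
    curvature Γ s = (deriv (deriv Γ) s * conj (deriv Γ s)).im / ‖deriv Γ s‖ ^ 3 := by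
  rw [curvature, cdot_unitNormal, div_div, ← pow_succ']

/-- The curve equation multiplied by `|Γ'|³`, the form in which the surface equations deliver it. -/
lemma isSelfSimilarCurveOn_of_eq {lam : ℝ} {Γ : ℝ → ℂ} {I : Set ℝ} (hΓ : IsRegularCurveOn Γ I)
    (h : ∀ s ∈ I, (deriv (deriv Γ) s * conj (deriv Γ s)).im +
      lam * Complex.normSq (deriv Γ s) * (Γ s * conj (deriv Γ s)).im = 0) :
    IsSelfSimilarCurveOn lam Γ I := by
  refine ⟨hΓ, fun s hs => ?_⟩
  have hn : ‖deriv Γ s‖ ≠ 0 := norm_ne_zero_iff.2 (hΓ.2 s hs)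
  rw [curvature_eq, cdot_unitNormal]
  have := h s hs
  rw [← Complex.sq_norm] at this
  generalize (deriv (deriv Γ) s * conj (deriv Γ s)).im = x, (Γ s * conj (deriv Γ s)).im = y at *
  field_simp
  linear_combination this

lemma smooth_inner {E : Type*} [NormedAddCommGroup E] [InnerProductSpace ℂ E] {I : Set ℝ}
    {f g : ℝ → E} (hf : ContDiffOn ℝ ∞ f I) (hg : ContDiffOn ℝ ∞ g I) :
    ContDiffOn ℝ ∞ (fun s => (inner ℂ (f s) (g s) : ℂ)) I :=
  hf.inner ℂ hg

/-- The derivatives of a horizontal curve in the unit sphere and of a curve with velocity in the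
direction of the orthogonal complex line. -/
lemma typeII_scalar_eqs {lam c : ℝ} {I : Set ℝ} (hc : c ≠ 0) (hI : IsOpen I) {γ V : ℝ → C2}
    {μ W : ℝ → ℂ} (hμ : ContDiffOn ℝ ∞ μ I) (hW : ContDiffOn ℝ ∞ W I)
    (hunit : ∀ s ∈ I, inner ℂ (γ s) (γ s) = (1 : ℂ))
    (hγ' : ∀ s ∈ I, HasDerivAt γ (μ s • quat (γ s)) s)
    (hV' : ∀ s ∈ I, HasDerivAt V (W s • quat (γ s)) s)
    (h : IsSol lam (fun s => (c : ℂ) • γ s) (fun _ => 0) V I) {s : ℝ} (hs : s ∈ I) {z : ℂ}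
    (hz : ‖z‖ = 1) :
    c * z * μ s + W s ≠ 0 ∧
    c * (c * Complex.normSq (μ s) + (μ s * conj (W s) * z).re) +
      Complex.normSq (c * z * μ s + W s) *
      (1 - lam * c ^ 2 - lam * c * (conj (inner ℂ (γ s) (V s)) * z).re) = 0 ∧
    ((c * z * deriv μ s + deriv W s) * conj (c * z * μ s + W s)).im +
      lam * Complex.normSq (c * z * μ s + W s) *
        (inner ℂ (quat (γ s)) (V s) * conj (c * z * μ s + W s)).im = 0 := by
  -- `quat` is antilinear with square `-1`, so the frame `γ, quat γ` satisfies a closed linear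
  -- system.
  have hq : ∀ s ∈ I, HasDerivAt (fun s => quat (γ s)) (-(conj (μ s)) • γ s) s := by
    intro s hs
    refine (quat.hasFDerivAt.comp_hasDerivAt s (hγ' s hs)).congr_deriv ?_
    rw [quat_smul, quat_quat, smul_neg, neg_smul]
  have d := fun {f : ℝ → ℂ} (hf : ContDiffOn ℝ ∞ f I) s (hs : s ∈ I) => hasDerivAt_of_smooth hI hf hs
  have hj := h.jet_of_hasDerivAt hI (fun s hs => (hγ' s hs).const_smul (c : ℂ))
    (fun s hs => ((d hμ s hs).smul (hq s hs)).const_smul (c : ℂ))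
    (fun s hs => hasDerivAt_const s (0 : C2)) (fun s hs => hasDerivAt_const s (0 : C2))
    hV' (fun s hs => (d hW s hs).smul (hq s hs)) hs hz
  refine circle_scalar_eqs hc (hunit s hs) hz hj ?_ ?_ ?_ ?_ ?_
  · conv_lhs => rw [eq_quat_frame (hunit s hs) (V s)]
    simp only [cyc]; module
  all_goals simp only [cyc]; module

/-- The parallel curves of a great circle. -/
lemma exists_great_circle {I : Set ℝ} (hI : IsOpenInterval I) {γ : ℝ → C2} {ρ : ℝ → ℝ} {e : ℂ}
    (hρ : ContDiffOn ℝ ∞ ρ I) (he : conj e * e = 1)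
    (hunit : ∀ s ∈ I, inner ℂ (γ s) (γ s) = (1 : ℂ))
    (hγ' : ∀ s ∈ I, HasDerivAt γ ((ρ s * e) • quat (γ s)) s) :
    ∃ (x : ℝ → ℝ) (F₁ F₂ : C2), ContDiffOn ℝ ∞ x I ∧ (∀ s ∈ I, HasDerivAt x (ρ s) s) ∧
      inner ℂ F₁ F₁ = (1 : ℂ) ∧ inner ℂ F₂ F₂ = (1 : ℂ) ∧ inner ℂ F₁ F₂ = (0 : ℂ) ∧
      ∀ s ∈ I, γ s = (Real.cos (x s) : ℂ) • F₁ + (Real.sin (x s) : ℂ) • F₂ := by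
  obtain ⟨x, hx, hx'⟩ := exists_primitive hI hρ
  have hq : ∀ s ∈ I, HasDerivAt (fun s => quat (γ s)) (-(ρ s * conj e) • γ s) s := by
    intro s hs
    refine (quat.hasFDerivAt.comp_hasDerivAt s (hγ' s hs)).congr_deriv ?_
    rw [quat_smul, quat_quat, smul_neg, neg_smul, map_mul, Complex.conj_ofReal]
  have hcos : ∀ s ∈ I, HasDerivAt (fun s => (Real.cos (x s) : ℂ)) (-Real.sin (x s) * ρ s : ℝ) s :=
    fun s hs => ((hx' s hs).cos).ofReal_comp
  have hsin : ∀ s ∈ I, HasDerivAt (fun s => (Real.sin (x s) : ℂ)) (Real.cos (x s) * ρ s : ℝ) s :=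
    fun s hs => ((hx' s hs).sin).ofReal_comp
  -- The moving frame `γ, e quat γ` turns with angular speed `ρ`; `F₁` and `F₂` are that frame
  -- rotated back by the angle `x`, hence constant.
  obtain ⟨F₁, hF₁⟩ := eq_const_of_hasDerivAt_zero hI
    (f := fun s => (Real.cos (x s) : ℂ) • γ s + (-(Real.sin (x s) : ℂ) * e) • quat (γ s)) (by
      intro s hs
      refine (((hcos s hs).smul (hγ' s hs)).add
        (((hsin s hs).neg.mul_const e).smul (hq s hs))).congr_deriv ?_
      have : (Real.sin (x s) : ℂ) * ρ s * (conj e * e) = Real.sin (x s) * ρ s := by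
        rw [he, mul_one]
      push_cast at this ⊢
      match_scalars
      · ring
      · simp only [Pi.neg_apply]
        linear_combination this)
  obtain ⟨F₂, hF₂⟩ := eq_const_of_hasDerivAt_zero hI
    (f := fun s => (Real.sin (x s) : ℂ) • γ s + ((Real.cos (x s) : ℂ) * e) • quat (γ s)) (by
      intro s hs
      refine (((hsin s hs).smul (hγ' s hs)).add
        (((hcos s hs).mul_const e).smul (hq s hs))).congr_deriv ?_
      have : (Real.cos (x s) : ℂ) * ρ s * (conj e * e) = Real.cos (x s) * ρ s := by
        rw [he, mul_one]
      push_cast at this ⊢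
      match_scalars
      · ring
      · linear_combination -this)
  have hcs : ∀ s, (Real.cos (x s) : ℂ) ^ 2 + (Real.sin (x s) : ℂ) ^ 2 = 1 := fun s => by
    exact_mod_cast Real.cos_sq_add_sin_sq (x s)
  obtain ⟨s₀, hs₀⟩ := hI.1
  have hc := hcs s₀
  refine ⟨x, F₁, F₂, hx, hx', ?_, ?_, ?_, fun s hs => ?_⟩
  · rw [← hF₁ s₀ hs₀, inner_frame (hunit s₀ hs₀)]
    simp only [map_mul, map_neg, Complex.conj_ofReal]
    linear_combination hc + (Real.sin (x s₀) : ℂ) ^ 2 * he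
  · rw [← hF₂ s₀ hs₀, inner_frame (hunit s₀ hs₀)]
    simp only [map_mul, Complex.conj_ofReal]
    linear_combination hc + (Real.cos (x s₀) : ℂ) ^ 2 * he
  · rw [← hF₁ s₀ hs₀, ← hF₂ s₀ hs₀, inner_frame (hunit s₀ hs₀)]
    simp only [map_mul, map_neg, Complex.conj_ofReal]
    linear_combination -(Real.sin (x s₀) * Real.cos (x s₀) : ℂ) * he
  · rw [← hF₁ s hs, ← hF₂ s hs]
    have hc := hcs s
    match_scalars
    · push_cast at hc ⊢
      linear_combination -hc
    · ring

lemma sqrt_two_inv_sq : ((Real.sqrt 2 : ℂ))⁻¹ ^ 2 = 1 / 2 := by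
  rw [inv_pow, ← Complex.ofReal_pow, Real.sq_sqrt (by norm_num)]; simp

/-- Self-similar surfaces foliated by circles in complex lines. -/
theorem typeII_classification {lam c : ℝ} (hlam : lam ≠ 0) {I : Set ℝ} (hI : IsOpenInterval I)
    {γ V : ℝ → C2} (hγ : ContDiffOn ℝ ∞ γ I)
    (hunit : ∀ s ∈ I, inner ℂ (γ s) (γ s) = (1 : ℂ))
    (hleg : ∀ s ∈ I, inner ℂ (γ s) (deriv γ s) = (0 : ℂ))
    (h : IsSol lam (fun s => (c : ℂ) • γ s) (fun _ => 0) V I) :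
    ((∃ γ₀ : C2, ∀ s ∈ I, γ s = γ₀) ∧ lam * c ^ 2 = 1 ∧
        ∃ (U : C2 ≃ₗᵢ[ℂ] C2) (Γ : ℝ → ℂ), IsSelfSimilarCurveOn lam Γ I ∧
          ∀ s ∈ I, ∀ t : ℝ, U (typeII c γ V (s, t)) = circleProduct c Γ (s, t)) ∨
      ((∀ s ∈ I, V s = 0) ∧ lam * c ^ 2 = 2 ∧ (∀ s ∈ I, deriv γ s ≠ 0) ∧
        ∃ (U : C2 ≃ₗᵢ[ℂ] C2) (x : ℝ → ℝ), IsRegularCurveOn x I ∧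
          ∀ s ∈ I, ∀ t : ℝ, U (typeII c γ V (s, t)) = cliffordTorus c (x s, t)) := by
  have hO := hI.2.1
  obtain ⟨s₀, hs₀⟩ := hI.1
  have hc : c ≠ 0 := by
    rintro rfl
    have := (h.jet s₀ hs₀ 1 (by simp)).indep.ne_zero 1
    simp [cyc] at this
  have hc' : (c : ℂ) ≠ 0 := by exact_mod_cast hc
  have hqs : ContDiffOn ℝ ∞ (fun s => quat (γ s)) I := quat.contDiff.comp_contDiffOn hγ
  set μ : ℝ → ℂ := fun s => inner ℂ (quat (γ s)) (deriv γ s) with hμdef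
  set W : ℝ → ℂ := fun s => inner ℂ (quat (γ s)) (deriv V s) with hWdef
  have hμ : ContDiffOn ℝ ∞ μ I := smooth_inner hqs (smooth_deriv hO hγ)
  have hW : ContDiffOn ℝ ∞ W I := smooth_inner hqs (smooth_deriv hO h.smoothV)
  have hγ' : ∀ s ∈ I, HasDerivAt γ (μ s • quat (γ s)) s := by
    intro s hs
    have := hasDerivAt_of_smooth hO hγ hs
    rwa [eq_quat_frame (hunit s hs) (deriv γ s), hleg s hs, zero_smul, zero_add] at this
  have hV' : ∀ s ∈ I, HasDerivAt V (W s • quat (γ s)) s := by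
    intro s hs
    have h1 := (h.lagrangian hs).2.1
    rw [inner_smul_right, inner_zero_left] at h1
    -- With `B = 0` the Lagrangian condition reads `⟨V', cγ⟩ = 0`, which leaves only the direction
    -- `quat γ`.
    have h2 : inner ℂ (γ s) (deriv V s) = (0 : ℂ) := by
      rw [← inner_conj_symm, (mul_eq_zero.1 h1).resolve_left hc', map_zero]
    have := hasDerivAt_of_smooth hO h.smoothV hs
    rwa [eq_quat_frame (hunit s hs) (deriv V s), h2, zero_smul, zero_add] at this
  have eqs := fun s hs z hz =>
    typeII_scalar_eqs hc hO hμ hW hunit hγ' hV' h (s := s) hs (z := z) hz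
  have dich := fun s hs => circle_dichotomy hlam hc (fun z hz => (eqs s hs z hz).1)
    (fun z hz => (eqs s hs z hz).2.1)
  have hVq : ∀ s ∈ I, V s = (inner ℂ (quat (γ s)) (V s) : ℂ) • quat (γ s) := by
    intro s hs
    conv_lhs => rw [eq_quat_frame (hunit s hs) (V s), (dich s hs).1, zero_smul, zero_add]
  -- The number `λc²` does not depend on `s`, so the alternative found at one point holds on all of
  -- `I`.
  rcases (dich s₀ hs₀).2 with ⟨hl, -⟩ | ⟨hl, -⟩
  · left
    have hμ0 : ∀ s ∈ I, μ s = 0 := fun s hs => by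
      rcases (dich s hs).2 with h1 | h1
      · exact h1.2
      · exact absurd (hl.symm.trans h1.1) (by norm_num)
    obtain ⟨γ₀, hγ₀⟩ := eq_const_of_hasDerivAt_zero hI (f := γ) (fun s hs => by
      have := hγ' s hs
      rwa [hμ0 s hs, zero_smul] at this)
    refine ⟨⟨γ₀, hγ₀⟩, hl, ?_⟩
    have hu0 : inner ℂ γ₀ γ₀ = (1 : ℂ) := by rw [← hγ₀ s₀ hs₀]; exact hunit s₀ hs₀
    obtain ⟨U, hU1, hU2⟩ := exists_unitary hu0 (by rw [inner_quat_quat, hu0])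
      (inner_quat_self γ₀) (g₁ := !₂[1, 0]) (g₂ := !₂[0, 1]) (by rw [inner_eq_coords]; simp)
      (by rw [inner_eq_coords]; simp) (by rw [inner_eq_coords]; simp)
    set Γ : ℝ → ℂ := fun s => inner ℂ (quat γ₀) (V s) with hΓ
    have hΓ' : ∀ s ∈ I, HasDerivAt Γ (W s) s := by
      intro s hs
      refine ((hasDerivAt_const s (quat γ₀)).inner ℂ (hV' s hs)).congr_deriv ?_
      rw [inner_zero_left, hγ₀ s hs, inner_smul_right, inner_quat_quat, hu0]; simp
    have hW0 : ∀ s ∈ I, W s ≠ 0 := fun s hs => by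
      simpa [hμ0 s hs] using (eqs s hs 1 (by simp)).1
    refine ⟨U, Γ, isSelfSimilarCurveOn_of_eq
      ⟨smooth_of_hasDerivAt hO hW hΓ', fun s hs => by rw [(hΓ' s hs).deriv]; exact hW0 s hs⟩ ?_, ?_⟩
    · intro s hs
      have h3 := (eqs s hs 1 (by simp)).2.2
      have hμ' : deriv μ s = 0 := by
        exact (HasDerivAt.of_eqOn hO hs hμ0 (hasDerivAt_const s (0 : ℂ))).deriv
      have hΓ2 : deriv (deriv Γ) s = deriv W s := by
        exact (HasDerivAt.of_eqOn hO hs (fun s hs => (hΓ' s hs).deriv)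
          (hasDerivAt_of_smooth hO hW hs)).deriv
      rw [hμ0 s hs, hμ', hγ₀ s hs] at h3
      rw [hΓ2, (hΓ' s hs).deriv]
      simpa using h3
    · intro s hs t
      have hVs := hVq s hs
      rw [hγ₀ s hs] at hVs
      simp only [typeII, circleProduct]
      rw [hγ₀ s hs, hVs, map_add, map_smul, map_smul, hU1, hU2]
      ext i; fin_cases i <;> simp [hΓ]
  · right
    have hW0 : ∀ s ∈ I, W s = 0 := fun s hs => by
      rcases (dich s hs).2 with h1 | h1
      · exact absurd (hl.symm.trans h1.1) (by norm_num)
      · exact h1.2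
    have hμ0 : ∀ s ∈ I, μ s ≠ 0 := fun s hs h0 => by
      simpa [h0, hW0 s hs] using (eqs s hs 1 (by simp)).1
    have hV0 : ∀ s ∈ I, V s = 0 := by
      intro s hs
      -- With `W = 0`, differentiating `⟨γ, V⟩ = 0` gives `conj μ ⟨quat γ, V⟩ = 0`, which kills the
      -- remaining component of `V`.
      have h1 : HasDerivAt (fun s => (inner ℂ (γ s) (V s) : ℂ)) _ s := (hγ' s hs).inner ℂ (hV' s hs)
      have h2 := HasDerivAt.eq_of_eqOn hO hs (f := fun _ => (0 : ℂ)) (fun s hs => (dich s hs).1)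
        (hasDerivAt_const s _) h1
      rw [hW0 s hs, zero_smul, inner_zero_right, zero_add, inner_smul_left] at h2
      rw [hVq s hs, (mul_eq_zero.1 h2).resolve_left (by simpa using hμ0 s hs), zero_smul]
    have hγne : ∀ s ∈ I, deriv γ s ≠ 0 := by
      intro s hs h0
      exact hμ0 s hs (by simp [hμdef, h0])
    refine ⟨hV0, hl, hγne, ?_⟩
    -- The `J Y_s` equation with `V = W = 0` says that `μ' conj μ` is real: `μ` has constant
    -- argument, which makes `γ` a great circle.
    have him : ∀ s ∈ I, (deriv μ s * conj (μ s)).im = 0 := by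
      intro s hs
      have h3 := (eqs s hs 1 (by simp)).2.2
      have hW' : deriv W s = 0 := by
        exact (HasDerivAt.of_eqOn hO hs hW0 (hasDerivAt_const s (0 : ℂ))).deriv
      rw [hW0 s hs, hW', hV0 s hs] at h3
      simp only [inner_zero_right, zero_mul, Complex.zero_im, mul_zero, add_zero, mul_one,
        map_mul, Complex.conj_ofReal] at h3
      rw [show (c : ℂ) * deriv μ s * (c * conj (μ s)) = ((c ^ 2 : ℝ) : ℂ) * (deriv μ s * conj (μ s))
        by push_cast; ring, Complex.im_ofReal_mul] at h3
      exact (mul_eq_zero.1 h3).resolve_left (pow_ne_zero 2 hc)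
    have hsm : ContDiffOn ℝ ∞ (fun s => (inner ℂ (μ s) (deriv μ s)).re / ‖μ s‖ ^ 2) I :=
      (Complex.reCLM.contDiff.comp_contDiffOn (smooth_inner hμ (smooth_deriv hO hμ))).div
        (hμ.norm_sq ℝ) (fun s hs => pow_ne_zero 2 (norm_ne_zero_iff.2 (hμ0 s hs)))
    obtain ⟨κ, H, hH, hκ⟩ := exists_eq_exp_smul hI (b := μ) hsm (fun s hs => by
      refine (hasDerivAt_of_smooth hO hμ hs).congr_deriv ?_
      have h1 : deriv μ s * conj (μ s) = ((inner ℂ (μ s) (deriv μ s)).re : ℂ) := by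
        rw [← Complex.re_add_im (deriv μ s * conj (μ s)), him s hs]; simp
      have h2 : μ s * conj (μ s) = (‖μ s‖ : ℂ) ^ 2 := Complex.mul_conj' _
      have h3 : (‖μ s‖ : ℂ) ≠ 0 := by simpa using hμ0 s hs
      rw [Complex.real_smul]
      push_cast
      rw [← h1, ← h2]
      have h4 : conj (μ s) ≠ 0 := by simpa using hμ0 s hs
      have := hμ0 s hs
      field_simp)
    have hκ0 : κ ≠ 0 := by
      rintro rfl
      exact hμ0 s₀ hs₀ (by rw [hκ s₀ hs₀, smul_zero])
    have hκn : (‖κ‖ : ℂ) ≠ 0 := by simpa using hκ0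
    obtain ⟨x, F₁, F₂, hx, hx', h11, h22, h12, hF⟩ := exists_great_circle hI (γ := γ)
      (ρ := fun s => Real.exp (H s) * ‖κ‖) (e := κ / ‖κ‖) (hH.exp.mul contDiffOn_const)
      (by
        rw [map_div₀, Complex.conj_ofReal, div_mul_div_comm, mul_comm (conj κ), Complex.mul_conj']
        field_simp) hunit (fun s hs => by
        refine (hγ' s hs).congr_deriv ?_
        rw [hκ s hs, Complex.real_smul]
        congr 1
        push_cast
        field_simp)
    have hsq := sqrt_two_inv_sq
    -- Targets chosen so that `cos x F₁ + sin x F₂` becomes `(e^{ix}, e^{-ix}) / √2`.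
    obtain ⟨U, hU1, hU2⟩ := exists_unitary h11 h22 h12
      (g₁ := (Real.sqrt 2 : ℂ)⁻¹ • !₂[1, 1])
      (g₂ := (Real.sqrt 2 : ℂ)⁻¹ • !₂[Complex.I, -Complex.I])
      (by rw [inner_eq_coords]; simp; linear_combination 2 * hsq)
      (by
        rw [inner_eq_coords]; simp
        linear_combination 2 * hsq - 2 * (Real.sqrt 2 : ℂ)⁻¹ ^ 2 * Complex.I_sq)
      (by rw [inner_eq_coords]; simp)
    refine ⟨U, x, ⟨hx, fun s hs => ?_⟩, fun s hs t => ?_⟩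
    · rw [(hx' s hs).deriv]
      have := norm_ne_zero_iff.2 hκ0
      positivity
    · simp only [typeII, cliffordTorus]
      rw [hV0 s hs, add_zero, map_smul, hF s hs, map_add, map_smul, map_smul, hU1, hU2]
      have e1 : Complex.exp (((t + x s : ℝ) : ℂ) * Complex.I) = Complex.exp (t * Complex.I) *
          (Real.cos (x s) + Real.sin (x s) * Complex.I) := by
        rw [Complex.ofReal_cos, Complex.ofReal_sin, ← Complex.exp_mul_I, ← Complex.exp_add]
        push_cast; ring_nf
      have e2 : Complex.exp (((t - x s : ℝ) : ℂ) * Complex.I) = Complex.exp (t * Complex.I) *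
          (Real.cos (x s) - Real.sin (x s) * Complex.I) := by
        have h3 := Complex.exp_mul_I (-(x s : ℂ))
        rw [Complex.cos_neg, Complex.sin_neg, neg_mul (Complex.sin _), ← sub_eq_add_neg] at h3
        rw [Complex.ofReal_cos, Complex.ofReal_sin, ← h3, ← Complex.exp_add]
        push_cast; ring_nf
      rw [e1, e2]
      ext i; fin_cases i <;> simp <;> ring

/-! ### Circles in Lagrangian planes -/

lemma rdot_phase {e : ℂ} (he : ‖e‖ = 1) (x y : C2) : rdot (e • x) (e • y) = rdot x y := by
  rw [rdot, inner_smul_left, inner_smul_right, ← mul_assoc, Complex.conj_mul', he]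
  simp [rdot]

lemma om_phase {e : ℂ} (he : ‖e‖ = 1) (x y : C2) : om (e • x) (e • y) = om x y := by
  rw [om, smul_comm, rdot_phase he, om]

/-- The scalar equations for circles in Lagrangian planes. -/
lemma lagrangian_circle_scalar_eqs {lam r φ₁ ρ₁ ρ₂ b₂ w₁ w₂ w₁' w₂' : ℝ} (hr : r ≠ 0) {e : ℂ}
    (he : ‖e‖ = 1) {X₀ X₁ z : ℂ} (hz : ‖z‖ = 1) {Y S T SS ST TT : C2}
    (hj : JetSol lam Y S T SS ST TT)
    (hY : Y = e • !₂[r * z.re + X₀, r * z.im + X₁])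
    (hS : S = e • !₂[(ρ₁ + Complex.I * (r * φ₁)) * z.re + w₁,
      (ρ₁ + Complex.I * (r * φ₁)) * z.im + w₂])
    (hT : T = e • !₂[(-(r * z.im) : ℂ), (r * z.re : ℂ)])
    (hSS : SS = e • !₂[(ρ₂ + Complex.I * b₂ + (ρ₁ + Complex.I * (r * φ₁)) * (Complex.I * φ₁)) * z.re
        + w₁' + Complex.I * φ₁ * w₁,
      (ρ₂ + Complex.I * b₂ + (ρ₁ + Complex.I * (r * φ₁)) * (Complex.I * φ₁)) * z.im
        + w₂' + Complex.I * φ₁ * w₂])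
    (hST : ST = e • !₂[-((ρ₁ + Complex.I * (r * φ₁)) * z.im), (ρ₁ + Complex.I * (r * φ₁)) * z.re])
    (hTT : TT = e • !₂[(-(r * z.re) : ℂ), (-(r * z.im) : ℂ)])
    {a b w : ℝ} (hb : b = r * φ₁) (ha : a = ρ₁ + (w₁ * z.re + w₂ * z.im))
    (hw : w = w₂ * z.re - w₁ * z.im) :
    0 < a ^ 2 + b ^ 2 ∧
    b * w = lam * r * ((a ^ 2 + b ^ 2) * (X₁.im * z.re - X₀.im * z.im)) ∧
    (X₀.im = 0 → X₁.im = 0 →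
      r ^ 2 * a * b₂ = (r ^ 2 * (ρ₂ + (w₁' * z.re + w₂' * z.im)) + 2 * r * w ^ 2
        - 2 * r * (a ^ 2 + b ^ 2 + w ^ 2)
        + lam * r ^ 2 * (a ^ 2 + b ^ 2) * (r + (X₀.re * z.re + X₁.re * z.im))) * b) := by
  have hz' := re_sq_add_im_sq hz
  have hp := gram_pos hj.indep
  have e1 := hj.eqT
  have e2 := hj.eqS
  simp only [ScalarEq] at e1 e2
  have rSS : rdot S S = a ^ 2 + b ^ 2 + w ^ 2 := by
    rw [hS, rdot_phase he, rdot_eq_coords, ha, hb, hw]; simp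
    linear_combination (ρ₁ ^ 2 + (r * φ₁) ^ 2 - w₁ ^ 2 - w₂ ^ 2) * hz'
  have rTT : rdot T T = r ^ 2 := by
    rw [hT, rdot_phase he, rdot_eq_coords]; simp
    linear_combination r ^ 2 * hz'
  have rST : rdot S T = r * w := by
    rw [hS, hT, rdot_phase he, rdot_eq_coords, hw]; simp; ring
  have hr2 : r ^ 2 ≠ 0 := pow_ne_zero 2 hr
  -- After removing the phase, `a` is the radial, `w` the tangential and `b` the `J`-radial
  -- component of `S`; only `a` and `b` are transverse to `T`.
  have hdet : rdot S S * rdot T T - rdot S T ^ 2 = r ^ 2 * (a ^ 2 + b ^ 2) := by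
    rw [rSS, rTT, rST]; ring
  rw [hdet] at hp e1 e2
  rw [rSS, rTT, rST] at e1 e2
  refine ⟨(pos_iff_pos_of_mul_pos hp).1 (by positivity), mul_left_cancel₀ hr2 ?_, fun h0 h1 => ?_⟩
  · have o1 : om SS T = b * w := by
      rw [hSS, hT, om_phase he, om_eq_coords, hb, hw]; simp; ring
    have o2 : om ST T = r * b := by
      rw [hST, hT, om_phase he, om_eq_coords, hb]; simp
      linear_combination (r * (r * φ₁)) * hz'
    have o3 : om TT T = 0 := by
      rw [hTT, hT, om_phase he, om_eq_coords]; simp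
    have o4 : om Y T = r * (X₁.im * z.re - X₀.im * z.im) := by
      rw [hY, hT, om_phase he, om_eq_coords]; simp; ring
    rw [o1, o2, o3, o4] at e1
    linear_combination -e1
  · have o1 : om SS S = φ₁ * (a ^ 2 + b ^ 2 + w ^ 2) + b₂ * a
        - (ρ₂ + (w₁' * z.re + w₂' * z.im)) * b := by
      rw [hSS, hS, om_phase he, om_eq_coords, hb, ha, hw]; simp
      linear_combination (b₂ * ρ₁ - ρ₂ * (r * φ₁) + φ₁ * (ρ₁ ^ 2 + (r * φ₁) ^ 2)
        - φ₁ * (w₁ ^ 2 + w₂ ^ 2)) * hz'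
    have o2 : om ST S = b * w := by
      rw [hST, hS, om_phase he, om_eq_coords, hb, hw]; simp; ring
    have o3 : om TT S = r * b := by
      rw [hTT, hS, om_phase he, om_eq_coords, hb]; simp
      linear_combination (r * (r * φ₁)) * hz'
    have o4 : om Y S = -(r + (X₀.re * z.re + X₁.re * z.im)) * b := by
      rw [hY, hS, om_phase he, om_eq_coords, hb]; simp [h0, h1]
      linear_combination (-(r * (r * φ₁))) * hz'
    rw [o1, o2, o3, o4] at e2
    linear_combination e2 + r * (a ^ 2 + b ^ 2 + w ^ 2) * hb

/-- The left side of `heq` has degree one in `z`, while the right side has cubic coefficient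
proportional to `ζ² x`, where `ζ` encodes `w₁, w₂` and `x` encodes `q₁, q₂`. If `ζ = 0` the left
side vanishes and positivity kills the `qᵢ`; if `x = 0` the right side vanishes and `b wᵢ = 0`. -/
lemma lagrangian_circle_dichotomy {lam r ρ b w₁ w₂ q₁ q₂ : ℝ} (hlam : lam ≠ 0) (hr : r ≠ 0)
    (hpos : ∀ z : ℂ, ‖z‖ = 1 → 0 < (ρ + (w₁ * z.re + w₂ * z.im)) ^ 2 + b ^ 2)
    (heq : ∀ z : ℂ, ‖z‖ = 1 → b * (w₂ * z.re - w₁ * z.im) =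
      lam * r * (((ρ + (w₁ * z.re + w₂ * z.im)) ^ 2 + b ^ 2) * (q₂ * z.re - q₁ * z.im))) :
    q₁ = 0 ∧ q₂ = 0 ∧ b * w₁ = 0 ∧ b * w₂ = 0 := by
  set ζ : ℂ := w₁ - Complex.I * w₂ with hζ
  set x : ℂ := Complex.I * (q₁ - Complex.I * q₂) with hx
  have hlr : lam * r ≠ 0 := mul_ne_zero hlam hr
  obtain ⟨-, -, -, h3⟩ := trig_coeffs_eq_zero
    (c₀ := -(lam * r) * (0 * (ρ ^ 2 + b ^ 2 + Complex.normSq ζ / 2) + (ρ * ζ * conj x).re))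
    (c₁ := b * (Complex.I * ζ) - (lam * r) * (((ρ ^ 2 + b ^ 2 + Complex.normSq ζ / 2 : ℝ) : ℂ) * x
      + 2 * (0 : ℝ) * (ρ * ζ) + ζ ^ 2 / 4 * conj x))
    (c₂ := -(lam * r) * (2 * (0 : ℝ) * (ζ ^ 2 / 4) + ρ * ζ * x))
    (c₃ := -(lam * r) * (ζ ^ 2 / 4 * x)) (by
      intro z hz
      have hz' := re_sq_add_im_sq hz
      have h := heq z hz
      have e1 : (ρ + (w₁ * z.re + w₂ * z.im)) ^ 2 + b ^ 2 = (ρ ^ 2 + b ^ 2 + Complex.normSq ζ / 2)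
          + (2 * (ρ * ζ) * z + 2 * (ζ ^ 2 / 4) * z ^ 2).re := by
        rw [show 2 * (ζ ^ 2 / 4) = ((1 / 2 : ℝ) : ℂ) * ζ ^ 2 by push_cast; ring, mul_assoc _ (ζ ^ 2)]
        simp only [hζ, Complex.normSq_apply, pow_two, Complex.add_re, Complex.re_ofReal_mul]
        simp
        linear_combination ((w₁ ^ 2 + w₂ ^ 2) / 2) * hz'
      have e2 : q₂ * z.re - q₁ * z.im = 0 + (x * z).re := by
        simp [hx]
      have e3 : w₂ * z.re - w₁ * z.im = (Complex.I * ζ * z).re := by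
        simp [hζ]
      rw [e1, e2, trig_mul_trig hz, e3] at h
      refine Eq.trans ?_ (sub_eq_zero.2 h)
      generalize z ^ 2 = z₂, z ^ 3 = z₃, ζ ^ 2 / 4 = y,
        ρ ^ 2 + b ^ 2 + Complex.normSq ζ / 2 = f₀
      clear_value ζ x
      simp only [Complex.add_re, Complex.add_im, Complex.sub_re, Complex.sub_im, Complex.neg_re,
        Complex.neg_im, Complex.mul_re, Complex.mul_im,
        Complex.ofReal_re, Complex.ofReal_im, Complex.re_ofNat, Complex.im_ofNat]
      ring)
  have h3' : ζ ^ 2 / 4 * x = 0 :=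
    (mul_eq_zero.1 h3).resolve_left (by exact_mod_cast neg_ne_zero.2 hlr)
  have e1 := heq 1 (by simp)
  have e2 := heq Complex.I (by simp)
  have p1 := hpos 1 (by simp)
  have p2 := hpos Complex.I (by simp)
  simp at e1 e2 p1 p2
  rcases mul_eq_zero.1 h3' with h | h
  · have hζ0 : ζ = 0 := by simpa using h
    have hw1 : w₁ = 0 := by simpa [hζ] using congrArg Complex.re hζ0
    have hw2 : w₂ = 0 := by simpa [hζ] using congrArg Complex.im hζ0
    subst hw1 hw2
    simp [hlam, hr] at e1 e2
    simp at p1 p2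
    exact ⟨e2.resolve_left p1.ne', e1.resolve_left p1.ne', by simp, by simp⟩
  · have hq1 : q₁ = 0 := by simpa [hx] using congrArg Complex.im h
    have hq2 : q₂ = 0 := by simpa [hx] using congrArg Complex.re h
    subst hq1 hq2
    refine ⟨rfl, rfl, ?_, ?_⟩
    · simpa using e2
    · simpa using e1

/-- Dictionary between the coefficient form and the real form of a circle in a Lagrangian plane. -/
lemma cyc_lagrangian (z α : ℂ) (V : C2) :
    cyc z ((α / 2) • !₂[1, -Complex.I]) ((α / 2) • !₂[1, Complex.I]) V
      = α • !₂[(z.re : ℂ), (z.im : ℂ)] + V := by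
  have h1 : z + conj z = 2 * z.re := by rw [Complex.add_conj]; push_cast; ring
  have h2 : z - conj z = 2 * z.im * Complex.I := by rw [Complex.sub_conj]; push_cast; ring
  ext i
  fin_cases i
  · simp [cyc_apply]; linear_combination α / 2 * h1
  · simp [cyc_apply]; linear_combination -α / 2 * Complex.I * h2 - α * z.im * Complex.I_sq

lemma cyc_lagrangian_I (z α : ℂ) :
    cyc z (Complex.I • (α / 2) • !₂[1, -Complex.I]) (-(Complex.I • (α / 2) • !₂[1, Complex.I])) 0
      = α • !₂[-(z.im : ℂ), (z.re : ℂ)] := by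
  have h1 : z + conj z = 2 * z.re := by rw [Complex.add_conj]; push_cast; ring
  have h2 : z - conj z = 2 * z.im * Complex.I := by rw [Complex.sub_conj]; push_cast; ring
  ext i
  fin_cases i
  · simp [cyc_apply]; linear_combination α / 2 * Complex.I * h2 + α * z.im * Complex.I_sq
  · simp [cyc_apply]
    linear_combination α / 2 * h1 - α / 2 * (z + conj z) * Complex.I_sq

lemma cyc_lagrangian_neg (z α : ℂ) :
    cyc z (-((α / 2) • !₂[1, -Complex.I])) (-((α / 2) • !₂[1, Complex.I])) 0
      = α • !₂[-(z.re : ℂ), -(z.im : ℂ)] := by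
  have h : cyc z (-((α / 2) • !₂[1, -Complex.I])) (-((α / 2) • !₂[1, Complex.I])) 0
      = -cyc z ((α / 2) • !₂[1, -Complex.I]) ((α / 2) • !₂[1, Complex.I]) 0 := by
    simp only [cyc]; module
  rw [h, cyc_lagrangian]
  ext i; fin_cases i <;> simp

lemma hasDerivAt_phase {φ : ℝ → ℝ} {φ' s : ℝ} (h : HasDerivAt φ φ' s) :
    HasDerivAt (fun s => Complex.exp (φ s * Complex.I))
      (Complex.exp (φ s * Complex.I) * (Complex.I * φ')) s := by
  refine (h.ofReal_comp.mul_const Complex.I).cexp.congr_deriv ?_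
  ring

lemma hasDerivAt_mk {f g : ℝ → ℂ} {f' g' : ℂ} {s : ℝ} (hf : HasDerivAt f f' s)
    (hg : HasDerivAt g g' s) : HasDerivAt (fun s => (!₂[f s, g s] : C2)) !₂[f', g'] s := by
  have e : ∀ x y : ℂ, (!₂[x, y] : C2) = x • !₂[1, 0] + y • !₂[0, 1] := fun x y => by
    ext i; fin_cases i <;> simp
  rw [e f' g', funext fun s => e (f s) (g s)]
  exact (hf.smul_const _).add (hg.smul_const _)

lemma hasDerivAt_apply {f : ℝ → C2} {f' : C2} {s : ℝ} (hf : HasDerivAt f f' s) (i : Fin 2) :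
    HasDerivAt (fun s => f s i) (f' i) s :=
  ((EuclideanSpace.proj i : C2 →L[ℂ] ℂ).restrictScalars ℝ).hasFDerivAt.comp_hasDerivAt s hf

lemma smooth_apply {I : Set ℝ} {f : ℝ → C2} (hf : ContDiffOn ℝ ∞ f I) (i : Fin 2) :
    ContDiffOn ℝ ∞ (fun s => f s i) I :=
  ((EuclideanSpace.proj i : C2 →L[ℂ] ℂ).restrictScalars ℝ).contDiff.comp_contDiffOn hf

lemma smooth_phase {I : Set ℝ} {φ : ℝ → ℝ} (hφ : ContDiffOn ℝ ∞ φ I) :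
    ContDiffOn ℝ ∞ (fun s => Complex.exp (φ s * Complex.I)) I :=
  ((Complex.ofRealCLM.contDiff.comp_contDiffOn hφ).mul contDiffOn_const).cexp

/-! ### The surfaces `r e^{iφ} (cos t, sin t) + V` -/

section TypeI

variable {lam : ℝ} {I : Set ℝ} {r φ w₁ w₂ : ℝ → ℝ} {V : ℝ → C2}

lemma hasDerivAt_polarCurve {r' φ' s : ℝ} (hr : HasDerivAt r r' s) (hφ : HasDerivAt φ φ' s) :
    HasDerivAt (polarCurve r φ)
      (Complex.exp (φ s * Complex.I) * (r' + Complex.I * (r s * φ'))) s := by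
  refine (hr.ofReal_comp.mul (hasDerivAt_phase hφ)).congr_deriv ?_
  ring

/-- The derivative of `r φ'` is left unexpanded because `b = r φ'` is later the unknown of a linear
equation. -/
lemma hasDerivAt_deriv_polarCurve (hI : IsOpen I) (hr : ContDiffOn ℝ ∞ r I)
    (hφ : ContDiffOn ℝ ∞ φ I) {s : ℝ} (hs : s ∈ I) :
    HasDerivAt (fun s => Complex.exp (φ s * Complex.I) *
        (deriv r s + Complex.I * (r s * deriv φ s)))
      (Complex.exp (φ s * Complex.I) * (deriv (deriv r) s
        + Complex.I * deriv (fun s => r s * deriv φ s) s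
        + (deriv r s + Complex.I * (r s * deriv φ s)) * (Complex.I * deriv φ s))) s := by
  have hb := hasDerivAt_of_smooth hI (hr.mul (smooth_deriv hI hφ)) hs
  have h1 := (hasDerivAt_phase (hasDerivAt_of_smooth hI hφ hs)).mul
    ((hasDerivAt_of_smooth hI (smooth_deriv hI hr) hs).ofReal_comp.add
      (hb.ofReal_comp.const_mul Complex.I))
  have e : (fun s => Complex.exp (φ s * Complex.I) *
        (deriv r s + Complex.I * (r s * deriv φ s)))
      = (fun s => Complex.exp (φ s * Complex.I)) * ((fun s => ((deriv r s : ℝ) : ℂ)) + fun s =>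
        Complex.I * ((r * deriv φ) s : ℝ)) := by
    funext s; simp
  rw [e]
  refine h1.congr_deriv ?_
  simp only [Pi.add_apply]
  push_cast
  ring

lemma typeI_scalar_eqs (hI : IsOpen I) (hr : ContDiffOn ℝ ∞ r I) (hφ : ContDiffOn ℝ ∞ φ I)
    (hpos : ∀ s ∈ I, 0 < r s) (hw₁ : ContDiffOn ℝ ∞ w₁ I) (hw₂ : ContDiffOn ℝ ∞ w₂ I)
    (hV' : ∀ s ∈ I, HasDerivAt V (Complex.exp (φ s * Complex.I) • !₂[(w₁ s : ℂ), (w₂ s : ℂ)]) s)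
    (h : IsSol lam (fun s => (polarCurve r φ s / 2) • !₂[1, -Complex.I])
      (fun s => (polarCurve r φ s / 2) • !₂[1, Complex.I]) V I)
    {X : C2} {s : ℝ} (hs : s ∈ I) (hX : V s = Complex.exp (φ s * Complex.I) • X)
    {z : ℂ} (hz : ‖z‖ = 1) {a b w : ℝ} (hb : b = r s * deriv φ s)
    (ha : a = deriv r s + (w₁ s * z.re + w₂ s * z.im)) (hw : w = w₂ s * z.re - w₁ s * z.im) :
    0 < a ^ 2 + b ^ 2 ∧
    b * w = lam * r s * ((a ^ 2 + b ^ 2) * ((X 1).im * z.re - (X 0).im * z.im)) ∧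
    ((X 0).im = 0 → (X 1).im = 0 →
      r s ^ 2 * a * deriv (fun s => r s * deriv φ s) s
        = (r s ^ 2 * (deriv (deriv r) s + (deriv w₁ s * z.re + deriv w₂ s * z.im))
        + 2 * r s * w ^ 2 - 2 * r s * (a ^ 2 + b ^ 2 + w ^ 2)
        + lam * r s ^ 2 * (a ^ 2 + b ^ 2) * (r s + ((X 0).re * z.re + (X 1).re * z.im))) * b) := by
  have d := fun {f : ℝ → ℝ} (hf : ContDiffOn ℝ ∞ f I) s (hs : s ∈ I) => hasDerivAt_of_smooth hI hf hs
  have g1 : ∀ s ∈ I, HasDerivAt (polarCurve r φ) _ s := fun s hs =>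
    hasDerivAt_polarCurve (d hr s hs) (d hφ s hs)
  have g2 := fun s hs => hasDerivAt_deriv_polarCurve (s := s) hI hr hφ hs
  have hj := h.jet_of_hasDerivAt hI
    (fun s hs => ((g1 s hs).div_const 2).smul_const !₂[1, -Complex.I])
    (fun s hs => ((g2 s hs).div_const 2).smul_const !₂[1, -Complex.I])
    (fun s hs => ((g1 s hs).div_const 2).smul_const !₂[1, Complex.I])
    (fun s hs => ((g2 s hs).div_const 2).smul_const !₂[1, Complex.I])
    hV' (fun s hs => (hasDerivAt_phase (d hφ s hs)).smul
      (hasDerivAt_mk (d hw₁ s hs).ofReal_comp (d hw₂ s hs).ofReal_comp)) hs hz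
  rw [cyc_lagrangian, cyc_lagrangian, cyc_lagrangian, cyc_lagrangian_I, cyc_lagrangian_I,
    cyc_lagrangian_neg] at hj
  refine lagrangian_circle_scalar_eqs (hpos s hs).ne' (Complex.norm_exp_ofReal_mul_I (φ s)) hz hj
    ?_ ?_ ?_ ?_ ?_ ?_ hb ha hw
  · rw [hX]; ext i; fin_cases i <;> simp [polarCurve] <;> ring
  · ext i; fin_cases i <;> simp <;> ring
  · ext i; fin_cases i <;> simp [polarCurve] <;> ring
  · ext i; fin_cases i <;> simp <;> ring
  · ext i; fin_cases i <;> simp <;> ring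
  · ext i; fin_cases i <;> simp [polarCurve] <;> ring

lemma isOpenInterval_ball (s : ℝ) {ε : ℝ} (hε : 0 < ε) : IsOpenInterval (Metric.ball s ε) :=
  ⟨⟨s, Metric.mem_ball_self hε⟩, Metric.isOpen_ball, by
    rw [Real.ball_eq_Ioo]; exact Set.ordConnected_Ioo⟩

/-- A smooth function `b` with `f b' = g b` and `f ≠ 0` wherever `b = 0` vanishes identically or
nowhere. -/
lemma zero_or_ne_zero_of_linear_ode (hI : IsOpenInterval I) {b f g : ℝ → ℝ}
    (hb : ContDiffOn ℝ ∞ b I) (hf : ContDiffOn ℝ ∞ f I) (hg : ContDiffOn ℝ ∞ g I)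
    (hfb : ∀ s ∈ I, b s = 0 → f s ≠ 0) (h : ∀ s ∈ I, f s * deriv b s = g s * b s) :
    (∀ s ∈ I, b s = 0) ∨ (∀ s ∈ I, b s ≠ 0) := by
  have hO := hI.2.1
  have hopen : IsOpen {s | s ∈ I ∧ b s = 0} := by
    rw [isOpen_iff_mem_nhds]
    rintro s ⟨hs, hbs⟩
    have hne : ∀ᶠ u in nhds s, u ∈ I ∧ f u ≠ 0 := (hO.eventually_mem hs).and
      ((hf.continuousOn.continuousAt (hO.mem_nhds hs)).eventually_ne (hfb s hs hbs))
    obtain ⟨ε, hε, hball⟩ := Metric.eventually_nhds_iff_ball.1 hne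
    have hsub : Metric.ball s ε ⊆ I := fun u hu => (hball u hu).1
    -- Near a zero of `b` the factor `f` is invertible, so `b' = (g / f) b` and the zero propagates:
    -- the zero set is open, as is its complement.
    obtain ⟨κ, H, -, hκ⟩ := exists_eq_exp_smul (isOpenInterval_ball s hε) (b := b)
      (h := fun u => g u / f u) ((hg.mono hsub).div (hf.mono hsub) fun u hu => (hball u hu).2)
      (fun u hu => by
        refine (hasDerivAt_of_smooth hO hb (hsub hu)).congr_deriv ?_
        have := (hball u hu).2
        rw [smul_eq_mul]
        field_simp
        linear_combination h u (hsub hu))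
    have hκ0 : κ = 0 := by
      have := hκ s (Metric.mem_ball_self hε)
      rw [hbs] at this
      simpa using this.symm
    refine Filter.mem_of_superset (Metric.ball_mem_nhds s hε) fun u hu => ⟨hsub hu, ?_⟩
    rw [hκ u hu, hκ0, smul_zero]
  have hopen' : IsOpen {s | s ∈ I ∧ b s ≠ 0} := by
    rw [isOpen_iff_mem_nhds]
    rintro s ⟨hs, hbs⟩
    exact (hO.eventually_mem hs).and
      ((hb.continuousOn.continuousAt (hO.mem_nhds hs)).eventually_ne hbs)
  rcases hI.isPreconnected.subset_or_subset hopen hopen'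
    (Set.disjoint_left.2 fun s h1 h2 => h2.2 h1.2)
    (fun s hs => (em (b s = 0)).imp (⟨hs, ·⟩) (⟨hs, ·⟩)) with h1 | h1
  · exact .inl fun s hs => (h1 hs).2
  · exact .inr fun s hs => (h1 hs).2

/-- Self-similar surfaces foliated by circles in Lagrangian planes. -/
theorem typeI_classification (hlam : lam ≠ 0) (hI : IsOpenInterval I)
    (hr : ContDiffOn ℝ ∞ r I) (hφ : ContDiffOn ℝ ∞ φ I) (hpos : ∀ s ∈ I, 0 < r s)
    (h : IsSol lam (fun s => (polarCurve r φ s / 2) • !₂[1, -Complex.I])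
      (fun s => (polarCurve r φ s / 2) • !₂[1, Complex.I]) V I) :
    ((∀ s ∈ I, V s = 0) ∧ IsEquivariantProfileOn lam (polarCurve r φ) I) ∨
      (∃ φ₀ : ℝ, ∀ s ∈ I, φ s = φ₀ ∧
        ∃ x y : ℝ, V s = Complex.exp (φ₀ * Complex.I) • !₂[(x : ℂ), (y : ℂ)]) := by
  have hO := hI.2.1
  have d := fun {f : ℝ → ℝ} (hf : ContDiffOn ℝ ∞ f I) s (hs : s ∈ I) => hasDerivAt_of_smooth hO hf hs
  have hnegφ : ∀ s, Complex.exp (((-φ s : ℝ) : ℂ) * Complex.I)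
      * Complex.exp (φ s * Complex.I) = 1 := by
    intro s; rw [← Complex.exp_add]; simp
  -- The velocity of the center seen in the rotating frame; the Lagrangian condition makes it real.
  set P : ℝ → C2 := fun s => Complex.exp (((-φ s : ℝ) : ℂ) * Complex.I) • deriv V s with hP
  have hVP : ∀ s, deriv V s = Complex.exp (φ s * Complex.I) • P s := by
    intro s; rw [hP, smul_smul, mul_comm, hnegφ, one_smul]
  have hPsm : ContDiffOn ℝ ∞ P I := (smooth_phase hφ.neg).smul (smooth_deriv hO h.smoothV)
  have hPreal : ∀ s ∈ I, (P s 0).im = 0 ∧ (P s 1).im = 0 := by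
    intro s hs
    have h1 := (h.lagrangian hs).2.1
    have he : conj (Complex.exp (φ s * Complex.I)) * Complex.exp (φ s * Complex.I) = 1 := by
      rw [Complex.conj_mul', Complex.norm_exp_ofReal_mul_I]; simp
    rw [hVP] at h1
    simp only [inner_smul_left, inner_smul_right, polarCurve, map_div₀, map_mul, map_ofNat,
      Complex.conj_ofReal, inner_eq_coords] at h1
    have hr0 : (r s : ℂ) ≠ 0 := by exact_mod_cast (hpos s hs).ne'
    have h2 : (r s : ℂ) / 2 * (conj (P s 0) - Complex.I * conj (P s 1))
        = (r s : ℂ) / 2 * (P s 0 - Complex.I * P s 1) := by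
      simp at h1
      linear_combination h1 - (r s : ℂ) / 2 * (conj (P s 0) - Complex.I * conj (P s 1)
        - (P s 0 - Complex.I * P s 1)) * he
    have h3 := mul_left_cancel₀ (div_ne_zero hr0 two_ne_zero) h2
    have h4 := congrArg Complex.re h3
    have h5 := congrArg Complex.im h3
    simp at h4 h5
    exact ⟨by linarith, by linarith⟩
  set w₁ : ℝ → ℝ := fun s => (P s 0).re with hw₁
  set w₂ : ℝ → ℝ := fun s => (P s 1).re with hw₂
  have sw₁ : ContDiffOn ℝ ∞ w₁ I := Complex.reCLM.contDiff.comp_contDiffOn (smooth_apply hPsm 0)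
  have sw₂ : ContDiffOn ℝ ∞ w₂ I := Complex.reCLM.contDiff.comp_contDiffOn (smooth_apply hPsm 1)
  have hPw : ∀ s ∈ I, P s = !₂[(w₁ s : ℂ), (w₂ s : ℂ)] := by
    intro s hs
    obtain ⟨h0, h1⟩ := hPreal s hs
    ext i; fin_cases i
    · apply Complex.ext <;> simp [hw₁, h0]
    · apply Complex.ext <;> simp [hw₂, h1]
  have hV' : ∀ s ∈ I,
      HasDerivAt V (Complex.exp (φ s * Complex.I) • !₂[(w₁ s : ℂ), (w₂ s : ℂ)]) s := by
    intro s hs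
    have := hasDerivAt_of_smooth hO h.smoothV hs
    rwa [hVP, hPw s hs] at this
  set X : ℝ → C2 := fun s => Complex.exp (((-φ s : ℝ) : ℂ) * Complex.I) • V s with hX
  have hVX : ∀ s, V s = Complex.exp (φ s * Complex.I) • X s := by
    intro s; rw [hX, smul_smul, mul_comm, hnegφ, one_smul]
  have hX' : ∀ s ∈ I, HasDerivAt X (P s - (Complex.I * deriv φ s) • X s) s := by
    intro s hs
    refine ((hasDerivAt_phase (d hφ s hs).neg).smul
      (hasDerivAt_of_smooth hO h.smoothV hs)).congr_deriv ?_
    simp only [hP, hX, Pi.neg_apply, smul_smul, sub_eq_add_neg, ← neg_smul]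
    congr 2
    push_cast; ring
  have hXsm : ContDiffOn ℝ ∞ X I := (smooth_phase hφ.neg).smul h.smoothV
  set b : ℝ → ℝ := fun s => r s * deriv φ s with hb
  have hbsm : ContDiffOn ℝ ∞ b I := hr.mul (smooth_deriv hO hφ)
  have eqs := fun s hs z hz => typeI_scalar_eqs hO hr hφ hpos sw₁ sw₂ hV' h (X := X s) (s := s) hs
    (hVX s) (z := z) hz rfl rfl rfl
  have dich := fun s hs => lagrangian_circle_dichotomy hlam (hpos s hs).ne'
    (fun z hz => (eqs s hs z hz).1) (fun z hz => (eqs s hs z hz).2.1)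
  -- Since `X' = P - iφ' X` with `P` and `X` real, the imaginary part of the derivative leaves `φ' X
  -- = 0`.
  have hreal : ∀ s ∈ I, deriv φ s * (X s 0).re = 0 ∧ deriv φ s * (X s 1).re = 0 := by
    have key : ∀ i : Fin 2, (∀ s ∈ I, (X s i).im = 0) → (∀ s ∈ I, (P s i).im = 0) →
        ∀ s ∈ I, deriv φ s * (X s i).re = 0 := by
      intro i h1 h2 s hs
      have h3 := Complex.imCLM.hasFDerivAt.comp_hasDerivAt s (hasDerivAt_apply (hX' s hs) i)
      have h4 := HasDerivAt.eq_of_eqOn hO hs (f := fun _ => (0 : ℝ)) h1 (hasDerivAt_const s _) h3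
      simpa [h2 s hs] using h4
    exact fun s hs => ⟨key 0 (fun s hs => (dich s hs).1) (fun s hs => (hPreal s hs).1) s hs,
      key 1 (fun s hs => (dich s hs).2.1) (fun s hs => (hPreal s hs).2) s hs⟩
  -- The `J Y_s` equation is needed only at `z = 1`, where it is linear in `b` once its other terms
  -- are read as given functions.
  have hode := fun s hs => (eqs s hs 1 (by simp)).2.2 (dich s hs).1 (dich s hs).2.1
  simp only [Complex.one_re, Complex.one_im, mul_one, mul_zero, add_zero, sub_zero] at hode
  have sX₀ : ContDiffOn ℝ ∞ (fun s => (X s 0).re) I :=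
    Complex.reCLM.contDiff.comp_contDiffOn (smooth_apply hXsm 0)
  have sr₁ := smooth_deriv hO hr
  have sr₂ := smooth_deriv hO sr₁
  have sw₁' := smooth_deriv hO sw₁
  have hzero := zero_or_ne_zero_of_linear_ode hI hbsm
    (f := fun s => r s ^ 2 * (deriv r s + w₁ s))
    (g := fun s => r s ^ 2 * (deriv (deriv r) s + deriv w₁ s) + 2 * r s * w₂ s ^ 2
      - 2 * r s * ((deriv r s + w₁ s) ^ 2 + b s ^ 2 + w₂ s ^ 2)
      + lam * r s ^ 2 * ((deriv r s + w₁ s) ^ 2 + b s ^ 2) * (r s + (X s 0).re))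
    (by fun_prop) (by fun_prop)
    -- At a zero of `b`, immersivity gives `a² > 0`, so the leading coefficient `r² a` is nonzero
    -- there.
    (by
      intro s hs hbs h0
      have h1 := (eqs s hs 1 (by simp)).1
      have h2 : deriv r s + w₁ s = 0 :=
        (mul_eq_zero.1 h0).resolve_left (pow_ne_zero 2 (hpos s hs).ne')
      have h3 : r s * deriv φ s = 0 := hbs
      simp [h2, h3] at h1)
    hode
  rcases hzero with hz | hz
  · right
    have hφ' : ∀ s ∈ I, deriv φ s = 0 := fun s hs =>
      (mul_eq_zero.1 (hz s hs)).resolve_left (hpos s hs).ne'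
    obtain ⟨φ₀, hφ₀⟩ := eq_const_of_hasDerivAt_zero hI (f := φ) (fun s hs => by
      have := d hφ s hs
      rwa [hφ' s hs] at this)
    refine ⟨φ₀, fun s hs => ⟨hφ₀ s hs, (X s 0).re, (X s 1).re, ?_⟩⟩
    rw [hVX s, hφ₀ s hs]
    congr 1
    have h0 := (dich s hs).1
    have h1 := (dich s hs).2.1
    ext i; fin_cases i
    · apply Complex.ext <;> simp [h0]
    · apply Complex.ext <;> simp [h1]
  · left
    have hφ' : ∀ s ∈ I, deriv φ s ≠ 0 := fun s hs h0 => hz s hs (by simp [hb, h0])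
    have hX0 : ∀ s ∈ I, X s = 0 := by
      intro s hs
      have h0 := (dich s hs).1
      have h1 := (dich s hs).2.1
      have h2 := (mul_eq_zero.1 (hreal s hs).1).resolve_left (hφ' s hs)
      have h3 := (mul_eq_zero.1 (hreal s hs).2).resolve_left (hφ' s hs)
      ext i; fin_cases i
      · apply Complex.ext <;> simp [h0, h2]
      · apply Complex.ext <;> simp [h1, h3]
    have hw0 : ∀ s ∈ I, w₁ s = 0 ∧ w₂ s = 0 := fun s hs =>
      ⟨(mul_eq_zero.1 (dich s hs).2.2.1).resolve_left (hz s hs),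
        (mul_eq_zero.1 (dich s hs).2.2.2).resolve_left (hz s hs)⟩
    have hV0 : ∀ s ∈ I, V s = 0 := fun s hs => by rw [hVX s, hX0 s hs, smul_zero]
    have g1 : ∀ s ∈ I, HasDerivAt (polarCurve r φ) _ s := fun s hs =>
      hasDerivAt_polarCurve (d hr s hs) (d hφ s hs)
    have g2 := fun s hs => hasDerivAt_deriv_polarCurve (s := s) hO hr hφ hs
    have hγsm : ContDiffOn ℝ ∞ (polarCurve r φ) I :=
      (Complex.ofRealCLM.contDiff.comp_contDiffOn hr).mul (smooth_phase hφ)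
    have hβ : ∀ s ∈ I, ((deriv r s : ℝ) : ℂ) + Complex.I * (r s * deriv φ s) ≠ 0 := by
      intro s hs h0
      exact hz s hs (by simpa [hb] using congrArg Complex.im h0)
    have hreg : IsRegularCurveOn (polarCurve r φ) I := ⟨hγsm, fun s hs => by
      rw [(g1 s hs).deriv]
      exact mul_ne_zero (Complex.exp_ne_zero _) (hβ s hs)⟩
    refine ⟨hV0, hreg, fun s hs => ⟨?_, ?_⟩⟩
    · exact mul_ne_zero (by exact_mod_cast (hpos s hs).ne') (Complex.exp_ne_zero _)
    · have hn : ‖deriv (polarCurve r φ) s‖ ≠ 0 := norm_ne_zero_iff.2 (hreg.2 s hs)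
      have hnsq : ‖deriv (polarCurve r φ) s‖ ^ 2 = deriv r s ^ 2 + b s ^ 2 := by
        rw [(g1 s hs).deriv, norm_mul, Complex.norm_exp_ofReal_mul_I, one_mul, Complex.sq_norm,
          Complex.normSq_apply]
        simp [hb]; ring
      have hγn : ‖polarCurve r φ s‖ = r s := by
        rw [polarCurve, norm_mul, Complex.norm_exp_ofReal_mul_I, mul_one, Complex.norm_real,
          Real.norm_of_nonneg (hpos s hs).le]
      have hg2 : deriv (deriv (polarCurve r φ)) s = _ :=
        (HasDerivAt.of_eqOn hO hs (fun s hs => (g1 s hs).deriv) (g2 s hs)).deriv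
      have he : Complex.exp (φ s * Complex.I) * conj (Complex.exp (φ s * Complex.I)) = 1 := by
        rw [Complex.mul_conj', Complex.norm_exp_ofReal_mul_I]; simp
      have i1 : (deriv (deriv (polarCurve r φ)) s * conj (deriv (polarCurve r φ) s)).im
          = deriv φ s * (deriv r s ^ 2 + b s ^ 2) + deriv b s * deriv r s
            - deriv (deriv r) s * b s := by
        rw [hg2, (g1 s hs).deriv, map_mul, mul_mul_mul_comm, he, one_mul]
        simp [hb]; ring
      have i2 : (polarCurve r φ s * conj (deriv (polarCurve r φ) s)).im = -(r s * b s) := by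
        rw [(g1 s hs).deriv, polarCurve, map_mul, mul_assoc, ← mul_assoc (Complex.exp _), he, one_mul]
        simp [hb]
      have hw₁' : deriv w₁ s = 0 :=
        (HasDerivAt.of_eqOn hO hs (fun s hs => (hw0 s hs).1) (hasDerivAt_const s (0 : ℝ))).deriv
      have h1 := hode s hs
      rw [hX0 s hs, (hw0 s hs).1, (hw0 s hs).2, hw₁'] at h1
      have h2 : r s ^ 2 * deriv r s * deriv b s = (r s ^ 2 * deriv (deriv r) s
          - 2 * r s * (deriv r s ^ 2 + b s ^ 2)
          + lam * r s ^ 2 * (deriv r s ^ 2 + b s ^ 2) * r s) * b s := by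
        simpa using h1
      have hbs : b s = r s * deriv φ s := rfl
      rw [curvature_eq, cdot_unitNormal, i1, i2, hγn]
      have hr0 := (hpos s hs).ne'
      generalize ‖deriv (polarCurve r φ) s‖ = n at *
      -- The linear equation with `w₁ = w₂ = 0` and `X = 0` is the profile equation cleared of its
      -- denominators.
      have h3 : r s ^ 2 * (deriv φ s * (deriv r s ^ 2 + b s ^ 2) + deriv b s * deriv r s
          - deriv (deriv r) s * b s) = -(r s * b s) * n ^ 2 * (1 - lam * r s ^ 2) := by
        rw [hnsq]
        linear_combination h2 - r s * (deriv r s ^ 2 + b s ^ 2) * hbs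
      generalize deriv φ s * (deriv r s ^ 2 + b s ^ 2) + deriv b s * deriv r s
        - deriv (deriv r) s * b s = k, r s * b s = m at h3 ⊢
      field_simp
      linear_combination h3

end TypeI

/-! ### Local congruence -/

lemma isOpen_strip {I : Set ℝ} (hI : IsOpen I) : IsOpen (strip I) := hI.prod isOpen_univ

/-- The partial derivatives are the values of the differential on the standard basis, so their
independence is injectivity. -/
lemma hasFDerivAt_of_isImmersionOn {Y : ℝ × ℝ → C2} {Ω : Set (ℝ × ℝ)} (hΩ : IsOpen Ω)
    (hY : IsImmersionOn Y Ω) {q : ℝ × ℝ} (hq : q ∈ Ω) :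
    ∃ L : ℝ × ℝ →L[ℝ] C2, HasFDerivAt Y L q ∧ Function.Injective L := by
  have h := ((hY.1.differentiableOn (by simp)).differentiableAt (hΩ.mem_nhds hq)).hasFDerivAt
  refine ⟨_, h, ?_⟩
  have hS : dS Y q = fderiv ℝ Y q (1, 0) := by
    have h1 : HasDerivAt (fun s : ℝ => (s, q.2)) (1, 0) q.1 :=
      (hasDerivAt_id q.1).prodMk (hasDerivAt_const q.1 q.2)
    exact (HasFDerivAt.comp_hasDerivAt (f := fun s : ℝ => (s, q.2)) q.1 h h1).deriv
  have hT : dT Y q = fderiv ℝ Y q (0, 1) := by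
    have h1 : HasDerivAt (fun t : ℝ => (q.1, t)) (0, 1) q.2 :=
      (hasDerivAt_const q.2 q.1).prodMk (hasDerivAt_id q.2)
    exact (HasFDerivAt.comp_hasDerivAt (f := fun t : ℝ => (q.1, t)) q.2 h h1).deriv
  rw [injective_iff_map_eq_zero]
  rintro ⟨a, b⟩ hab
  have e : ((a, b) : ℝ × ℝ) = a • (1, 0) + b • (0, 1) := by simp
  rw [e, map_add, map_smul, map_smul, ← hS, ← hT] at hab
  obtain ⟨h1, h2⟩ := LinearIndependent.pair_iff.1 (hY.2 q hq) a b hab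
  rw [h1, h2]; rfl

/-- If an immersion factors, up to a unitary map, as `Z ∘ g`, then `g` is a local change of
parameters. -/
lemma locallyCongruentAt_of_comp {Y Z : ℝ × ℝ → C2} {g : ℝ × ℝ → ℝ × ℝ} {Ω Ω' N : Set (ℝ × ℝ)}
    {p : ℝ × ℝ} (hΩ : IsOpen Ω) (hΩ' : IsOpen Ω') (hY : IsImmersionOn Y Ω) (hN : IsOpen N)
    (hNΩ : N ⊆ Ω) (hp : p ∈ N) (hZ : DifferentiableOn ℝ Z Ω') (hg : ContDiffOn ℝ ∞ g N)
    (hmaps : ∀ q ∈ N, g q ∈ Ω') (U : C2 ≃ₗᵢ[ℂ] C2) (h : ∀ q ∈ N, U (Y q) = Z (g q)) :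
    LocallyCongruentAt Y Ω p Z Ω' := by
  -- By the chain rule `U ∘ dY = dZ ∘ dg`, so `dg` is injective, hence invertible by dimension. It
  -- is needed on all of `N`, since smoothness of the inverse is checked at every point of the
  -- target.
  have hequiv : ∀ q ∈ N, ∃ f' : (ℝ × ℝ) ≃L[ℝ] (ℝ × ℝ), HasFDerivAt g (f' : ℝ × ℝ →L[ℝ] ℝ × ℝ) q := by
    intro q hq
    obtain ⟨L, hL, hinj⟩ := hasFDerivAt_of_isImmersionOn hΩ hY (hNΩ hq)
    have hgq := ((hg.differentiableOn (by simp)).differentiableAt (hN.mem_nhds hq)).hasFDerivAt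
    have hZq := (hZ.differentiableAt (hΩ'.mem_nhds (hmaps q hq))).hasFDerivAt
    have hUq := ((U.toContinuousLinearEquiv : C2 →L[ℂ] C2).restrictScalars ℝ).hasFDerivAt.comp q hL
    have huniq := (hUq.congr_of_eventuallyEq
      (Filter.eventually_of_mem (hN.mem_nhds hq) fun u hu => (h u hu).symm)).unique
      (hZq.comp q hgq)
    have hgi : Function.Injective (fderiv ℝ g q) := by
      rw [injective_iff_map_eq_zero]
      intro v hv
      have h1 := DFunLike.congr_fun huniq v
      simp only [ContinuousLinearMap.comp_apply, hv, map_zero] at h1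
      have h2 : U (L v) = 0 := h1
      rw [map_eq_zero_iff U U.injective] at h2
      exact (injective_iff_map_eq_zero L).1 hinj v h2
    refine ⟨(LinearEquiv.ofInjectiveEndo (fderiv ℝ g q : ℝ × ℝ →ₗ[ℝ] ℝ × ℝ)
      hgi).toContinuousLinearEquiv, ?_⟩
    exact hgq
  obtain ⟨f', hf'⟩ := hequiv p hp
  have hgp : ContDiffAt ℝ ∞ g p := hg.contDiffAt (hN.mem_nhds hp)
  refine ⟨U, (hgp.toOpenPartialHomeomorph g hf' (by simp)).restrOpen N hN, ?_, ?_, ?_, ?_, ?_, ?_⟩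
  · exact ⟨hgp.mem_toOpenPartialHomeomorph_source hf' (by simp), hp⟩
  · exact fun q hq => hNΩ hq.2
  · intro y hy
    have h1 := OpenPartialHomeomorph.map_target _ hy
    have h2 := OpenPartialHomeomorph.right_inv _ hy
    rw [← h2]
    exact hmaps _ h1.2
  · exact hg.mono fun q hq => hq.2
  · intro y hy
    have h1 := OpenPartialHomeomorph.map_target _ hy
    obtain ⟨f₁, hf₁⟩ := hequiv _ h1.2
    exact (OpenPartialHomeomorph.contDiffAt_symm _ hy hf₁
      (hg.contDiffAt (hN.mem_nhds h1.2))).contDiffWithinAt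
  · exact fun q hq => h q hq.2

lemma exists_unitary_smul {e : ℂ} (he : ‖e‖ = 1) : ∃ U : C2 ≃ₗᵢ[ℂ] C2, ∀ x, U x = e • x := by
  have h1 : conj e * e = 1 := by rw [Complex.conj_mul', he]; simp
  obtain ⟨U, h1, h2⟩ := exists_unitary (f₁ := !₂[1, 0]) (f₂ := !₂[0, 1])
    (g₁ := !₂[e, 0]) (g₂ := !₂[0, e])
    (by rw [inner_eq_coords]; simp) (by rw [inner_eq_coords]; simp) (by rw [inner_eq_coords]; simp)
    (by rw [inner_eq_coords]; simpa using h1) (by rw [inner_eq_coords]; simpa using h1)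
    (by rw [inner_eq_coords]; simp)
  refine ⟨U, fun x => ?_⟩
  have hx : x = x 0 • !₂[1, 0] + x 1 • !₂[0, 1] := by ext i; fin_cases i <;> simp
  conv_lhs => rw [hx, map_add, map_smul, map_smul, h1, h2]
  ext i; fin_cases i <;> simp [mul_comm]

lemma smooth_mk {E : Type*} [NormedAddCommGroup E] [NormedSpace ℝ E] {f g : E → ℂ} {s : Set E}
    (hf : ContDiffOn ℝ ∞ f s) (hg : ContDiffOn ℝ ∞ g s) :
    ContDiffOn ℝ ∞ (fun q => (!₂[f q, g q] : C2)) s := by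
  have e : ∀ x y : ℂ, (!₂[x, y] : C2) = x • !₂[1, 0] + y • !₂[0, 1] := fun x y => by
    ext i; fin_cases i <;> simp
  rw [funext fun q => e (f q) (g q)]
  exact (hf.smul contDiffOn_const).add (hg.smul contDiffOn_const)

lemma smooth_ofReal {E : Type*} [NormedAddCommGroup E] [NormedSpace ℝ E] {f : E → ℝ} {s : Set E}
    (hf : ContDiffOn ℝ ∞ f s) : ContDiffOn ℝ ∞ (fun q => (f q : ℂ)) s :=
  Complex.ofRealCLM.contDiff.comp_contDiffOn hf

lemma smooth_circleProduct {c : ℝ} {Γ : ℝ → ℂ} {I : Set ℝ} (hΓ : ContDiffOn ℝ ∞ Γ I) :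
    ContDiffOn ℝ ∞ (circleProduct c Γ) (strip I) :=
  smooth_mk (contDiffOn_const.mul ((smooth_ofReal contDiffOn_snd).mul contDiffOn_const).cexp)
    (hΓ.comp contDiffOn_fst fun _ hq => hq.1)

lemma smooth_realPlane : ContDiffOn ℝ ∞ realPlane Set.univ :=
  smooth_mk (smooth_ofReal contDiffOn_fst) (smooth_ofReal contDiffOn_snd)

lemma smooth_polarCurve {r φ : ℝ → ℝ} {I : Set ℝ} (hr : ContDiffOn ℝ ∞ r I)
    (hφ : ContDiffOn ℝ ∞ φ I) : ContDiffOn ℝ ∞ (polarCurve r φ) I :=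
  (smooth_ofReal hr).mul (smooth_phase hφ)

lemma smooth_typeI {r φ : ℝ → ℝ} {I : Set ℝ} (hr : ContDiffOn ℝ ∞ r I)
    (hφ : ContDiffOn ℝ ∞ φ I) : ContDiffOn ℝ ∞ (typeI r φ fun _ => 0) (strip I) :=
  (((smooth_polarCurve hr hφ).comp contDiffOn_fst fun _ hq => hq.1).smul
    (smooth_mk (smooth_ofReal contDiffOn_snd.cos) (smooth_ofReal contDiffOn_snd.sin))).add
    contDiffOn_const

/-! ### Pieces of Lagrangian planes through the origin -/

/-- On a ray from the origin both the curvature and `⟨γ, N⟩` vanish, so the value of `lam` is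
irrelevant. -/
lemma isEquivariantProfileOn_line (lam : ℝ) :
    IsEquivariantProfileOn lam (polarCurve id fun _ => 0) (Set.Ioi 0) := by
  have e : polarCurve id (fun _ => 0) = fun s : ℝ => (s : ℂ) := by
    funext s; simp [polarCurve]
  have h1 : deriv (fun s : ℝ => (s : ℂ)) = fun _ => 1 := by
    funext s; exact (hasDerivAt_id s).ofReal_comp.deriv
  rw [e]
  refine ⟨⟨Complex.ofRealCLM.contDiff.contDiffOn, fun s _ => by rw [h1]; simp⟩, fun s hs => ⟨?_, ?_⟩⟩
  · exact Complex.ofReal_ne_zero.2 (ne_of_gt hs)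
  · rw [curvature_eq, cdot_unitNormal, h1]; simp

/-- An immersion with values in the real plane is locally congruent to the plane, and away from the
origin also to the equivariant surface over a ray. -/
lemma locallyCongruentAt_plane {Y : ℝ × ℝ → C2} {Ω : Set (ℝ × ℝ)} (hΩ : IsOpen Ω)
    (hY : IsImmersionOn Y Ω) (U : C2 ≃ₗᵢ[ℂ] C2)
    (h : ∀ q ∈ Ω, ∃ x y : ℝ, U (Y q) = !₂[(x : ℂ), (y : ℂ)]) {p : ℝ × ℝ} (hp : p ∈ Ω) :
    LocallyCongruentAt Y Ω p realPlane Set.univ ∧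
    (Y p ≠ 0 → LocallyCongruentAt Y Ω p (typeI id (fun _ => 0) fun _ => 0) (strip (Set.Ioi 0))) := by
  have hUY : ContDiffOn ℝ ∞ (fun q => U (Y q)) Ω := smooth_unitary U hY.1
  have hcoord : ∀ i : Fin 2, ContDiffOn ℝ ∞ (fun q => (U (Y q) i).re) Ω := fun i =>
    Complex.reCLM.contDiff.comp_contDiffOn
      (((EuclideanSpace.proj i : C2 →L[ℂ] ℂ).restrictScalars ℝ).contDiff.comp_contDiffOn hUY)
  have hreal : ∀ q ∈ Ω, U (Y q) = !₂[((U (Y q) 0).re : ℂ), ((U (Y q) 1).re : ℂ)] := by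
    intro q hq
    obtain ⟨x, y, hxy⟩ := h q hq
    rw [hxy]; simp
  refine ⟨locallyCongruentAt_of_comp hΩ isOpen_univ hY hΩ subset_rfl hp
    (smooth_realPlane.differentiableOn (by simp)) ((hcoord 0).prodMk (hcoord 1))
    (fun _ _ => trivial) U hreal, fun hYp => ?_⟩
  set w : ℝ × ℝ → ℂ := fun q => (U (Y q) 0).re + (U (Y q) 1).re * Complex.I with hw
  have hwsm : ContDiffOn ℝ ∞ w Ω :=
    (smooth_ofReal (hcoord 0)).add ((smooth_ofReal (hcoord 1)).mul contDiffOn_const)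
  have hwp : w p ≠ 0 := by
    intro h0
    have h1 := congrArg Complex.re h0
    have h2 := congrArg Complex.im h0
    simp [hw] at h1 h2
    have h3 := hreal p hp
    rw [h1, h2] at h3
    apply hYp
    rw [← map_eq_zero_iff U U.injective, h3]
    ext i; fin_cases i <;> simp
  -- Polar coordinates use the principal argument, which is smooth only off the negative real axis;
  -- if `w p` lies on that axis, the unitary map `-1` moves it away.
  obtain ⟨σ, hσ, hslit⟩ : ∃ σ : ℝ, (σ = 1 ∨ σ = -1) ∧ (σ : ℂ) * w p ∈ Complex.slitPlane := by
    by_cases hs : w p ∈ Complex.slitPlane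
    · exact ⟨1, .inl rfl, by simpa using hs⟩
    · refine ⟨-1, .inr rfl, ?_⟩
      rw [Complex.mem_slitPlane_iff, not_or, not_lt, not_not] at hs
      rw [Complex.mem_slitPlane_iff]
      left
      have : (w p).re ≠ 0 := fun h0 => hwp (Complex.ext h0 hs.2)
      have := lt_of_le_of_ne hs.1 this
      simpa using this
  have hσn : ‖(σ : ℂ)‖ = 1 := by rcases hσ with rfl | rfl <;> simp
  obtain ⟨R, hR⟩ := exists_unitary_smul hσn
  set w' : ℝ × ℝ → ℂ := fun q => (σ : ℂ) * w q with hw'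
  have hw'sm : ContDiffOn ℝ ∞ w' Ω := contDiffOn_const.mul hwsm
  have hN : IsOpen (Ω ∩ w' ⁻¹' Complex.slitPlane) :=
    hw'sm.continuousOn.isOpen_inter_preimage hΩ Complex.isOpen_slitPlane
  refine locallyCongruentAt_of_comp (g := fun q => (‖w' q‖, (w' q).arg)) hΩ
    (isOpen_strip isOpen_Ioi) hY hN Set.inter_subset_left
    ⟨hp, hslit⟩ ((smooth_typeI contDiffOn_id contDiffOn_const).differentiableOn (by simp))
    ?_ ?_ (U.trans R) ?_
  · have hsm := hw'sm.mono (Set.inter_subset_left (t := w' ⁻¹' Complex.slitPlane))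
    refine (hsm.norm ℝ fun q hq => Complex.slitPlane_ne_zero hq.2).prodMk ?_
    have : ContDiffOn ℝ ∞ (fun q => (Complex.log (w' q)).im) (Ω ∩ w' ⁻¹' Complex.slitPlane) :=
      Complex.imCLM.contDiff.comp_contDiffOn (fun q hq =>
        ((Complex.contDiffAt_log hq.2).restrict_scalars ℝ).comp_contDiffWithinAt q (hsm q hq))
    simpa only [Complex.log_im] using this
  · exact fun q hq => ⟨norm_pos_iff.2 (Complex.slitPlane_ne_zero hq.2), trivial⟩
  · intro q hq
    have e1 := congrArg Complex.ofReal (Complex.norm_mul_cos_arg (w' q))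
    have e2 := congrArg Complex.ofReal (Complex.norm_mul_sin_arg (w' q))
    rw [Complex.ofReal_mul, Complex.ofReal_cos] at e1
    rw [Complex.ofReal_mul, Complex.ofReal_sin] at e2
    rw [LinearIsometryEquiv.trans_apply, hR, hreal q hq.1]
    ext i; fin_cases i
    · simp only [typeI, polarCurve]
      simp
      rw [e1]
      simp [hw', hw]
    · simp only [typeI, polarCurve]
      simp
      rw [e2]
      simp [hw', hw]

/-! ### Reduction to circles in Lagrangian planes or in complex lines -/

section Cyclic

variable {lam : ℝ} {I : Set ℝ} {A B V : ℝ → C2}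

lemma IsSol.congr (hI : IsOpen I) (h : IsSol lam A B V I) {A' B' : ℝ → C2}
    (hA : ∀ s ∈ I, A' s = A s) (hB : ∀ s ∈ I, B' s = B s) : IsSol lam A' B' V I := by
  have d : ∀ {f g : ℝ → C2}, (∀ s ∈ I, g s = f s) → ContDiffOn ℝ ∞ f I →
      ∀ s ∈ I, HasDerivAt g (deriv f s) s := fun hfg hf s hs =>
    HasDerivAt.of_eqOn hI hs hfg (hasDerivAt_of_smooth hI hf hs)
  have d2 := fun {f : ℝ → C2} (hf : ContDiffOn ℝ ∞ f I) s (hs : s ∈ I) =>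
    hasDerivAt_of_smooth hI (smooth_deriv hI hf) hs
  refine .of_hasDerivAt hI (h.smoothA.congr hA) (h.smoothB.congr hB) h.smoothV
    (d hA h.smoothA) (d2 h.smoothA) (d hB h.smoothB) (d2 h.smoothB)
    (d (fun _ _ => rfl) h.smoothV) (d2 h.smoothV) (fun s hs => ?_) (fun s hs z hz => ?_)
  · rw [hA s hs, hB s hs, h.orth s hs]
  · rw [hA s hs, hB s hs]; exact h.jet s hs z hz

lemma IsSol.ne_zero (h : IsSol lam A B V I) {s : ℝ} (hs : s ∈ I) : A s ≠ 0 ∨ B s ≠ 0 := by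
  by_contra! h0
  have := (h.jet s hs 1 (by simp)).indep.ne_zero 1
  simp [cyc, h0] at this

lemma re_inner_self (x : C2) : (inner ℂ x x : ℂ).re = ‖x‖ ^ 2 := rdot_self x

/-- By the constant coefficient of the Lagrangian condition, `|A|²` and `|B|²` have the same
derivative. -/
lemma IsSol.norm_sub_norm (hI : IsOpenInterval I) (h : IsSol lam A B V I) :
    ∃ K : ℝ, ∀ s ∈ I, ‖A s‖ ^ 2 - ‖B s‖ ^ 2 = K := by
  have hO := hI.2.1
  refine eq_const_of_hasDerivAt_zero hI fun s hs => ?_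
  have key : ∀ {f : ℝ → C2}, ContDiffOn ℝ ∞ f I →
      HasDerivAt (fun s => ‖f s‖ ^ 2) (2 * (inner ℂ (deriv f s) (f s)).re) s := by
    intro f hf
    have d := hasDerivAt_of_smooth hO hf hs
    have h1 := Complex.reCLM.hasFDerivAt.comp_hasDerivAt s (d.inner ℂ d)
    have e : (fun s => ‖f s‖ ^ 2) = ⇑Complex.reCLM ∘ fun s => inner ℂ (f s) (f s) := by
      funext s; simp only [← re_inner_self]; rfl
    rw [e]
    refine h1.congr_deriv ?_
    have e2 : (inner ℂ (f s) (deriv f s)).re = (inner ℂ (deriv f s) (f s)).re := by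
      rw [← inner_conj_symm, Complex.conj_re]
    simp only [Complex.reCLM_apply, Complex.add_re]
    linarith
  refine ((key h.smoothA).sub (key h.smoothB)).congr_deriv ?_
  rw [(h.lagrangian hs).1, sub_self]

/-- In `ℂ²`, the vectors orthogonal to `B` are the multiples of any `A ≠ 0` orthogonal to `B`. -/
lemma eq_smul_of_orth {A B x : C2} (hA : A ≠ 0) (hB : B ≠ 0) (h : inner ℂ A B = (0 : ℂ))
    (hx : inner ℂ B x = (0 : ℂ)) : x = ((inner ℂ A x : ℂ) / (‖A‖ : ℂ) ^ 2) • A := by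
  obtain ⟨U, h1, h2⟩ := exists_unitary_axes hA hB h
  have hA' : (‖A‖ : ℂ) ≠ 0 := by simpa using hA
  have hB' : (‖B‖ : ℂ) ≠ 0 := by simpa using hB
  rw [← U.inner_map_map, h2] at hx
  rw [← U.inner_map_map A x, h1]
  apply U.injective
  rw [map_smul, h1]
  have hx1 : U x 1 = 0 := by simpa [inner_eq_coords, hB] using hx
  ext i; fin_cases i
  · simp [inner_eq_coords]; field_simp
  · simpa using hx1

/-- A nowhere vanishing curve with velocity in its complex line. -/
lemma exists_exp_smul (hI : IsOpenInterval I) {p : ℝ → ℂ} (hp : ContDiffOn ℝ ∞ p I)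
    (hA : ∀ s ∈ I, HasDerivAt A (p s • A s) s) :
    ∃ (P : ℝ → ℂ) (A₀ : C2), ContDiffOn ℝ ∞ P I ∧ ∀ s ∈ I, A s = Complex.exp (P s) • A₀ := by
  obtain ⟨P, hP, hP'⟩ := exists_primitive hI hp
  obtain ⟨A₀, hA₀⟩ := eq_const_of_hasDerivAt_zero hI (f := fun s => Complex.exp (-P s) • A s) (by
    intro s hs
    refine ((hP' s hs).neg.cexp.smul (hA s hs)).congr_deriv ?_
    simp only [Pi.neg_apply]
    module)
  refine ⟨P, A₀, hP, fun s hs => ?_⟩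
  rw [← hA₀ s hs, smul_smul, ← Complex.exp_add]; simp

/-- `A'` is orthogonal to `B`, and in dimension two the orthogonal of `B` is the complex line of
`A`; so `A` never leaves a fixed line. -/
lemma IsSol.exists_exp_smul (hI : IsOpenInterval I) (h : IsSol lam A B V I)
    (hA : ∀ s ∈ I, A s ≠ 0) (hB : ∀ s ∈ I, B s ≠ 0) :
    ∃ (P : ℝ → ℂ) (A₀ : C2), ContDiffOn ℝ ∞ P I ∧ ∀ s ∈ I, A s = Complex.exp (P s) • A₀ := by
  have hO := hI.2.1
  refine CyclicLagrangian.exists_exp_smul hI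
    (p := fun s => inner ℂ (A s) (deriv A s) / (‖A s‖ : ℂ) ^ 2) ?_ ?_
  · simp only [div_eq_mul_inv]
    refine (smooth_inner h.smoothA (smooth_deriv hO h.smoothA)).mul
      (((smooth_ofReal (h.smoothA.norm ℝ hA)).pow 2).inv fun s hs => ?_)
    exact pow_ne_zero 2 (by simpa using hA s hs)
  · intro s hs
    have := hasDerivAt_of_smooth hO h.smoothA hs
    rwa [eq_smul_of_orth (hA s hs) (hB s hs) (h.orth s hs) (h.deriv_orth hO hs).1] at this

/-- If both coefficients are nowhere zero, the circles lie in Lagrangian planes. -/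
lemma IsSol.exists_typeI (hlam : lam ≠ 0) (hI : IsOpenInterval I) (h : IsSol lam A B V I)
    (hA : ∀ s ∈ I, A s ≠ 0) (hB : ∀ s ∈ I, B s ≠ 0) :
    ∃ (r φ τ : ℝ → ℝ) (U : C2 ≃ₗᵢ[ℂ] C2), ContDiffOn ℝ ∞ r I ∧ ContDiffOn ℝ ∞ φ I ∧
      ContDiffOn ℝ ∞ τ I ∧ (∀ s ∈ I, 0 < r s) ∧
      IsSol lam (fun s => (polarCurve r φ s / 2) • !₂[1, -Complex.I])
        (fun s => (polarCurve r φ s / 2) • !₂[1, Complex.I]) (fun s => U (V s)) I ∧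
      ∀ s ∈ I, ∀ t : ℝ, U (cyc (Complex.exp (t * Complex.I)) (A s) (B s) (V s))
        = typeI r φ (fun s => U (V s)) (s, t + τ s) := by
  have hO := hI.2.1
  obtain ⟨s₀, hs₀⟩ := hI.1
  obtain ⟨P, A₀, hP, hAP⟩ := h.exists_exp_smul hI hA hB
  obtain ⟨Q, B₀, hQ, hBQ⟩ := h.swap.exists_exp_smul hI hB hA
  have hA₀ : A₀ ≠ 0 := by rintro rfl; exact hA s₀ hs₀ (by rw [hAP s₀ hs₀, smul_zero])
  have hB₀ : B₀ ≠ 0 := by rintro rfl; exact hB s₀ hs₀ (by rw [hBQ s₀ hs₀, smul_zero])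
  have hAB₀ : inner ℂ A₀ B₀ = (0 : ℂ) := by
    have := h.orth s₀ hs₀
    rw [hAP s₀ hs₀, hBQ s₀ hs₀, inner_smul_left, inner_smul_right] at this
    simpa [Complex.exp_ne_zero] using this
  have hnorm : ∀ s ∈ I, Real.exp (Q s).re * ‖B₀‖ = Real.exp (P s).re * ‖A₀‖ := by
    intro s hs
    have := h.norm_eq hlam hO hs (hA s hs) (hB s hs)
    rw [hAP s hs, hBQ s hs, norm_smul, norm_smul, Complex.norm_exp, Complex.norm_exp] at this
    exact this.symm
  have hsq := sqrt_two_inv_sq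
  have hs2 : (Real.sqrt 2 : ℂ) ≠ 0 := by
    exact_mod_cast (Real.sqrt_pos.2 (by norm_num : (0 : ℝ) < 2)).ne'
  have hs2' : (Real.sqrt 2 : ℂ) ^ 2 = 2 := by
    rw [← Complex.ofReal_pow, Real.sq_sqrt (by norm_num)]; simp
  -- The two fixed lines are sent to those of `(1, -i)` and `(1, i)`, the coefficient vectors of the
  -- unit circle of `ℝ²`.
  obtain ⟨U₁, hU₁A, hU₁B⟩ := exists_unitary_axes hA₀ hB₀ hAB₀
  obtain ⟨U₂, hU₂A, hU₂B⟩ := exists_unitary (f₁ := !₂[1, 0]) (f₂ := !₂[0, 1])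
    (g₁ := (Real.sqrt 2 : ℂ)⁻¹ • !₂[1, -Complex.I]) (g₂ := (Real.sqrt 2 : ℂ)⁻¹ • !₂[1, Complex.I])
    (by rw [inner_eq_coords]; simp) (by rw [inner_eq_coords]; simp) (by rw [inner_eq_coords]; simp)
    (by
      rw [inner_eq_coords]; simp
      linear_combination 2 * hsq - (Real.sqrt 2 : ℂ)⁻¹ ^ 2 * Complex.I_sq)
    (by
      rw [inner_eq_coords]; simp
      linear_combination 2 * hsq - (Real.sqrt 2 : ℂ)⁻¹ ^ 2 * Complex.I_sq)
    (by
      rw [inner_eq_coords]; simp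
      linear_combination (Real.sqrt 2 : ℂ)⁻¹ ^ 2 * Complex.I_sq)
  set U := U₁.trans U₂ with hU
  have hUA : U A₀ = ((‖A₀‖ : ℂ) * (Real.sqrt 2 : ℂ)⁻¹) • !₂[1, -Complex.I] := by
    rw [hU, LinearIsometryEquiv.trans_apply, hU₁A, mul_smul, ← hU₂A, ← map_smul]
    congr 1; ext i; fin_cases i <;> simp
  have hUB : U B₀ = ((‖B₀‖ : ℂ) * (Real.sqrt 2 : ℂ)⁻¹) • !₂[1, Complex.I] := by
    rw [hU, LinearIsometryEquiv.trans_apply, hU₁B, mul_smul, ← hU₂B, ← map_smul]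
    congr 1; ext i; fin_cases i <;> simp
  -- `(1, -i)` has norm `√2`, so `(r / 2) √2 = |A|`. The mean of the two phases turns the plane, and
  -- half their difference shifts the parameter.
  set r : ℝ → ℝ := fun s => Real.sqrt 2 * (Real.exp (P s).re * ‖A₀‖) with hr
  set φ : ℝ → ℝ := fun s => ((P s).im + (Q s).im) / 2 with hφ
  set τ : ℝ → ℝ := fun s => ((P s).im - (Q s).im) / 2 with hτ
  have sPre : ContDiffOn ℝ ∞ (fun s => (P s).re) I := Complex.reCLM.contDiff.comp_contDiffOn hP
  have sPim : ContDiffOn ℝ ∞ (fun s => (P s).im) I := Complex.imCLM.contDiff.comp_contDiffOn hP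
  have sQim : ContDiffOn ℝ ∞ (fun s => (Q s).im) I := Complex.imCLM.contDiff.comp_contDiffOn hQ
  have sr : ContDiffOn ℝ ∞ r I := contDiffOn_const.mul (sPre.exp.mul contDiffOn_const)
  have sφ : ContDiffOn ℝ ∞ φ I := (sPim.add sQim).div_const 2
  have sτ : ContDiffOn ℝ ∞ τ I := (sPim.sub sQim).div_const 2
  have hUAs : ∀ s ∈ I, U (A s) =
      Complex.exp (τ s * Complex.I) • ((polarCurve r φ s / 2) • !₂[1, -Complex.I]) := by
    intro s hs
    have e1 : Complex.exp (P s) = (Real.exp (P s).re : ℂ) * (Complex.exp (τ s * Complex.I)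
        * Complex.exp (φ s * Complex.I)) := by
      rw [Complex.ofReal_exp, ← Complex.exp_add, ← Complex.exp_add]
      congr 1
      conv_lhs => rw [← Complex.re_add_im (P s)]
      simp only [hτ, hφ]; push_cast; ring
    rw [hAP s hs, map_smul, hUA, smul_smul, smul_smul, e1]
    congr 1
    simp only [polarCurve, hr]
    push_cast
    field_simp
    linear_combination -(‖A₀‖ : ℂ) * hs2'
  have hUBs : ∀ s ∈ I, U (B s) =
      Complex.exp (-(τ s * Complex.I)) • ((polarCurve r φ s / 2) • !₂[1, Complex.I]) := by
    intro s hs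
    have e1 : Complex.exp (Q s) = (Real.exp (Q s).re : ℂ) * (Complex.exp (-(τ s * Complex.I))
        * Complex.exp (φ s * Complex.I)) := by
      rw [Complex.ofReal_exp, ← Complex.exp_add, ← Complex.exp_add]
      congr 1
      conv_lhs => rw [← Complex.re_add_im (Q s)]
      simp only [hτ, hφ]; push_cast; ring
    have e2 : (Real.exp (Q s).re : ℂ) * ‖B₀‖ = Real.exp (P s).re * ‖A₀‖ := by
      exact_mod_cast hnorm s hs
    rw [hBQ s hs, map_smul, hUB, smul_smul, smul_smul, e1]
    congr 1
    simp only [polarCurve, hr]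
    push_cast at e2 ⊢
    field_simp
    linear_combination 2 * e2 - Complex.exp (P s).re * ‖A₀‖ * hs2'
  have hexp : ∀ s, Complex.exp (-(τ s * Complex.I)) * Complex.exp (τ s * Complex.I) = 1 := by
    intro s; rw [← Complex.exp_add]; simp
  refine ⟨r, φ, τ, U, sr, sφ, sτ, fun s hs => ?_, ?_, fun s hs t => ?_⟩
  · have := norm_pos_iff.2 hA₀
    positivity
  · refine ((h.unitary hO U).phase hO sτ.neg).congr hO (fun s hs => ?_) (fun s hs => ?_)
    · rw [hUAs s hs, smul_smul (Complex.exp _)]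
      simp only [Complex.ofReal_neg, neg_mul, hexp, one_smul]
    · rw [hUBs s hs, smul_smul (Complex.exp _)]
      simp only [Complex.ofReal_neg, neg_mul, neg_neg, mul_comm (Complex.exp (τ s * Complex.I)),
        hexp, one_smul]
  · rw [cyc_unitary, hUAs s hs, hUBs s hs]
    have e1 : Complex.exp (((t + τ s : ℝ) : ℂ) * Complex.I)
        = Complex.exp (t * Complex.I) * Complex.exp (τ s * Complex.I) := by
      rw [← Complex.exp_add]; push_cast; ring_nf
    have e2 : cyc (Complex.exp (t * Complex.I))
        (Complex.exp (τ s * Complex.I) • ((polarCurve r φ s / 2) • !₂[1, -Complex.I]))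
        (Complex.exp (-(τ s * Complex.I)) • ((polarCurve r φ s / 2) • !₂[1, Complex.I])) (U (V s))
        = cyc (Complex.exp (((t + τ s : ℝ) : ℂ) * Complex.I))
          ((polarCurve r φ s / 2) • !₂[1, -Complex.I]) ((polarCurve r φ s / 2) • !₂[1, Complex.I])
          (U (V s)) := by
      simp only [cyc, smul_smul]
      rw [e1, map_mul, conj_expI (τ s)]
      simp only [mul_assoc]
    rw [e2, cyc_lagrangian, Complex.exp_ofReal_mul_I_re, Complex.exp_ofReal_mul_I_im]
    rfl

/-- The normal is inward, so the curvature is `1/k` and `⟨Γ, N⟩ = -k`. This presents the Clifford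
torus as a product of the required kind. -/
lemma isSelfSimilarCurveOn_circle {k : ℝ} (hk : 0 < k) (h : lam * k ^ 2 = 1) :
    IsSelfSimilarCurveOn lam (fun s : ℝ => (k : ℂ) * Complex.exp (s * Complex.I)) Set.univ := by
  have h1 : ∀ s : ℝ, HasDerivAt (fun s : ℝ => (k : ℂ) * Complex.exp (s * Complex.I))
      (k * (Complex.exp (s * Complex.I) * Complex.I)) s := fun s => (hasDerivAt_expI s).const_mul _
  have h2 : ∀ s : ℝ, HasDerivAt (fun s : ℝ => (k : ℂ) * (Complex.exp (s * Complex.I) * Complex.I))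
      (k * (Complex.exp (s * Complex.I) * Complex.I * Complex.I)) s := fun s =>
    ((hasDerivAt_expI s).mul_const _).const_mul _
  have hd : deriv (fun s : ℝ => (k : ℂ) * Complex.exp (s * Complex.I))
      = fun s : ℝ => (k : ℂ) * (Complex.exp (s * Complex.I) * Complex.I) :=
    funext fun s => (h1 s).deriv
  have hk0 : (k : ℂ) ≠ 0 := by exact_mod_cast hk.ne'
  refine isSelfSimilarCurveOn_of_eq ⟨?_, fun s _ => ?_⟩ fun s _ => ?_
  · exact contDiffOn_const.mul ((smooth_ofReal contDiffOn_id).mul contDiffOn_const).cexp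
  · rw [hd]
    exact mul_ne_zero hk0 (mul_ne_zero (Complex.exp_ne_zero _) Complex.I_ne_zero)
  · rw [hd, (h2 s).deriv]
    have hn := re_sq_add_im_sq (Complex.norm_exp_ofReal_mul_I s)
    beta_reduce
    generalize Complex.exp (s * Complex.I) = z at hn ⊢
    simp [Complex.normSq_apply]
    linear_combination -lam * k ^ 4 * (z.re ^ 2 + z.im ^ 2) * hn
      - k ^ 2 * (z.re ^ 2 + z.im ^ 2) * h

/-- If `B = 0`, the surface is a product of a circle and a curve. -/
lemma IsSol.exists_circleProduct (hlam : lam ≠ 0) (hI : IsOpenInterval I)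
    (h : IsSol lam A (fun _ => 0) V I) :
    ∃ (I' : Set ℝ) (r : ℝ) (Γ : ℝ → ℂ) (U : C2 ≃ₗᵢ[ℂ] C2) (g : ℝ × ℝ → ℝ × ℝ),
      IsOpenInterval I' ∧ 0 < r ∧ lam * r ^ 2 = 1 ∧ IsSelfSimilarCurveOn lam Γ I' ∧
      ContDiffOn ℝ ∞ g (strip I) ∧ (∀ q ∈ strip I, g q ∈ strip I') ∧
      ∀ s ∈ I, ∀ t : ℝ, U (cyc (Complex.exp (t * Complex.I)) (A s) 0 (V s))
        = circleProduct r Γ (g (s, t)) := by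
  have hO := hI.2.1
  obtain ⟨s₀, hs₀⟩ := hI.1
  obtain ⟨K, hK⟩ := h.norm_sub_norm hI
  simp only [norm_zero, ne_eq, OfNat.ofNat_ne_zero, not_false_eq_true, zero_pow, sub_zero] at hK
  have hA : ∀ s ∈ I, A s ≠ 0 := fun s hs => (h.ne_zero hs).resolve_right fun h => h rfl
  have hKpos : 0 < K := by rw [← hK s₀ hs₀]; have := norm_pos_iff.2 (hA s₀ hs₀); positivity
  set c := Real.sqrt K with hc
  have hcpos : 0 < c := Real.sqrt_pos.2 hKpos
  have hcK : c ^ 2 = K := Real.sq_sqrt hKpos.le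
  have hc0 : (c : ℂ) ≠ 0 := by exact_mod_cast hcpos.ne'
  have hAA : ∀ s ∈ I, inner ℂ (A s) (A s) = (c : ℂ) ^ 2 := by
    intro s hs
    rw [inner_self_eq_norm_sq_to_K, ← Complex.ofReal_pow c, hcK, ← hK s hs]
    simp
  -- As `|A|² = K` is constant, `⟨A, A'⟩` is purely imaginary; turning `A` by `-τ` cancels it and
  -- makes the curve horizontal.
  obtain ⟨τ, hτ, hτ'⟩ := exists_primitive hI (f := fun s => (inner ℂ (A s) (deriv A s)).im / K)
    ((Complex.imCLM.contDiff.comp_contDiffOn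
      (smooth_inner h.smoothA (smooth_deriv hO h.smoothA))).div_const K)
  have hexp : ∀ s, Complex.exp (τ s * Complex.I) * Complex.exp (((-τ s : ℝ) : ℂ) * Complex.I) = 1 := by
    intro s; rw [← Complex.exp_add]; simp
  set γ : ℝ → C2 := fun s => (c : ℂ)⁻¹ • Complex.exp (((-τ s : ℝ) : ℂ) * Complex.I) • A s with hγ
  have hcγ : ∀ s, (c : ℂ) • γ s = Complex.exp (((-τ s : ℝ) : ℂ) * Complex.I) • A s := by
    intro s; rw [hγ, smul_inv_smul₀ hc0]
  have hAγ : ∀ s, A s = ((c : ℂ) * Complex.exp (τ s * Complex.I)) • γ s := by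
    intro s; rw [mul_comm, mul_smul, hcγ, smul_smul, hexp, one_smul]
  have hsol : IsSol lam (fun s => (c : ℂ) • γ s) (fun _ => 0) V I :=
    (h.phase hO hτ.neg).congr hO (fun s hs => hcγ s) (fun s hs => by simp)
  have hγsm : ContDiffOn ℝ ∞ γ I :=
    (contDiffOn_const (c := (c : ℂ)⁻¹)).smul ((smooth_phase hτ.neg).smul h.smoothA)
  have hconj : ∀ s, conj (Complex.exp (((-τ s : ℝ) : ℂ) * Complex.I))
      * Complex.exp (((-τ s : ℝ) : ℂ) * Complex.I) = 1 := by
    intro s; rw [Complex.conj_mul', Complex.norm_exp_ofReal_mul_I]; simp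
  have hunit : ∀ s ∈ I, inner ℂ (γ s) (γ s) = (1 : ℂ) := by
    intro s hs
    simp only [hγ, inner_smul_left, inner_smul_right, map_inv₀, Complex.conj_ofReal, hAA s hs]
    field_simp
    rw [mul_comm]
    exact hconj s
  have hre : ∀ s ∈ I, (inner ℂ (deriv A s) (A s)).re = 0 := by
    intro s hs
    rw [(h.lagrangian hs).1]; simp
  have hleg : ∀ s ∈ I, inner ℂ (γ s) (deriv γ s) = (0 : ℂ) := by
    intro s hs
    have h1 : HasDerivAt γ _ s := ((hasDerivAt_phase (hτ' s hs).neg).smul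
      (hasDerivAt_of_smooth hO h.smoothA hs)).const_smul (c : ℂ)⁻¹
    have h2 : inner ℂ (A s) (deriv A s) = ((inner ℂ (A s) (deriv A s)).im : ℂ) * Complex.I := by
      have h3 := hre s hs
      rw [← inner_conj_symm, Complex.conj_re] at h3
      conv_lhs => rw [← Complex.re_add_im (inner ℂ (A s) (deriv A s)), h3]
      simp
    rw [h1.deriv]
    generalize (inner ℂ (A s) (deriv A s)).im = y at h2 ⊢
    simp only [hγ, inner_smul_left, inner_smul_right, inner_add_right, hAA s hs, Pi.neg_apply]
    rw [h2, ← hcK]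
    push_cast
    field_simp
    ring
  have hY : ∀ s (t : ℝ), cyc (Complex.exp (t * Complex.I)) (A s) 0 (V s)
      = typeII c γ V (s, t + τ s) := by
    intro s t
    simp only [cyc, typeII, smul_zero, add_zero]
    congr 1
    conv_lhs => rw [hAγ s, smul_smul]
    congr 1
    push_cast
    rw [add_mul, Complex.exp_add]; ring
  have hτ2 : ContDiffOn ℝ ∞ (fun q : ℝ × ℝ => q.2 + τ q.1) (strip I) :=
    contDiffOn_snd.add (hτ.comp contDiffOn_fst fun q hq => hq.1)
  rcases typeII_classification hlam hI hγsm hunit hleg hsol with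
    ⟨-, hl, U, Γ, hΓ, hU⟩ | ⟨-, hl, -, U, x, hx, hU⟩
  · refine ⟨I, c, Γ, U, fun q => (q.1, q.2 + τ q.1), hI, hcpos, hl, hΓ,
      contDiffOn_fst.prodMk hτ2, fun q hq => ⟨hq.1, trivial⟩, fun s hs t => ?_⟩
    rw [hY, hU s hs]
  · have hxsm : ContDiffOn ℝ ∞ (fun q : ℝ × ℝ => x q.1) (strip I) :=
      hx.1.comp contDiffOn_fst fun q hq => hq.1
    have hl' : lam * (c / Real.sqrt 2) ^ 2 = 1 := by
      rw [div_pow, Real.sq_sqrt (zero_le_two (α := ℝ))]; linarith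
    have hk : 0 < c / Real.sqrt 2 := by positivity
    -- In the product the second parameter runs along the circle factor, so `t + x` goes in second
    -- place and `t - x` in first.
    refine ⟨Set.univ, c / Real.sqrt 2, _, U,
      fun q => (q.2 + τ q.1 - x q.1, q.2 + τ q.1 + x q.1),
      ⟨Set.univ_nonempty, isOpen_univ, Set.ordConnected_univ⟩, hk, hl',
      isSelfSimilarCurveOn_circle hk hl',
      (hτ2.sub hxsm).prodMk (hτ2.add hxsm), fun q hq => ⟨trivial, trivial⟩, fun s hs t => ?_⟩
    rw [hY, hU s hs]
    simp only [cliffordTorus, circleProduct]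
    ext i; fin_cases i <;> simp

end Cyclic

/-! ### The given parametrizations in coefficient form -/

section Types

variable {lam : ℝ} {I : Set ℝ} {A B V : ℝ → C2} {Y : ℝ × ℝ → C2}

lemma inner_self_eq_ofReal (x : C2) : (inner ℂ x x : ℂ) = ((‖x‖ ^ 2 : ℝ) : ℂ) := by
  rw [inner_self_eq_norm_sq_to_K]; simp

/-- The identities are the Fourier coefficients of the Lagrangian condition. Types I, II and III
satisfy them by construction, which is why they need no separate Lagrangian hypothesis. -/
lemma isSol_of_inner_eq (hI : IsOpen I)
    (hA : ContDiffOn ℝ ∞ A I) (hB : ContDiffOn ℝ ∞ B I) (hV : ContDiffOn ℝ ∞ V I)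
    (orth : ∀ s ∈ I, inner ℂ (A s) (B s) = (0 : ℂ))
    (hY : ∀ s ∈ I, ∀ t : ℝ, Y (s, t) = cyc (Complex.exp (t * Complex.I)) (A s) (B s) (V s))
    (himm : IsImmersionOn Y (strip I))
    (h₀ : ∀ s ∈ I, (inner ℂ (deriv B s) (B s)).re = (inner ℂ (deriv A s) (A s)).re)
    (h₁ : ∀ s ∈ I, inner ℂ (B s) (deriv V s) = inner ℂ (deriv V s) (A s))
    (h₂ : ∀ s ∈ I, inner ℂ (B s) (deriv A s) = inner ℂ (deriv B s) (A s))
    (hss : IsSelfSimilarOn lam Y (strip I)) : IsSol lam A B V I := by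
  refine isSol_of_isSelfSimilarOn hI hA hB hV orth hY himm (fun s hs z hz => ?_) hss
  rw [om_cyc hz, h₀ s hs, h₁ s hs, h₂ s hs]
  simp

lemma exists_isSol_of_isCyclicOn (hI : IsOpenInterval I) (hY : IsCyclicOn Y I)
    (himm : IsImmersionOn Y (strip I)) (hlag : IsLagrangianOn Y (strip I))
    (hss : IsSelfSimilarOn lam Y (strip I)) :
    ∃ A B V : ℝ → C2, IsSol lam A B V I ∧
      ∀ s ∈ I, ∀ t : ℝ, Y (s, t) = cyc (Complex.exp (t * Complex.I)) (A s) (B s) (V s) := by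
  obtain ⟨r, e₁, e₂, V, hr, he₁, he₂, hV, hon, hYeq⟩ := hY
  have hO := hI.2.1
  set A : ℝ → C2 := fun s => ((r s / 2 : ℝ) : ℂ) • (e₁ s - Complex.I • e₂ s) with hA
  set B : ℝ → C2 := fun s => ((r s / 2 : ℝ) : ℂ) • (e₁ s + Complex.I • e₂ s) with hB
  have sr : ContDiffOn ℝ ∞ (fun s => ((r s / 2 : ℝ) : ℂ)) I := smooth_ofReal (hr.div_const 2)
  have sA : ContDiffOn ℝ ∞ A I := sr.smul (he₁.sub (he₂.const_smul Complex.I))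
  have sB : ContDiffOn ℝ ∞ B I := sr.smul (he₁.add (he₂.const_smul Complex.I))
  have hcyc : ∀ s ∈ I, ∀ t : ℝ,
      Y (s, t) = cyc (Complex.exp (t * Complex.I)) (A s) (B s) (V s) := by
    intro s hs t
    rw [hYeq s hs t]
    simp only [hA, hB]
    ext i
    rw [cyc_apply, conj_expI, ← neg_mul, Complex.exp_mul_I, Complex.exp_mul_I]
    simp only [PiLp.add_apply, PiLp.smul_apply, PiLp.sub_apply, Complex.real_smul, smul_eq_mul,
      Complex.cos_neg, Complex.sin_neg, Complex.ofReal_cos, Complex.ofReal_sin]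
    push_cast
    linear_combination (r s : ℂ) * Complex.sin t * e₂ s i * Complex.I_sq
  refine ⟨A, B, V, isSol_of_isSelfSimilarOn hO sA sB hV (fun s hs => ?_) hcyc himm ?_ hss, hcyc⟩
  · obtain ⟨-, h1, h2, h3⟩ := hon s hs
    have h4 : ∀ x : C2, (inner ℂ x x : ℂ) = (rdot x x : ℂ) := fun x => by
      rw [rdot_self, inner_self_eq_ofReal]
    -- Only the real part of `⟨e₁, e₂⟩` is known to vanish, and only it enters `⟨A, B⟩`.
    have h5 : inner ℂ (e₁ s) (e₂ s) + inner ℂ (e₂ s) (e₁ s) = (0 : ℂ) := by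
      rw [← inner_conj_symm (e₂ s), Complex.add_conj]
      rw [rdot] at h3
      simp [h3]
    simp only [hA, hB, inner_smul_left, inner_smul_right, inner_add_right, inner_sub_left,
      h4 (e₁ s), h4 (e₂ s), h1, h2, Complex.conj_I,
      Complex.ofReal_one]
    linear_combination ((r s / 2 : ℝ) : ℂ) * conj ((r s / 2 : ℝ) : ℂ) *
      (Complex.I * h5 + Complex.I_sq)
  · intro s hs z hz
    obtain ⟨t, rfl⟩ : ∃ t : ℝ, Complex.exp (t * Complex.I) = z :=
      ⟨z.arg, by simpa [hz] using Complex.norm_mul_exp_arg_mul_I z⟩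
    have := hlag (s, t) ⟨hs, trivial⟩
    rwa [dS_cyc hO hcyc hs (hasDerivAt_of_smooth hO sA hs) (hasDerivAt_of_smooth hO sB hs)
      (hasDerivAt_of_smooth hO hV hs), dT_cyc hcyc hs] at this

lemma IsTypeIData.isSol {r φ : ℝ → ℝ} (hI : IsOpen I) (hd : IsTypeIData r φ V I)
    (himm : IsImmersionOn (typeI r φ V) (strip I))
    (hss : IsSelfSimilarOn lam (typeI r φ V) (strip I)) :
    IsSol lam (fun s => (polarCurve r φ s / 2) • !₂[1, -Complex.I])
      (fun s => (polarCurve r φ s / 2) • !₂[1, Complex.I]) V I := by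
  obtain ⟨hr, hφ, hV, hpos, W₁, W₂, hW⟩ := hd
  have hp := smooth_polarCurve hr hφ
  have sm : ∀ f : C2, ContDiffOn ℝ ∞ (fun s => (polarCurve r φ s / 2) • f) I := fun f =>
    (hp.div_const 2).smul contDiffOn_const
  have dm : ∀ f : C2, ∀ s ∈ I, deriv (fun s => (polarCurve r φ s / 2) • f) s
      = (deriv (polarCurve r φ) s / 2) • f := fun f s hs =>
    (((hasDerivAt_of_smooth hI hp hs).div_const 2).smul_const f).deriv
  refine isSol_of_inner_eq hI (sm _) (sm _) hV (fun s hs => ?_) (fun s hs t => ?_) himm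
    (fun s hs => ?_) (fun s hs => ?_) (fun s hs => ?_) hss
  · simp [inner_eq_coords]
  · rw [cyc_lagrangian, Complex.exp_ofReal_mul_I_re, Complex.exp_ofReal_mul_I_im]
    rfl
  · rw [dm _ s hs, dm _ s hs]
    simp only [inner_smul_left, inner_smul_right, inner_eq_coords]
    simp
  · rw [(hW s hs).deriv]
    simp only [inner_smul_left, inner_smul_right, inner_eq_coords, polarCurve]
    simp only [map_mul, map_div₀, Complex.conj_ofReal, map_ofNat, map_one, Complex.conj_I,
      Matrix.cons_val_zero, Matrix.cons_val_one]
    ring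
  · rw [dm _ s hs, dm _ s hs]
    simp [inner_eq_coords]

lemma IsTypeIIData.typeII_classification {c : ℝ} {γ : ℝ → C2} (hlam : lam ≠ 0)
    (hI : IsOpenInterval I) (hd : IsTypeIIData γ V I)
    (himm : IsImmersionOn (typeII c γ V) (strip I))
    (hss : IsSelfSimilarOn lam (typeII c γ V) (strip I)) :
    ((∃ γ₀ : C2, ∀ s ∈ I, γ s = γ₀) ∧ lam * c ^ 2 = 1 ∧
        ∃ (U : C2 ≃ₗᵢ[ℂ] C2) (Γ : ℝ → ℂ), IsSelfSimilarCurveOn lam Γ I ∧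
          ∀ s ∈ I, ∀ t : ℝ, U (typeII c γ V (s, t)) = circleProduct c Γ (s, t)) ∨
      ((∀ s ∈ I, V s = 0) ∧ lam * c ^ 2 = 2 ∧ (∀ s ∈ I, deriv γ s ≠ 0) ∧
        ∃ (U : C2 ≃ₗᵢ[ℂ] C2) (x : ℝ → ℝ), IsRegularCurveOn x I ∧
          ∀ s ∈ I, ∀ t : ℝ, U (typeII c γ V (s, t)) = cliffordTorus c (x s, t)) := by
  obtain ⟨hγ, hV, hγeq, W, hW⟩ := hd
  have hO := hI.2.1
  have hunit : ∀ s ∈ I, inner ℂ (γ s) (γ s) = (1 : ℂ) := fun s hs => by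
    have h1 := (hγeq s hs).1
    rw [rdot_self] at h1
    rw [inner_self_eq_ofReal, h1, Complex.ofReal_one]
  -- The real part vanishes because `|γ| = 1`, the imaginary part by the Legendrian condition.
  have hleg : ∀ s ∈ I, inner ℂ (γ s) (deriv γ s) = (0 : ℂ) := fun s hs => by
    have d := hasDerivAt_of_smooth hO hγ hs
    have h1 := HasDerivAt.eq_of_eqOn hO hs hunit (hasDerivAt_const s (1 : ℂ)) (d.inner ℂ d)
    have h2 := (hγeq s hs).2
    change om _ _ = 0 at h2
    rw [om_eq_inner] at h2
    rw [← inner_conj_symm (deriv γ s), Complex.add_conj] at h1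
    rw [← inner_conj_symm, Complex.conj_im] at h2
    apply Complex.ext
    · simpa using h1
    · simpa using h2
  have hdc : ∀ s ∈ I, deriv (fun s => (c : ℂ) • γ s) s = (c : ℂ) • deriv γ s := fun s hs =>
    ((hasDerivAt_of_smooth hO hγ hs).const_smul (c : ℂ)).deriv
  have hquat : ∀ s ∈ I, deriv V s = W s • quat (γ s) := fun s hs => (hW s hs).deriv
  refine CyclicLagrangian.typeII_classification hlam hI hγ hunit hleg
    (isSol_of_inner_eq hO (hγ.const_smul (c : ℂ)) contDiffOn_const hV (by simp) (fun s hs t => ?_)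
      himm (fun s hs => ?_) (fun s hs => ?_) (by simp) hss)
  · simp only [typeII, cyc, smul_zero, add_zero, smul_smul, mul_comm]
  · rw [hdc s hs, inner_smul_left, inner_smul_right, ← inner_conj_symm (deriv γ s), hleg s hs]
    simp
  · rw [hquat s hs, inner_zero_left, inner_smul_left, inner_smul_right,
      ← inner_conj_symm (quat (γ s)), inner_quat_self]
    simp

/-- The coefficients lie on the two coordinate axes. The constant Lagrangian coefficient is the
derivative of `|α₁|² - |α₂|² = -1`, and the form of `V'` supplies the linear one. -/
lemma IsTypeIIIData.isSol {c : ℝ} {α : ℝ → C2} (hI : IsOpen I) (hd : IsTypeIIIData α V I)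
    (himm : IsImmersionOn (typeIII c α V) (strip I))
    (hss : IsSelfSimilarOn lam (typeIII c α V) (strip I)) :
    IsSol lam (fun s => !₂[c * α s 0, 0]) (fun s => !₂[0, c * α s 1]) V I := by
  obtain ⟨hα, hV, hαeq, W, hW⟩ := hd
  have d := fun i {s} (hs : s ∈ I) => hasDerivAt_apply (hasDerivAt_of_smooth hI hα hs) i
  have dA : ∀ s ∈ I, deriv (fun s => (!₂[c * α s 0, 0] : C2)) s = !₂[c * deriv α s 0, 0] :=
    fun s hs => (hasDerivAt_mk ((d 0 hs).const_mul (c : ℂ)) (hasDerivAt_const s (0 : ℂ))).deriv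
  have dB : ∀ s ∈ I, deriv (fun s => (!₂[0, c * α s 1] : C2)) s = !₂[0, c * deriv α s 1] :=
    fun s hs => (hasDerivAt_mk (hasDerivAt_const s (0 : ℂ)) ((d 1 hs).const_mul (c : ℂ))).deriv
  refine isSol_of_inner_eq hI
    (smooth_mk (contDiffOn_const.mul (smooth_apply hα 0)) contDiffOn_const)
    (smooth_mk contDiffOn_const (contDiffOn_const.mul (smooth_apply hα 1))) hV
    (by simp [inner_eq_coords]) (fun s hs t => ?_) himm
    (fun s hs => ?_) (fun s hs => ?_) (fun s hs => ?_) hss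
  · ext i
    rw [cyc_apply, conj_expI]
    fin_cases i <;> simp [typeIII] <;> ring
  · have h1 : ∀ s ∈ I, conj (α s 0) * α s 0 - conj (α s 1) * α s 1 = (-1 : ℂ) := by
      intro s hs
      rw [Complex.conj_mul', Complex.conj_mul', ← Complex.ofReal_pow, ← Complex.ofReal_pow,
        ← Complex.ofReal_sub, (hαeq s hs).1]
      simp
    have h2 := HasDerivAt.eq_of_eqOn hI hs h1 (hasDerivAt_const s (-1 : ℂ))
      (((d 0 hs).star.mul (d 0 hs)).sub ((d 1 hs).star.mul (d 1 hs)))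
    have h3 := congrArg Complex.re h2
    rw [dA s hs, dB s hs]
    simp [inner_eq_coords] at h3 ⊢
    linear_combination (-c ^ 2 / 2) * h3
  · rw [(hW s hs).deriv]
    simp only [inner_eq_coords]
    simp
    rw [← Complex.conj_mul']
    ring
  · rw [dA s hs, dB s hs]
    simp [inner_eq_coords]

/-- The relation `|α₁|² - |α₂|² = -1` keeps `α₂` nonzero and the two norms distinct, so
`IsSol.norm_eq` leaves only `α₁ = 0`. Then `α₂` is a unit constant and the surface is of type II
after reversing `t`. -/
lemma IsTypeIIIData.classification {c : ℝ} {α : ℝ → C2} (hlam : lam ≠ 0)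
    (hI : IsOpenInterval I) (hd : IsTypeIIIData α V I)
    (himm : IsImmersionOn (typeIII c α V) (strip I))
    (hss : IsSelfSimilarOn lam (typeIII c α V) (strip I)) :
    (∀ s ∈ I, α s 0 = 0) ∧ lam * c ^ 2 = 1 ∧
      ∃ (U : C2 ≃ₗᵢ[ℂ] C2) (Γ : ℝ → ℂ), IsSelfSimilarCurveOn lam Γ I ∧
        ∀ s ∈ I, ∀ t : ℝ, U (typeIII c α V (s, t)) = circleProduct c Γ (s, -t) := by
  have hO := hI.2.1
  have h := hd.isSol hO himm hss
  obtain ⟨hα, hV, hαeq, -⟩ := hd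
  obtain ⟨s₀, hs₀⟩ := hI.1
  have hc : c ≠ 0 := by
    rintro rfl
    rcases h.ne_zero hs₀ with h | h <;> exact h (by ext i; fin_cases i <;> simp)
  have hα₁ : ∀ s ∈ I, α s 0 = 0 := by
    intro s hs
    by_contra h0
    have h1 := (hαeq s hs).1
    have h2 : α s 1 ≠ 0 := by
      intro h2
      rw [h2] at h1
      have := sq_nonneg ‖α s 0‖
      simp at h1
      linarith
    have h3 := h.norm_eq hlam hO hs (fun h => by simpa [hc, h0] using congrArg (· 0) h)
      (fun h => by simpa [hc, h2] using congrArg (· 1) h)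
    simp [EuclideanSpace.norm_eq, Fin.sum_univ_two, hc] at h3
    rw [h3] at h1
    linarith
  have d := fun i {s} (hs : s ∈ I) => hasDerivAt_apply (hasDerivAt_of_smooth hO hα hs) i
  have hα₂ : ∀ s ∈ I, ‖α s 1‖ = 1 := by
    intro s hs
    have h1 := (hαeq s hs).1
    rw [hα₁ s hs] at h1
    simp at h1
    exact h1.resolve_right fun h => by linarith [norm_nonneg (α s 1)]
  have hdα : ∀ s ∈ I, deriv α s 1 = 0 := by
    intro s hs
    have h1 : ∀ s ∈ I, conj (α s 1) * α s 1 = (1 : ℂ) := by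
      intro s hs
      rw [Complex.conj_mul', hα₂ s hs]
      simp
    have h2 := HasDerivAt.eq_of_eqOn hO hs h1 (hasDerivAt_const s (1 : ℂ))
      ((d 1 hs).star.mul (d 1 hs))
    have h3 := (hαeq s hs).2
    rw [hα₁ s hs] at h3
    have h4 : conj (α s 1) * deriv α s 1 = 0 := by
      have h5 := congrArg Complex.re h2
      simp [cdot] at h3 h5
      apply Complex.ext
      · simp; linarith
      · simp; linarith
    exact (mul_eq_zero.1 h4).resolve_left fun h => by
      have := hα₂ s hs
      rw [map_eq_zero] at h
      simp [h] at this
  set γ : ℝ → C2 := fun s => !₂[0, α s 1] with hγ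
  have hdγ : ∀ s ∈ I, deriv γ s = 0 := fun s hs => by
    rw [(hasDerivAt_mk (hasDerivAt_const s (0 : ℂ)) (d 1 hs)).deriv, hdα s hs]
    ext i; fin_cases i <;> simp
  have hsol : IsSol lam (fun s => (c : ℂ) • γ s) (fun _ => 0) V I :=
    h.swap.congr hO (fun s hs => by ext i; fin_cases i <;> simp [hγ])
      (fun s hs => by rw [hα₁ s hs]; ext i; fin_cases i <;> simp)
  have hY : ∀ s ∈ I, ∀ t : ℝ, typeIII c α V (s, t) = typeII c γ V (s, -t) := by
    intro s hs t
    simp only [typeIII, typeII, hα₁ s hs]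
    ext i; fin_cases i <;> simp [hγ]
    ring
  rcases typeII_classification hlam hI (smooth_mk contDiffOn_const (smooth_apply hα 1))
    (fun s hs => by rw [inner_eq_coords]; simp [Complex.conj_mul', hα₂ s hs])
    (fun s hs => by rw [hdγ s hs, inner_zero_right]) hsol with
    ⟨-, hl, U, Γ, hΓ, hU⟩ | ⟨-, -, h, -⟩
  · exact ⟨hα₁, hl, U, Γ, hΓ, fun s hs t => by rw [hY s hs, hU s hs]⟩
  -- The Clifford torus needs `γ' ≠ 0`, whereas here `γ` is constant.
  · exact absurd (hdγ s₀ hs₀) (h s₀ hs₀)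

end Types

/-! ### Local congruence with the models -/

section Local

variable {lam : ℝ} {I : Set ℝ} {A B V : ℝ → C2} {Y : ℝ × ℝ → C2}

/-- The local classification, for a surface whose circles lie in Lagrangian planes. -/
lemma IsSol.locallyCongruentAt_of_ne_zero (hlam : lam ≠ 0) (hI : IsOpenInterval I)
    (h : IsSol lam A B V I) (hA : ∀ s ∈ I, A s ≠ 0) (hB : ∀ s ∈ I, B s ≠ 0)
    (hY : ∀ s ∈ I, ∀ t : ℝ, Y (s, t) = cyc (Complex.exp (t * Complex.I)) (A s) (B s) (V s))
    (himm : IsImmersionOn Y (strip I)) {p : ℝ × ℝ} (hp : p ∈ strip I) :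
    (∃ (I' : Set ℝ) (r φ : ℝ → ℝ), IsOpenInterval I' ∧
      ContDiffOn ℝ ∞ r I' ∧ ContDiffOn ℝ ∞ φ I' ∧ (∀ s ∈ I', 0 < r s) ∧
      IsEquivariantProfileOn lam (polarCurve r φ) I' ∧
      LocallyCongruentAt Y (strip I) p (typeI r φ (fun _ => 0)) (strip I')) ∨
    (Y p = 0 ∧ LocallyCongruentAt Y (strip I) p realPlane Set.univ) := by
  have hO := hI.2.1
  obtain ⟨r, φ, τ, U, hr, hφ, hτ, hpos, hsol, hU⟩ := h.exists_typeI hlam hI hA hB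
  have hUY : ∀ q ∈ strip I, U (Y q) = typeI r φ (fun s => U (V s)) (q.1, q.2 + τ q.1) :=
    fun q hq => by rw [← hU _ hq.1, ← hY _ hq.1]
  rcases typeI_classification hlam hI hr hφ hpos hsol with ⟨hV, hprof⟩ | ⟨φ₀, hφ₀⟩
  · refine .inl ⟨I, r, φ, hI, hr, hφ, hpos, hprof, ?_⟩
    refine locallyCongruentAt_of_comp (g := fun q => (q.1, q.2 + τ q.1)) (isOpen_strip hO)
      (isOpen_strip hO) himm (isOpen_strip hO) subset_rfl hp
      ((smooth_typeI hr hφ).differentiableOn (by simp))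
      (contDiffOn_fst.prodMk (contDiffOn_snd.add (hτ.comp contDiffOn_fst fun q hq => hq.1)))
      (fun q hq => ⟨hq.1, trivial⟩) U fun q hq => ?_
    rw [hUY q hq]
    simp only [typeI, hV _ hq.1]
  -- Turning by `e^{-iφ₀}` brings the plane to `ℝ²`; it is then named by a ray away from the origin
  -- and by the plane itself at the origin.
  · obtain ⟨R, hR⟩ := exists_unitary_smul (Complex.norm_exp_ofReal_mul_I (-φ₀))
    have hexp : Complex.exp (((-φ₀ : ℝ) : ℂ) * Complex.I) * Complex.exp (φ₀ * Complex.I) = 1 := by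
      rw [← Complex.exp_add]; simp
    have hreal : ∀ q ∈ strip I, ∃ x y : ℝ, (U.trans R) (Y q) = !₂[(x : ℂ), (y : ℂ)] := by
      intro q hq
      obtain ⟨hφq, x, y, hV⟩ := hφ₀ _ hq.1
      refine ⟨r q.1 * Real.cos (q.2 + τ q.1) + x, r q.1 * Real.sin (q.2 + τ q.1) + y, ?_⟩
      rw [LinearIsometryEquiv.trans_apply, hUY q hq, hR]
      simp only [typeI, polarCurve, hφq, hV]
      ext i
      fin_cases i
      · simp only [Fin.zero_eta, PiLp.smul_apply, PiLp.add_apply, smul_eq_mul]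
        simp only [Matrix.cons_val_zero]
        push_cast
        push_cast at hexp
        linear_combination (r q.1 * Complex.cos (q.2 + τ q.1) + x) * hexp
      · simp only [Fin.mk_one, PiLp.smul_apply, PiLp.add_apply, smul_eq_mul]
        simp only [Matrix.cons_val_one]
        push_cast
        push_cast at hexp
        linear_combination (r q.1 * Complex.sin (q.2 + τ q.1) + y) * hexp
    obtain ⟨h1, h2⟩ := locallyCongruentAt_plane (isOpen_strip hO) himm (U.trans R) hreal hp
    by_cases h0 : Y p = 0
    · exact .inr ⟨h0, h1⟩
    · exact .inl ⟨Set.Ioi 0, id, fun _ => 0, ⟨⟨1, Set.mem_Ioi.2 one_pos⟩, isOpen_Ioi, Set.ordConnected_Ioi⟩,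
        contDiffOn_id, contDiffOn_const, fun s hs => hs, isEquivariantProfileOn_line lam, h2 h0⟩

/-- The local classification, for a surface whose circles lie in complex lines. -/
lemma IsSol.locallyCongruentAt_circleProduct (hlam : lam ≠ 0) (hI : IsOpenInterval I)
    (h : IsSol lam A B V I) (hB : ∀ s ∈ I, B s = 0) {f : ℝ → ℝ} (hf : ContDiff ℝ ∞ f)
    (hY : ∀ s ∈ I, ∀ t : ℝ, Y (s, t) = cyc (Complex.exp (f t * Complex.I)) (A s) 0 (V s))
    (himm : IsImmersionOn Y (strip I)) {p : ℝ × ℝ} (hp : p ∈ strip I) :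
    ∃ (I' : Set ℝ) (r : ℝ) (Γ : ℝ → ℂ), IsOpenInterval I' ∧ 0 < r ∧ lam * r ^ 2 = 1 ∧
      IsSelfSimilarCurveOn lam Γ I' ∧
      LocallyCongruentAt Y (strip I) p (circleProduct r Γ) (strip I') := by
  have hO := hI.2.1
  obtain ⟨I', r, Γ, U, g, hI', hr, hl, hΓ, hg, hmaps, hU⟩ :=
    (h.congr hO (fun _ _ => rfl) fun s hs => (hB s hs).symm).exists_circleProduct hlam hI
  -- The function `f` allows for `t` and `-t`, according to which of the two coefficients survives.
  have hf' : ContDiffOn ℝ ∞ (fun q : ℝ × ℝ => (q.1, f q.2)) (strip I) :=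
    contDiffOn_fst.prodMk (hf.comp_contDiffOn contDiffOn_snd)
  have hmaps' : ∀ q ∈ strip I, (q.1, f q.2) ∈ strip I := fun q hq => ⟨hq.1, trivial⟩
  refine ⟨I', r, Γ, hI', hr, hl, hΓ, locallyCongruentAt_of_comp (g := fun q => g (q.1, f q.2))
    (isOpen_strip hO) (isOpen_strip hI'.2.1) himm (isOpen_strip hO) subset_rfl hp
    ((smooth_circleProduct hΓ.1.1).differentiableOn (by simp)) (hg.comp hf' hmaps')
    (fun q hq => hmaps _ (hmaps' q hq)) U fun q hq => ?_⟩
  rw [← hU _ hq.1, ← hY _ hq.1]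

end Local

end CyclicLagrangian

end

/-! ### The classification theorem -/

open CyclicLagrangian in
theorem theorem3 (lam : ℝ) (hlam : lam ≠ 0) :
    -- the local classification
    (∀ (I : Set ℝ) (Y : ℝ × ℝ → C2), IsOpenInterval I → IsCyclicOn Y I →
      IsImmersionOn Y (strip I) → IsLagrangianOn Y (strip I) →
      IsSelfSimilarOn lam Y (strip I) →
      ∀ p ∈ strip I,
        (∃ (I' : Set ℝ) (r φ : ℝ → ℝ), IsOpenInterval I' ∧
          ContDiffOn ℝ ∞ r I' ∧ ContDiffOn ℝ ∞ φ I' ∧ (∀ s ∈ I', 0 < r s) ∧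
          IsEquivariantProfileOn lam (polarCurve r φ) I' ∧
          LocallyCongruentAt Y (strip I) p (typeI r φ (fun _ => 0)) (strip I')) ∨
        (∃ (I' : Set ℝ) (r : ℝ) (Γ : ℝ → ℂ), IsOpenInterval I' ∧ 0 < r ∧ lam * r ^ 2 = 1 ∧
          IsSelfSimilarCurveOn lam Γ I' ∧
          LocallyCongruentAt Y (strip I) p (circleProduct r Γ) (strip I')) ∨
        (Y p = 0 ∧ LocallyCongruentAt Y (strip I) p realPlane Set.univ)) ∧
    -- type I: only the centered surfaces and the pieces of Lagrangian planes
    (∀ (I : Set ℝ) (r φ : ℝ → ℝ) (V : ℝ → C2), IsOpenInterval I → IsTypeIData r φ V I →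
      IsImmersionOn (typeI r φ V) (strip I) → IsSelfSimilarOn lam (typeI r φ V) (strip I) →
      ((∀ s ∈ I, V s = 0) ∧ IsEquivariantProfileOn lam (polarCurve r φ) I) ∨
      (∃ φ₀ : ℝ, ∀ s ∈ I, φ s = φ₀ ∧
        ∃ x y : ℝ, V s = Complex.exp (φ₀ * Complex.I) • !₂[(x : ℂ), (y : ℂ)])) ∧
    -- type II: only the products and the Clifford torus
    (∀ (I : Set ℝ) (c : ℝ) (γ V : ℝ → C2), IsOpenInterval I → IsTypeIIData γ V I →
      IsImmersionOn (typeII c γ V) (strip I) → IsSelfSimilarOn lam (typeII c γ V) (strip I) →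
      ((∃ γ₀ : C2, ∀ s ∈ I, γ s = γ₀) ∧ lam * c ^ 2 = 1 ∧
        ∃ (U : C2 ≃ₗᵢ[ℂ] C2) (Γ : ℝ → ℂ), IsSelfSimilarCurveOn lam Γ I ∧
          ∀ s ∈ I, ∀ t : ℝ, U (typeII c γ V (s, t)) = circleProduct c Γ (s, t)) ∨
      ((∀ s ∈ I, V s = 0) ∧ lam * c ^ 2 = 2 ∧
        ∃ (U : C2 ≃ₗᵢ[ℂ] C2) (x : ℝ → ℝ), IsRegularCurveOn x I ∧
          ∀ s ∈ I, ∀ t : ℝ, U (typeII c γ V (s, t)) = cliffordTorus c (x s, t))) ∧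
    -- type III: none, except for the degenerate case that is a product
    (∀ (I : Set ℝ) (c : ℝ) (α V : ℝ → C2), IsOpenInterval I → IsTypeIIIData α V I →
      IsImmersionOn (typeIII c α V) (strip I) → IsSelfSimilarOn lam (typeIII c α V) (strip I) →
      (∀ s ∈ I, α s 0 = 0) ∧ lam * c ^ 2 = 1 ∧
        ∃ (U : C2 ≃ₗᵢ[ℂ] C2) (Γ : ℝ → ℂ), IsSelfSimilarCurveOn lam Γ I ∧
          ∀ s ∈ I, ∀ t : ℝ, U (typeIII c α V (s, t)) = circleProduct c Γ (s, -t)) := by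
  refine ⟨fun I Y hI hcyc himm hlag hss p hp => ?_, fun I r φ V hI hd himm hss => ?_,
    fun I c γ V hI hd himm hss => ?_, fun I c α V hI hd himm hss => ?_⟩
  · obtain ⟨A, B, V, h, hY⟩ := exists_isSol_of_isCyclicOn hI hcyc himm hlag hss
    obtain ⟨K, hK⟩ := h.norm_sub_norm hI
    -- If `|A|² - |B|²` is a nonzero constant the norms never agree, so the smaller coefficient
    -- vanishes on all of `I`; if it is zero, neither coefficient ever vanishes.
    rcases lt_trichotomy K 0 with h0 | rfl | h0
    · have hA : ∀ s ∈ I, A s = 0 := by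
        intro s hs
        by_contra hA
        have hB : B s ≠ 0 := by
          intro hB
          have := hK s hs
          rw [hB, norm_zero] at this
          linarith [sq_nonneg ‖A s‖]
        have := hK s hs
        rw [h.norm_eq hlam hI.2.1 hs hA hB] at this
        linarith
      refine .inr (.inl (h.swap.locallyCongruentAt_circleProduct hlam hI hA contDiff_neg
        (fun s hs t => ?_) himm hp))
      rw [hY s hs, hA s hs]
      simp only [cyc, conj_expI, smul_zero, zero_add, add_zero, Complex.ofReal_neg, neg_mul]
    · have hne : ∀ s ∈ I, A s ≠ 0 ∧ B s ≠ 0 := by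
        intro s hs
        have h1 : ‖A s‖ = ‖B s‖ := by
          rw [← abs_norm (A s), ← abs_norm (B s), ← sq_eq_sq_iff_abs_eq_abs]
          linarith [hK s hs]
        rcases h.ne_zero hs with h2 | h2
        · exact ⟨h2, norm_ne_zero_iff.1 (h1 ▸ norm_ne_zero_iff.2 h2)⟩
        · exact ⟨norm_ne_zero_iff.1 (h1 ▸ norm_ne_zero_iff.2 h2), h2⟩
      rcases h.locallyCongruentAt_of_ne_zero hlam hI (fun s hs => (hne s hs).1)
        (fun s hs => (hne s hs).2) hY himm hp with h | h
      · exact .inl h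
      · exact .inr (.inr h)
    · have hB : ∀ s ∈ I, B s = 0 := by
        intro s hs
        by_contra hB
        have hA : A s ≠ 0 := by
          intro hA
          have := hK s hs
          rw [hA, norm_zero] at this
          linarith [sq_nonneg ‖B s‖]
        have := hK s hs
        rw [h.norm_eq hlam hI.2.1 hs hA hB] at this
        linarith
      refine .inr (.inl (h.locallyCongruentAt_circleProduct hlam hI hB contDiff_id
        (fun s hs t => ?_) himm hp))
      rw [hY s hs, hB s hs]
      rfl
  · have h := hd.isSol hI.2.1 himm hss
    obtain ⟨hr, hφ, -, hpos, -⟩ := hd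
    exact typeI_classification hlam hI hr hφ hpos h
  · rcases hd.typeII_classification hlam hI himm hss with h | ⟨hV, hl, -, h⟩
    · exact .inl h
    · exact .inr ⟨hV, hl, h⟩
  · exact hd.classification hlam hI himm hss
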